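/- **Setting.** A dimer is a finite connected bipartite graph (nodes black or white) embedded in the oriented torus $T^2$ so that all faces are discs; $F$ is the number of faces. Fix a positively oriented basis of $H_1(T^2;\mathbb Z)$. Zigzag paths are the closed paths that turn alternately to the adjacent edge counterclockwise around white nodes and clockwise around black nodes; each has a winding in $\mathbb Z^2$. The dimer is *properly ordered* if no zigzag path has winding $0$, zigzag paths with the same winding do not meet (nor does a path meet itself), and around each node the zigzag paths appear in the circular order of the directions of their windings. Each perfect matching $M$ has a lattice point in $\mathbb Z^2$, the exponent of its monomial in the Kasteleyn determinant; the toric diagram is the convex hull of these points. Let $\delta_M$ be $2$ on the edges of $M$ and $0$ on the other edges. A charge assignment is a function $R$ from edges to $\mathbb R$ with $\sum_{e\in v}R(e)=2$ for each node $v$ and $\sum_{e\in f}(1-R(e))=2$ for each face $f$ (sum over the sides of $f$). For $N$ colors, put $$a_N(R)=\frac{9N^2}{32}\Big[F+\sum_e (R(e)-1)^3\Big].$$ Call $R$ $a$-maximizing if it is a local maximum of $a_N$ on the set of charge assignments. We say that *$a$ has the area form* if the toric diagram is a polygon with nonempty interior and there is a choice of one perfect matching $M_i$ at each boundary lattice point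 $P_i$ of it, such that matchings at consecutive boundary lattice points differ exactly by the edges of a zigzag path, such that the $\delta_{M_i}$ are linearly independent and the charge assignments are exactly the functions $\sum_i\lambda_i\delta_{M_i}$ with $\lambda_i\in\mathbb R$, $\sum_i\lambda_i=1$, and such that for all $N$ and all such $\lambda$ $$a_N\Big(\sum_i\lambda_i\delta_{M_i}\Big)=\frac{9N^2}{4}\sum_{i,j,k}\operatorname{area}(P_iP_jP_k)\,\lambda_i\lambda_j\lambda_k .$$ The quiver has the faces as its nodes and an arrow across each edge $e$, with the white endpoint of $e$ on its left. The gauge invariant chiral primary operators are the mesonic operators, one for each closed directed loop of the quiver with at least one arrow, with $R$-charge the sum of $R(e)$ over its arrows, and the baryonic operators, one for each edge $e$ (the $N$-th exterior power of its field), with $R$-charge $N\,R(e)$. **Theorem.** Suppose that $a$ has the area form. Then there is exactly one $a$-maximizing charge assignment $R$, the same for all $N\ge 1$. For this $R$ every mesonic operator has $R$-charge at least $\frac23$, and there is an $N_0$ such that for all $N\ge N_0$ every gauge invariant chiral primary operator, mesonic or baryonic, has $R$-charge at least $\frac23$ in the theory with $N$ colors. If the dimer is properly ordered, then $a$ has the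 area form, and hence the same conclusions hold. -/

import Mathlib

open scoped Topology

/-- The set of cycles of a permutation (fixed points count as cycles). -/
abbrev Cycles {E : Type*} (π : Equiv.Perm E) : Type _ :=
  Quotient (Equiv.Perm.SameCycle.setoid π)

noncomputable instance Cycles.instFintype {E : Type*} [Fintype E] (π : Equiv.Perm E) :
    Fintype (Cycles π) :=
  Fintype.ofFinite _

/-- The wedge `(a, b) ∧ (c, d) = a d - b c`. -/
def wedge (u v : ℤ × ℤ) : ℤ := u.1 * v.2 - u.2 * v.1

/-- Twice the signed area of the closed polygon whose consecutive side vectors are listed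
(the side vectors add up to zero): the sum of the wedges `aᵢ ∧ aⱼ` over `i < j`. -/
def twiceSignedArea : List (ℤ × ℤ) → ℤ
  | [] => 0
  | a :: l => wedge a l.sum + twiceSignedArea l

/-- The area of the triangle with vertices `p`, `q`, `r`. -/
noncomputable def triangleArea (p q r : ℤ × ℤ) : ℝ := |(wedge (q - p) (r - p) : ℝ)| / 2

/-- A lattice point, seen in the real plane. -/
def toPlane (p : ℤ × ℤ) : ℝ × ℝ := ((p.1 : ℝ), (p.2 : ℝ))

/-- The vectors `u 0, …, u (n - 1)` are nonzero, their directions are distinct, and in this order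
they are met in one counterclockwise turn: the order is the circular order of the directions. -/
def InCircularOrder (n : ℕ) (u : ℕ → ℤ × ℤ) : Prop :=
  ∃ θ : ℕ → ℝ, (∀ i j, i < j → j < n → θ i < θ j ∧ θ j < θ i + 2 * Real.pi) ∧
    ∀ i < n, ∃ r : ℝ, 0 < r ∧ toPlane (u i) = (r * Real.cos (θ i), r * Real.sin (θ i))

/-- A dimer model on the torus with edge set `E`: a connected bipartite graph embedded in an
oriented torus whose faces are discs.  It is recorded by its rotation system.  `white e` is the
edge that follows `e` counterclockwise around the white endpoint of `e`, and `black e` the edge that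
follows `e` counterclockwise around its black endpoint.  White nodes, black nodes and faces are the
cycles of `white`, `black` and `black * white`; the surface is a torus because `V + F = E`. -/
structure Dimer (E : Type*) [Fintype E] where
  white : Equiv.Perm E
  black : Equiv.Perm E
  nonempty : Nonempty E
  connected : ∀ x y : E, ∃ g ∈ Subgroup.closure ({white, black} : Set (Equiv.Perm E)), g x = y
  euler : Fintype.card (Cycles white) + Fintype.card (Cycles black)
    + Fintype.card (Cycles (black * white)) = Fintype.card E

namespace Dimer

variable {E : Type*} [Fintype E]

/-- The cycle of `e` is the face on the left of `e`, when `e` is traversed from white to black. Its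
corner at the white endpoint of `e` lies between `e` and `white e`, so the sides of the face
are, for `x` in the cycle, the left side of `x` and the right side of `white x`. -/
def facePerm (D : Dimer E) : Equiv.Perm E := D.black * D.white

abbrev Face (D : Dimer E) : Type _ := Cycles D.facePerm

def leftFace (D : Dimer E) (e : E) : D.Face := Quotient.mk _ e

def rightFace (D : Dimer E) (e : E) : D.Face := Quotient.mk _ (D.white⁻¹ e)

/-- The vectors met along the boundary of the face on the left of `e`, counterclockwise from the
white endpoint of `e`, when the edge `x` has the vector `h x` from its white to its black end. -/
noncomputable def faceSteps (D : Dimer E) (h : E → ℤ × ℤ) (e : E) : List (ℤ × ℤ) :=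
  (List.range (Function.minimalPeriod D.facePerm e)).flatMap fun i =>
    let x := (D.facePerm⁻¹ ^ i) e
    [h x, -h (D.black⁻¹ x)]

/-- A positively oriented basis of the homology of the torus, given through its crossing numbers
with the edges.  The two coordinates of `crossing e` are the exponents of the two
variables in the Kasteleyn weight of `e`: the signed numbers of crossings of `e` (directed from
white to black) with two closed curves.  A closed curve has total crossing number zero with the
boundary of every face.  The two curves form a positively oriented basis exactly if their
intersection number is `1`, which says that the faces, laid out in the plane by means of
`crossing`, have total signed area `1`. -/
structure Marking (D : Dimer E) where
  crossing : E → ℤ × ℤ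
  closed : ∀ e, (D.faceSteps crossing e).sum = 0
  unimodular : ∑ f : D.Face, twiceSignedArea (D.faceSteps crossing f.out) = 2

/-- Zigzag paths are the cycles of this permutation.  The path of `e` traverses `e` from black to
white, then `white e` from white to black, then `zigzagPerm e` from black to white, and so on; it
passes counterclockwise around white nodes and clockwise around black nodes.
The two zigzag paths that contain an edge `e` are those of `e` and of `white⁻¹ e`. At a white node
(black node) the path of `x` passes between `x` and `white x` (between `x` and `black x`). -/
def zigzagPerm (D : Dimer E) : Equiv.Perm E := D.black⁻¹ * D.white

/-- The set of edges of the zigzag path of `e`. -/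
def zigzagEdges (D : Dimer E) (e : E) : Set E :=
  {x | D.zigzagPerm.SameCycle e x ∨ D.zigzagPerm.SameCycle e (D.white⁻¹ x)}

open Classical in
/-- The winding of the zigzag path of `e`. -/
noncomputable def winding (D : Dimer E) (m : D.Marking) (e : E) : ℤ × ℤ :=
  ∑ x with D.zigzagPerm.SameCycle e x, (m.crossing (D.white x) - m.crossing x)

/-- The order of the zigzag paths around every node is the circular order of the directions of
their windings; no zigzag path has winding zero, and paths with the same winding do not meet
(in particular no path meets itself). -/
def ProperlyOrdered (D : Dimer E) (m : D.Marking) : Prop :=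
  (∀ e, InCircularOrder (Function.minimalPeriod D.white e)
    fun i => D.winding m ((D.white ^ i) e)) ∧
  (∀ e, InCircularOrder (Function.minimalPeriod D.black e)
    fun i => D.winding m ((D.black ^ i) e)) ∧
  ∀ e, D.winding m e ≠ D.winding m (D.white⁻¹ e)

/-- A set of edges such that each node is an endpoint of exactly one of them. -/
def IsPerfectMatching (D : Dimer E) (M : Finset E) : Prop :=
  (∀ e, ∃! x, x ∈ M ∧ D.white.SameCycle e x) ∧ ∀ e, ∃! x, x ∈ M ∧ D.black.SameCycle e x

/-- The lattice point of a perfect matching: the exponent of its monomial in the Kasteleyn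
determinant. -/
def latticePoint (D : Dimer E) (m : D.Marking) (M : Finset E) : ℤ × ℤ := ∑ e ∈ M, m.crossing e

/-- The toric diagram: the convex hull of the exponents of the monomials that the perfect matchings
contribute to the Kasteleyn determinant. -/
def toricDiagram (D : Dimer E) (m : D.Marking) : Set (ℝ × ℝ) :=
  convexHull ℝ {p | ∃ M, D.IsPerfectMatching M ∧ p = toPlane (D.latticePoint m M)}

/-- Lattice points on the boundary of the toric diagram. -/
def boundaryPoints (D : Dimer E) (m : D.Marking) : Set (ℤ × ℤ) :=
  {p | toPlane p ∈ frontier (D.toricDiagram m)}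

/-- `p` and `q` are consecutive lattice points on the boundary of the toric diagram. -/
def Consecutive (D : Dimer E) (m : D.Marking) (p q : ℤ × ℤ) : Prop :=
  p ≠ q ∧ segment ℝ (toPlane p) (toPlane q) ⊆ frontier (D.toricDiagram m) ∧
    ∀ r : ℤ × ℤ, toPlane r ∈ segment ℝ (toPlane p) (toPlane q) → r = p ∨ r = q

open Classical in
/-- The `R`-charges of the edges for which each superpotential term has charge two (the charges add
up to `2` at each node) and the beta function of each gauge group vanishes
(`∑ (1 - R) = 2` over the sides of each face). -/
def chargeAssignments (D : Dimer E) : Set (E → ℝ) :=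
  {R | (∀ e, ∑ x with D.white.SameCycle e x, R x = 2) ∧
    (∀ e, ∑ x with D.black.SameCycle e x, R x = 2) ∧
    ∀ e, ∑ x with D.facePerm.SameCycle e x, ((1 - R x) + (1 - R (D.white x))) = 2}

/-- The cubic 't Hooft anomaly, with `N` colors. -/
noncomputable def anomaly (D : Dimer E) (N : ℕ) (R : E → ℝ) : ℝ :=
  9 * (N : ℝ) ^ 2 / 32 * ((Fintype.card D.Face : ℝ) + ∑ e, (R e - 1) ^ 3)

/-- `R` locally maximizes the anomaly among the admissible charge assignments. -/
def IsAMaximizing (D : Dimer E) (N : ℕ) (R : E → ℝ) : Prop :=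
  R ∈ D.chargeAssignments ∧ IsLocalMaxOn (D.anomaly N) D.chargeAssignments R

open Classical in
/-- The function equal to `2` on the edges of `M` and to `0` on the other edges. -/
noncomputable def delta (M : Finset E) (e : E) : ℝ := if e ∈ M then 2 else 0

/-- A choice of one perfect matching at each boundary lattice point of the toric diagram (which is
a genuine polygon), such that matchings at consecutive points differ by a zigzag path, and such
that the `δ_M` form a basis for the charge assignments. -/
structure BoundaryBasis (D : Dimer E) (m : D.Marking) where
  polygon : (interior (D.toricDiagram m)).Nonempty
  n : ℕ
  point : Fin n → ℤ × ℤ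
  point_injective : Function.Injective point
  range_point : Set.range point = D.boundaryPoints m
  matching : Fin n → Finset E
  isPerfectMatching : ∀ i, D.IsPerfectMatching (matching i)
  latticePoint_matching : ∀ i, D.latticePoint m (matching i) = point i
  zigzag : ∀ i j, D.Consecutive m (point i) (point j) →
    ∃ e, symmDiff (matching i : Set E) (matching j : Set E) = D.zigzagEdges e
  independent : LinearIndependent ℝ fun i => delta (matching i)
  spanning : ∀ R : E → ℝ, R ∈ D.chargeAssignments ↔
    ∃ lam : Fin n → ℝ, ∑ i, lam i = 1 ∧ R = ∑ i, lam i • delta (matching i)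

/-- In terms of the weights `λᵢ` with respect to a basis of boundary perfect matchings,
`a = (9 N² / 4) ∑ area(Pᵢ Pⱼ Pₖ) λᵢ λⱼ λₖ`. -/
def HasAreaForm (D : Dimer E) (m : D.Marking) : Prop :=
  ∃ B : D.BoundaryBasis m, ∀ (N : ℕ) (lam : Fin B.n → ℝ), ∑ i, lam i = 1 →
    D.anomaly N (∑ i, lam i • delta (B.matching i)) =
      9 * (N : ℝ) ^ 2 / 4 * ∑ i, ∑ j, ∑ k,
        triangleArea (B.point i) (B.point j) (B.point k) * lam i * lam j * lam k

/-- A loop of the quiver: the nodes of the quiver are the faces, and each edge `e` of the dimer is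
an arrow across `e`, with the white endpoint of `e` on its left. A loop has at least one arrow. -/
structure QuiverLoop (D : Dimer E) where
  k : ℕ
  arrow : Fin (k + 1) → E
  composable : ∀ i, D.leftFace (arrow i) = D.rightFace (arrow (i + 1))

/-- The `R`-charge of the mesonic operator of a loop, the trace of the product of its fields. -/
def QuiverLoop.charge {D : Dimer E} (l : D.QuiverLoop) (R : E → ℝ) : ℝ := ∑ i, R (l.arrow i)

/-- The gauge invariant chiral primary operators: the mesonic ones, given by the loops of the
quiver, and the baryonic ones, the `N`-th exterior powers of the bifundamental
fields. -/
inductive GaugeInvariantOperator (D : Dimer E) where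
  | meson (l : D.QuiverLoop)
  | baryon (e : E)

/-- The `R`-charge of an operator in the theory with `N` colors. -/
def GaugeInvariantOperator.charge {D : Dimer E} (N : ℕ) (R : E → ℝ) :
    D.GaugeInvariantOperator → ℝ
  | .meson l => l.charge R
  | .baryon e => N * R e

/-- There is a unique `a`-maximizing `R` (the same for all `N`); for it each mesonic loop has
charge at least `2/3`, and for all large `N` each gauge invariant chiral primary operator does. -/
def SatisfiesUnitarityBound (D : Dimer E) : Prop :=
  ∃ R : E → ℝ,
    (∀ N : ℕ, 0 < N → ∀ R' : E → ℝ, D.IsAMaximizing N R' ↔ R' = R) ∧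
    (∀ l : D.QuiverLoop, 2 / 3 ≤ l.charge R) ∧
    ∃ N₀ : ℕ, ∀ N ≥ N₀, ∀ O : D.GaugeInvariantOperator, 2 / 3 ≤ O.charge N R

end Dimer

set_option linter.unusedSectionVars false

/-! In the coordinates `λ` the anomaly is, up to a positive factor, the form `cubic`. Its gradient
at `λ` is three times the function `weight`, `p ↦ ∑ area(p Pⱼ Pₖ) λⱼ λₖ`, evaluated at the points
`Pᵢ`. For nonnegative weights this function is convex in the plane, and it is affine on a segment
whose ends are not separated by a line through two weighted points. The study of the maximum rests
on this.

Weights supported on the corners form a compact simplex, so a maximum `x` exists there, and `weight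
≤ cubic` at every corner, with equality where `x` is nonzero. No corner has weight zero
(`pos_of_isMax`): the segment from such a corner to a weighted point would cross a side of the hull
of the weighted points, where `weight` equals the maximum by affinity and is smaller than it by
strict convexity. Shifting the weight of a point inside a side to its two neighbors has no
first-order effect and a positive second-order one (`cubic_le_of_move`), so `x` is a local maximum
among all real weights of sum one. It is the only one: a cubic polynomial of one variable with two
local maxima is constant (`eq_of_two_localMax`), and `cubic` is constant on no line through `x`
(`exists_max`).

A mesonic loop is a closed cochain, so the number of edges that it shares with a perfect matching is
an affine function `h` of the lattice point, nonnegative on the polygon. Every edge lies in the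
matching of some corner (`exists_corner_mem`), hence `h(p) ≥ 1` for some corner `p`. Barycentric
coordinates give `h(p) area(qrs) ≤ h(q) area(prs) + h(r) area(qps) + h(s) area(qrp)`. Averaging over
`q`, `r`, `s` with the weights `x` yields `h(p) cubic ≤ 3 h̄ weight(p) ≤ 3 h̄ cubic`, so `h̄ ≥ 1/3`,
and the charge is `2 h̄ ≥ 2/3` (`meson_bound`). A baryon has charge `N R(e)` with `R(e) > 0`, which
suffices for large `N`.

If the dimer is properly ordered, sort the zigzag paths by the angles of their windings. Around each
node this order drops exactly once, and the edges of the drops form a perfect matching. Cutting the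
circular order elsewhere gives one matching for each path (`SweepOrder.mat`), and passing a path
changes the matching by the alternating charge `zeta` of that path. The lattice points thus run
through a closed path whose steps are the windings. Windings are primitive (`isCoprime_winding`) and
all matchings stay on the left of each step, so the path meets exactly the boundary lattice points.
The form is computed by letting one of three matchings advance (`triple_mat`). The contributions of
the nodes are nonnegative, which makes the signed areas nonnegative. A dimension count
(`finrank_ker_chargeMatrix`) shows that these matchings span all charge assignments.

Both halves use the first cohomology of the torus (`Marking.exists_potential`): modulo exact
cochains, every closed cochain is a combination of the two coordinates of the marking. The
coefficients for a zigzag path are its winding turned by a right angle. -/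

theorem perm_apply_inv {E : Type*} (π : Equiv.Perm E) (x : E) : π (π⁻¹ x) = x := by simp

theorem perm_inv_apply {E : Type*} (π : Equiv.Perm E) (x : E) : π⁻¹ (π x) = x := by simp

/-! ### Sums over the cycles of a permutation -/

section CycleSums

open Classical

variable {E : Type*} [Fintype E]

theorem cycles_mk_eq_iff {π : Equiv.Perm E} {x y : E} :
    (Quotient.mk _ x : Cycles π) = Quotient.mk _ y ↔ π.SameCycle x y :=
  Quotient.eq

theorem cycles_mk_apply (π : Equiv.Perm E) (x : E) :
    (Quotient.mk _ (π x) : Cycles π) = Quotient.mk _ x :=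
  cycles_mk_eq_iff.2 (Equiv.Perm.sameCycle_apply_left.2 (Equiv.Perm.SameCycle.refl _ _))

theorem cycles_mk_inv_apply (π : Equiv.Perm E) (x : E) :
    (Quotient.mk _ (π⁻¹ x) : Cycles π) = Quotient.mk _ x := by
  rw [← cycles_mk_apply π (π⁻¹ x), perm_apply_inv]

theorem sum_cycles {M : Type*} [AddCommMonoid M] (π : Equiv.Perm E) (g : E → M) :
    ∑ c : Cycles π, ∑ x with π.SameCycle c.out x, g x = ∑ x, g x := by
  rw [← Finset.sum_fiberwise (s := Finset.univ) (g := fun x => (Quotient.mk _ x : Cycles π))]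
  refine Finset.sum_congr rfl fun c _ => Finset.sum_congr ?_ fun _ _ => rfl
  ext x
  simp only [Finset.mem_filter, Finset.mem_univ, true_and]
  rw [← cycles_mk_eq_iff, Quotient.out_eq, eq_comm]

theorem sum_sameCycle_comp {M : Type*} [AddCommMonoid M] (π : Equiv.Perm E) (g : E → M) (x : E) :
    ∑ y with π.SameCycle x y, g (π y) = ∑ y with π.SameCycle x y, g y := by
  refine Finset.sum_bij (fun y _ => π y) ?_ (fun _ _ _ _ h => π.injective h) ?_ (fun _ _ => rfl)
  · intro y hy
    simpa [Equiv.Perm.sameCycle_apply_right] using hy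
  · intro y hy
    refine ⟨π⁻¹ y, ?_, by simp⟩
    have := (Finset.mem_filter.1 hy).2
    rw [Finset.mem_filter]
    refine ⟨Finset.mem_univ _, ?_⟩
    rwa [← Equiv.Perm.sameCycle_apply_right, perm_apply_inv]

/-- Face walks and circular orders list iterates, while charges and windings are sums over cycles.
This passes from one to the other. -/
theorem sum_range_minimalPeriod {M : Type*} [AddCommMonoid M] (π : Equiv.Perm E) (g : E → M)
    (x : E) :
    ∑ i ∈ Finset.range (Function.minimalPeriod π x), g ((π ^ i) x) =
      ∑ y with π.SameCycle x y, g y := by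
  have hper : x ∈ Function.periodicPts π :=
    Function.Injective.mem_periodicPts π.injective x
  refine Finset.sum_bij (fun i _ => (π ^ i) x) ?_ ?_ ?_ (fun _ _ => rfl)
  · intro i _
    simp only [Finset.mem_filter, Finset.mem_univ, true_and]
    exact ⟨i, by simp⟩
  · intro i hi j hj h
    refine Function.iterate_injOn_Iio_minimalPeriod (f := π) (x := x)
      (by simpa using hi) (by simpa using hj) ?_
    simpa [Equiv.Perm.iterate_eq_pow] using h
  · intro y hy
    obtain ⟨k, hk⟩ := (Finset.mem_filter.1 hy).2.exists_nat_pow_eq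
    refine ⟨k % Function.minimalPeriod π x, ?_, ?_⟩
    · exact Finset.mem_range.2 (Nat.mod_lt _ (Function.minimalPeriod_pos_of_mem_periodicPts hper))
    · rw [← hk, ← Equiv.Perm.iterate_eq_pow, ← Equiv.Perm.iterate_eq_pow,
        Function.iterate_mod_minimalPeriod_eq]

/-- Both periods count the elements of the same cycle. -/
theorem minimalPeriod_inv (π : Equiv.Perm E) (x : E) :
    Function.minimalPeriod (π⁻¹ : Equiv.Perm E) x = Function.minimalPeriod π x := by
  have h1 := sum_range_minimalPeriod π (fun _ => (1 : ℕ)) x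
  have h2 := sum_range_minimalPeriod π⁻¹ (fun _ => (1 : ℕ)) x
  simp only [Equiv.Perm.sameCycle_inv] at h2
  rw [← h1] at h2
  simpa using h2

end CycleSums

/-! ### Signed areas of closed polygons -/

theorem twiceSignedArea_append (l l' : List (ℤ × ℤ)) :
    twiceSignedArea (l ++ l') = twiceSignedArea l + twiceSignedArea l' + wedge l.sum l'.sum := by
  induction l with
  | nil => simp [twiceSignedArea, wedge]
  | cons a l ih =>
    simp only [List.cons_append, twiceSignedArea, ih, List.sum_append, List.sum_cons, wedge,
      Prod.fst_add, Prod.snd_add]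
    ring

/-- If a combination of the coordinates of the steps of a polygon has the potential `p`, then the
area of the polygon is computed by summation by parts. -/
theorem twiceSignedArea_flatMap (u v : ℕ → ℤ × ℤ) (x y : ℝ) (p q : ℕ → ℝ)
    (hu : ∀ i, x * (u i).1 + y * (u i).2 = q i - p i)
    (hv : ∀ i, x * (v i).1 + y * (v i).2 = p (i + 1) - q i) (n : ℕ) :
    let l := (List.range n).flatMap fun i => [u i, v i]
    (x * l.sum.1 + y * l.sum.2 = p n - p 0) ∧
    y * (twiceSignedArea l : ℝ) = (p n + p 0) * l.sum.1 -
      ∑ i ∈ Finset.range n, ((u i).1 * (p i + q i) + (v i).1 * (q i + p (i + 1))) ∧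
    x * (twiceSignedArea l : ℝ) = -(p n + p 0) * l.sum.2 +
      ∑ i ∈ Finset.range n, ((u i).2 * (p i + q i) + (v i).2 * (q i + p (i + 1))) := by
  induction n with
  | zero => simp [twiceSignedArea]
  | succ n ih =>
    obtain ⟨h0, h1, h2⟩ := ih
    have hu' := hu n
    have hv' := hv n
    simp only [List.range_succ, List.flatMap_append, List.flatMap_singleton,
      twiceSignedArea_append, List.sum_append, Finset.sum_range_succ]
    generalize (List.flatMap (fun i => [u i, v i]) (List.range n)) = l at *
    simp only [twiceSignedArea, wedge, List.sum_cons, List.sum_nil, add_zero, Prod.fst_add,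
      Prod.snd_add, Prod.fst_zero, Prod.snd_zero]
    push_cast
    refine ⟨by linarith, ?_, ?_⟩
    · rw [mul_add, mul_add, h1]
      -- The potential eliminates the coordinate that is multiplied by `y`; what remains is
      -- polynomial.
      have e1 : y * (u n).2 = q n - p n - x * (u n).1 := by linarith
      have e2 : y * (v n).2 = p (n + 1) - q n - x * (v n).1 := by linarith
      have e3 : y * l.sum.2 = p n - p 0 - x * l.sum.1 := by linarith
      linear_combination (l.sum.1 + (u n).1 : ℝ) * e2 + (l.sum.1 : ℝ) * e1 -
        (v n).1 * e1 - ((u n).1 + (v n).1 : ℝ) * e3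
    · rw [mul_add, mul_add, h2]
      have e1 : x * (u n).1 = q n - p n - y * (u n).2 := by linarith
      have e2 : x * (v n).1 = p (n + 1) - q n - y * (v n).2 := by linarith
      have e3 : x * l.sum.1 = p n - p 0 - y * l.sum.2 := by linarith
      linear_combination -(l.sum.2 + (u n).2 : ℝ) * e2 - (l.sum.2 : ℝ) * e1 +
        (v n).2 * e1 + ((u n).2 + (v n).2 : ℝ) * e3

/-! ### Connectedness, face walks and the normalization of the marking -/

namespace Dimer

section Topology

open Classical

variable {E : Type*} [Fintype E] (D : Dimer E)

/-- The connectedness of the graph enters the proof only here. -/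
theorem eq_of_invariant {α : Type*} (f : E → α) (hw : ∀ x, f (D.white x) = f x)
    (hb : ∀ x, f (D.black x) = f x) (x y : E) : f x = f y := by
  obtain ⟨g, hg, rfl⟩ := D.connected x y
  have key : ∀ z, f (g z) = f z := by
    induction hg using Subgroup.closure_induction with
    | mem g hg =>
      rcases hg with rfl | rfl
      · exact hw
      · exact hb
    | one => intro z; rfl
    | mul a b _ _ ha hb => intro z; rw [Equiv.Perm.mul_apply, ha, hb]
    | inv a _ ha => intro z; rw [← ha (a⁻¹ z), perm_apply_inv]
  exact (key x).symm

theorem facePerm_apply (x : E) : D.facePerm x = D.black (D.white x) := rfl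

theorem facePerm_inv_apply (x : E) : D.facePerm⁻¹ x = D.white⁻¹ (D.black⁻¹ x) := by
  simp [facePerm, mul_inv_rev]

theorem zigzagPerm_apply (x : E) : D.zigzagPerm x = D.black⁻¹ (D.white x) := rfl

theorem zigzagPerm_inv_apply (x : E) : D.zigzagPerm⁻¹ x = D.white⁻¹ (D.black x) := by
  simp [zigzagPerm, mul_inv_rev]

theorem sum_comp_perm {M : Type*} [AddCommMonoid M] (π : Equiv.Perm E) (g : E → M) :
    ∑ x, g (π x) = ∑ x, g x := Equiv.sum_comp π g

/-- The walk follows `facePerm⁻¹`. Its return steps are re-indexed by `black⁻¹ (facePerm x) = white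
x`. -/
theorem sum_faceSteps (h : E → ℤ × ℤ) (e : E) :
    (D.faceSteps h e).sum = ∑ x with D.facePerm.SameCycle e x, (h x - h (D.white x)) := by
  have h1 : ∀ n : ℕ, ((List.range n).flatMap fun i =>
      let x := (D.facePerm⁻¹ ^ i) e
      [h x, -h (D.black⁻¹ x)]).sum =
      ∑ i ∈ Finset.range n, (h ((D.facePerm⁻¹ ^ i) e) - h (D.black⁻¹ ((D.facePerm⁻¹ ^ i) e))) := by
    intro n
    induction n with
    | zero => simp
    | succ n ih =>
      rw [List.range_succ, List.flatMap_append, List.sum_append, ih, Finset.sum_range_succ]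
      simp [sub_eq_add_neg]
  have h2 := sum_range_minimalPeriod D.facePerm⁻¹ (fun x => h x - h (D.black⁻¹ x)) e
  simp only [Equiv.Perm.sameCycle_inv, minimalPeriod_inv] at h2
  rw [faceSteps, h1, h2, Finset.sum_sub_distrib, Finset.sum_sub_distrib]
  congr 1
  rw [← sum_sameCycle_comp]
  simp [facePerm_apply]

variable {D} in
theorem Marking.sum_face (m : D.Marking) (e : E) :
    ∑ x with D.facePerm.SameCycle e x, (m.crossing x - m.crossing (D.white x)) = 0 := by
  rw [← sum_faceSteps, m.closed]

variable {D} in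
/-- A combination of the coordinates of the crossing numbers that has a potential at the corners
of the faces is computed from the potential by summation by parts. -/
theorem Marking.coeff_of_potential (m : D.Marking) (x y : ℝ) (p q : E → ℝ)
    (h1 : ∀ e, x * (m.crossing e).1 + y * (m.crossing e).2 = q e - p e)
    (h2 : ∀ e, x * (m.crossing (D.black⁻¹ e)).1 + y * (m.crossing (D.black⁻¹ e)).2 =
      q e - p (D.facePerm⁻¹ e)) :
    2 * y = -∑ e, ((m.crossing e).1 * (p e + q e) -
        (m.crossing (D.black⁻¹ e)).1 * (q e + p (D.facePerm⁻¹ e))) ∧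
    2 * x = ∑ e, ((m.crossing e).2 * (p e + q e) -
        (m.crossing (D.black⁻¹ e)).2 * (q e + p (D.facePerm⁻¹ e))) := by
  -- Summation by parts around one face; the boundary terms carry the factor `l.sum`, which is zero
  -- for a closed walk.
  have key : ∀ e, y * (twiceSignedArea (D.faceSteps m.crossing e) : ℝ) =
      -∑ z with D.facePerm.SameCycle e z, ((m.crossing z).1 * (p z + q z) -
        (m.crossing (D.black⁻¹ z)).1 * (q z + p (D.facePerm⁻¹ z))) ∧
      x * (twiceSignedArea (D.faceSteps m.crossing e) : ℝ) =
      ∑ z with D.facePerm.SameCycle e z, ((m.crossing z).2 * (p z + q z) -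
        (m.crossing (D.black⁻¹ z)).2 * (q z + p (D.facePerm⁻¹ z))) := by
    intro e
    have hs : ∀ i, (D.facePerm⁻¹ ^ (i + 1)) e = D.facePerm⁻¹ ((D.facePerm⁻¹ ^ i) e) := by
      intro i; rw [pow_succ', Equiv.Perm.mul_apply]
    have := twiceSignedArea_flatMap (fun i => m.crossing ((D.facePerm⁻¹ ^ i) e))
      (fun i => -m.crossing (D.black⁻¹ ((D.facePerm⁻¹ ^ i) e))) x y
      (fun i => p ((D.facePerm⁻¹ ^ i) e)) (fun i => q ((D.facePerm⁻¹ ^ i) e))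
      (fun i => h1 _) (fun i => by
        have := h2 ((D.facePerm⁻¹ ^ i) e)
        simp only [hs, Prod.fst_neg, Prod.snd_neg, Int.cast_neg]
        linarith) (Function.minimalPeriod D.facePerm e)
    obtain ⟨-, h3, h4⟩ := this
    have hc := m.closed e
    have hl : D.faceSteps m.crossing e = (List.range (Function.minimalPeriod D.facePerm e)).flatMap
      fun i => [m.crossing ((D.facePerm⁻¹ ^ i) e),
        -m.crossing (D.black⁻¹ ((D.facePerm⁻¹ ^ i) e))] := rfl
    rw [← hl, hc] at h3 h4
    rw [h3, h4, ← minimalPeriod_inv]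
    have g1 := sum_range_minimalPeriod D.facePerm⁻¹ (fun z => ((m.crossing z).1 : ℝ) * (p z + q z) -
        (m.crossing (D.black⁻¹ z)).1 * (q z + p (D.facePerm⁻¹ z))) e
    have g2 := sum_range_minimalPeriod D.facePerm⁻¹ (fun z => ((m.crossing z).2 : ℝ) * (p z + q z) -
        (m.crossing (D.black⁻¹ z)).2 * (q z + p (D.facePerm⁻¹ z))) e
    simp only [Equiv.Perm.sameCycle_inv] at g1 g2
    rw [← g1, ← g2]
    simp only [hs, sub_eq_add_neg, Prod.fst_neg, Prod.snd_neg, Int.cast_neg, Prod.fst_zero,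
      Prod.snd_zero, Int.cast_zero, mul_zero, zero_add, neg_mul, and_self]
  -- Unimodularity fixes the scale: the coefficients times the total signed area of the faces are
  -- what the sums compute.
  have hu : ∑ f : D.Face, (twiceSignedArea (D.faceSteps m.crossing f.out) : ℝ) = 2 := by
    exact_mod_cast m.unimodular
  constructor
  · rw [mul_comm, ← hu, Finset.mul_sum, Finset.sum_congr rfl fun f _ => (key f.out).1,
      Finset.sum_neg_distrib, sum_cycles]
  · rw [mul_comm, ← hu, Finset.mul_sum, Finset.sum_congr rfl fun f _ => (key f.out).2, sum_cycles]

end Topology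

end Dimer

/-- The kernels of a matrix and of its transpose have dimensions that differ as much as the
dimensions of the two spaces. -/
theorem finrank_ker_add_card {ι κ : Type*} [Fintype ι] [Fintype κ] [DecidableEq ι] [DecidableEq κ]
    (A : Matrix κ ι ℝ) :
    Module.finrank ℝ (LinearMap.ker A.mulVecLin) + Fintype.card κ =
      Fintype.card ι + Module.finrank ℝ (LinearMap.ker A.transpose.mulVecLin) := by
  have h1 := LinearMap.finrank_range_add_finrank_ker A.mulVecLin
  have h2 := LinearMap.finrank_range_add_finrank_ker A.transpose.mulVecLin
  have h3 : Module.finrank ℝ (LinearMap.range A.transpose.mulVecLin) =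
    Module.finrank ℝ (LinearMap.range A.mulVecLin) := Matrix.rank_transpose A
  rw [Module.finrank_fintype_fun_eq_card] at h1 h2
  omega

theorem finrank_le_one_of_forall {V : Type*} [AddCommGroup V] [Module ℝ V] (S : Submodule ℝ V)
    (v : V) (h : ∀ w ∈ S, ∃ r : ℝ, w = r • v) : Module.finrank ℝ S ≤ 1 := by
  have : S ≤ Submodule.span ℝ {v} := by
    intro w hw
    obtain ⟨r, rfl⟩ := h w hw
    exact Submodule.mem_span_singleton.2 ⟨r, rfl⟩
  exact (Submodule.finrank_mono this).trans (finrank_span_singleton_le v)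
where
  finrank_span_singleton_le (v : V) : Module.finrank ℝ (Submodule.span ℝ {v}) ≤ 1 := by
    simpa using finrank_span_le_card (R := ℝ) ({v} : Set V)

/-! ### The first cohomology of the torus -/

namespace Dimer

section Homology

open Classical

variable {E : Type*} [Fintype E] {D : Dimer E}

/-- The coefficients of the class of the crossing numbers of a zigzag path with the edges (more
generally of a combination `χ` of zigzag paths). -/
theorem Marking.coeff_of_zigzag (m : D.Marking) (χ φ η : E → ℝ) (x y : ℝ)
    (hχ : ∀ e, χ (D.zigzagPerm e) = χ e)
    (hφ : ∀ e, φ (D.white e) = φ e) (hη : ∀ e, η (D.black e) = η e)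
    (h : ∀ e, χ e + χ (D.white⁻¹ e) =
      x * (m.crossing e).1 + y * (m.crossing e).2 + φ e + η e) :
    x = ∑ e, χ e * ((m.crossing (D.white e)).2 - (m.crossing e).2) ∧
      y = -∑ e, χ e * ((m.crossing (D.white e)).1 - (m.crossing e).1) := by
  have hχ' : ∀ z, χ (D.white⁻¹ (D.black z)) = χ z := by
    intro z
    rw [← zigzagPerm_inv_apply, ← hχ, perm_apply_inv]
  have hφ' : ∀ e, φ (D.white⁻¹ e) = φ e := fun e => by rw [← hφ, perm_apply_inv]
  have hη' : ∀ e, η (D.black⁻¹ e) = η e := fun e => by rw [← hη, perm_apply_inv]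
  have hq : ∀ e, χ (D.white⁻¹ e) = χ (D.black⁻¹ e) := by
    intro e
    rw [← hχ' (D.black⁻¹ e), perm_apply_inv]
  -- The two functions are potentials at the white and black corners of the face to the left of `e`.
  -- They are potentials of corners, not of nodes: `χ` gives the jump across the path that cuts the
  -- corner off.
  obtain ⟨h1, h2⟩ := m.coeff_of_potential x y (fun e => -χ e + φ e)
    (fun e => χ (D.white⁻¹ e) - η e)
    (fun e => by linarith [h e])
    (fun e => by
      have := h (D.black⁻¹ e)
      rw [facePerm_inv_apply, hφ', hη'] at *
      linarith [hq e])
  -- After the second term is shifted by `black`, the exact parts `φ` and `η` cancel and only the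
  -- jumps remain.
  have key : ∀ a : E → ℝ, ∑ e, (a e * ((-χ e + φ e) + (χ (D.white⁻¹ e) - η e)) -
      a (D.black⁻¹ e) * ((χ (D.white⁻¹ e) - η e) +
        (-χ (D.facePerm⁻¹ e) + φ (D.facePerm⁻¹ e)))) =
      2 * ∑ e, χ e * (a (D.white e) - a e) := by
    intro a
    have e1 : ∑ e, a (D.black⁻¹ e) * ((χ (D.white⁻¹ e) - η e) +
        (-χ (D.facePerm⁻¹ e) + φ (D.facePerm⁻¹ e))) =
        ∑ z, a z * (χ z - η z - χ (D.white⁻¹ z) + φ z) := by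
      rw [← sum_comp_perm D.black]
      refine Finset.sum_congr rfl fun z _ => ?_
      rw [facePerm_inv_apply, hφ', perm_inv_apply, hχ', hη]
      ring
    have e2 : ∑ e, χ e * a (D.white e) = ∑ e, χ (D.white⁻¹ e) * a e := by
      rw [← sum_comp_perm D.white (fun e => χ (D.white⁻¹ e) * a e)]
      simp only [perm_inv_apply]
    rw [Finset.sum_sub_distrib, e1]
    simp only [mul_sub, Finset.sum_sub_distrib]
    rw [e2, ← Finset.sum_sub_distrib, ← mul_sub, ← Finset.sum_sub_distrib, Finset.mul_sum]
    refine Finset.sum_congr rfl fun z _ => ?_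
    ring
  rw [key (fun e => ((m.crossing e).1 : ℝ))] at h1
  rw [key (fun e => ((m.crossing e).2 : ℝ))] at h2
  constructor <;> linarith

variable (D) in
/-- The exact cochains, those of a function on the nodes. -/
def nodeMap : (Cycles D.white → ℝ) × (Cycles D.black → ℝ) →ₗ[ℝ] (E → ℝ) where
  toFun p e := p.1 (Quotient.mk _ e) + p.2 (Quotient.mk _ e)
  map_add' p q := by ext e; simp; ring
  map_smul' r p := by ext e; simp; ring

variable (D) in
/-- The boundaries of the faces. -/
noncomputable def faceMatrix : Matrix D.Face E ℝ :=
  Matrix.of fun f e => (if D.leftFace e = f then 1 else 0) - if D.rightFace e = f then 1 else 0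

theorem leftFace_eq_iff {x y : E} : D.leftFace x = D.leftFace y ↔ D.facePerm.SameCycle x y :=
  cycles_mk_eq_iff

theorem rightFace_white (x : E) : D.rightFace (D.white x) = D.leftFace x := by
  rw [rightFace, perm_inv_apply, leftFace]

theorem faceMatrix_mulVec (ψ : E → ℝ) (e : E) :
    D.faceMatrix.mulVec ψ (D.leftFace e) =
      ∑ x with D.facePerm.SameCycle e x, (ψ x - ψ (D.white x)) := by
  simp only [Matrix.mulVec, dotProduct, faceMatrix, Matrix.of_apply, sub_mul, ite_mul, one_mul,
    zero_mul, Finset.sum_sub_distrib]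
  congr 1
  · rw [Finset.sum_filter]
    refine Finset.sum_congr rfl fun x _ => ?_
    simp only [← leftFace_eq_iff, eq_comm (a := D.leftFace e)]
  · rw [← sum_comp_perm D.white, Finset.sum_filter]
    refine Finset.sum_congr rfl fun x _ => ?_
    simp only [rightFace_white, ← leftFace_eq_iff, eq_comm (a := D.leftFace e)]

/-- A relation between the face equations is a function on faces that takes the same value on both
sides of every edge. It is constant by connectedness, so the equations have at most one relation. -/
theorem finrank_ker_faceMatrix :
    Module.finrank ℝ (LinearMap.ker D.faceMatrix.mulVecLin) + Fintype.card D.Face ≤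
      Fintype.card E + 1 := by
  rw [finrank_ker_add_card]
  refine Nat.add_le_add_left (finrank_le_one_of_forall _ (fun _ => 1) fun t ht => ?_) _
  have h : ∀ e, t (D.leftFace e) = t (D.rightFace e) := by
    intro e
    have := congrFun (LinearMap.mem_ker.1 ht) e
    simp only [Matrix.mulVecLin_apply, Matrix.mulVec, dotProduct, Matrix.transpose_apply,
      faceMatrix, Matrix.of_apply, sub_mul, ite_mul, one_mul, zero_mul, Finset.sum_sub_distrib,
      Finset.sum_ite_eq, Finset.mem_univ, if_true, Pi.zero_apply] at this
    linarith
  have hw : ∀ x, t (D.leftFace (D.white x)) = t (D.leftFace x) := by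
    intro x; rw [h, rightFace_white]
  have hb : ∀ x, t (D.leftFace (D.black x)) = t (D.leftFace x) := by
    intro x
    have : D.leftFace (D.black x) = D.leftFace (D.white⁻¹ x) := by
      have := cycles_mk_apply D.facePerm (D.white⁻¹ x)
      rwa [facePerm_apply, perm_apply_inv] at this
    rw [this, ← hw, perm_apply_inv]
  obtain ⟨e₀⟩ := D.nonempty
  refine ⟨t (D.leftFace e₀), ?_⟩
  ext f
  induction f using Quotient.inductionOn with
  | h e => exact (D.eq_of_invariant (fun e => t (D.leftFace e)) hw hb e e₀).trans (by simp)

/-- A closed cochain is a combination of the two coordinates of the crossing numbers, up to an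
exact cochain: the first cohomology of the torus. -/
theorem Marking.exists_potential (m : D.Marking) (ψ : E → ℝ)
    (hψ : ∀ e, ∑ x with D.facePerm.SameCycle e x, (ψ x - ψ (D.white x)) = 0) :
    ∃ (x y : ℝ) (φ η : E → ℝ), (∀ e, φ (D.white e) = φ e) ∧ (∀ e, η (D.black e) = η e) ∧
      ∀ e, ψ e = x * (m.crossing e).1 + y * (m.crossing e).2 + φ e + η e := by
  let G : ((Fin 2 → ℝ) × ((Cycles D.white → ℝ) × (Cycles D.black → ℝ))) →ₗ[ℝ] (E → ℝ) :=
    { toFun := fun p e => p.1 0 * (m.crossing e).1 + p.1 1 * (m.crossing e).2 + D.nodeMap p.2 e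
      map_add' := fun p q => by
        ext e
        simp only [Prod.fst_add, Prod.snd_add, map_add, Pi.add_apply]
        ring
      map_smul' := fun r p => by
        ext e
        simp only [Prod.smul_fst, Prod.smul_snd, map_smul, Pi.smul_apply, smul_eq_mul,
          RingHom.id_apply]
        ring }
  have hG : ∀ p e, G p e = p.1 0 * (m.crossing e).1 + p.1 1 * (m.crossing e).2 +
    p.2.1 (Quotient.mk _ e) + p.2.2 (Quotient.mk _ e) := fun p e => by
      simp [G, nodeMap, add_assoc]
  -- With `χ = 0`, `coeff_of_zigzag` shows that no nontrivial combination of the crossing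
  -- coordinates is exact. The remaining relation is a constant on the white nodes against its
  -- negative on the black ones.
  have hker : Module.finrank ℝ (LinearMap.ker G) ≤ 1 := by
    refine finrank_le_one_of_forall _ (0, (fun _ => 1), fun _ => -1) fun p hp => ?_
    have h0 : ∀ e, (0 : ℝ) + 0 = p.1 0 * (m.crossing e).1 + p.1 1 * (m.crossing e).2 +
        p.2.1 (Quotient.mk _ e) + p.2.2 (Quotient.mk _ e) := fun e => by
      rw [← hG, LinearMap.mem_ker.1 hp, add_zero, Pi.zero_apply]
    have hx := m.coeff_of_zigzag (fun _ => 0) (fun e => p.2.1 (Quotient.mk _ e))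
      (fun e => p.2.2 (Quotient.mk _ e)) (p.1 0) (p.1 1) (fun _ => rfl)
      (fun e => congrArg _ (cycles_mk_apply _ _)) (fun e => congrArg _ (cycles_mk_apply _ _)) h0
    simp only [zero_mul, Finset.sum_const_zero, neg_zero] at hx
    have h1 : ∀ e : E, p.2.1 (Quotient.mk _ e) = -p.2.2 (Quotient.mk _ e) := by
      intro e
      have := h0 e
      rw [hx.1, hx.2] at this
      linarith
    obtain ⟨e₀⟩ := D.nonempty
    have h2 : ∀ e : E, p.2.1 (Quotient.mk _ e) = p.2.1 (Quotient.mk _ e₀) := fun e =>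
      D.eq_of_invariant (fun e => p.2.1 (Quotient.mk _ e))
        (fun e => congrArg _ (cycles_mk_apply _ _))
        (fun e => by
          simp only [h1]
          exact congrArg _ (congrArg _ (cycles_mk_apply _ _))) e e₀
    refine ⟨p.2.1 (Quotient.mk _ e₀), ?_⟩
    refine Prod.ext ?_ (Prod.ext ?_ ?_)
    · ext i
      fin_cases i <;> simp [hx.1, hx.2]
    · ext v
      induction v using Quotient.inductionOn with
      | h e => simpa using h2 e
    · ext v
      induction v using Quotient.inductionOn with
      | h e => 
        have := h1 e
        simp only [Prod.smul_mk, Pi.smul_apply, smul_eq_mul]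
        linarith [h2 e]
  have hle : LinearMap.range G ≤ LinearMap.ker D.faceMatrix.mulVecLin := by
    rintro _ ⟨p, rfl⟩
    rw [LinearMap.mem_ker]
    ext f
    induction f using Quotient.inductionOn with
    | h e =>
      rw [Matrix.mulVecLin_apply]
      refine (faceMatrix_mulVec _ e).trans ?_
      have hs := m.sum_face e
      have hs1 : ∑ x with D.facePerm.SameCycle e x,
          (((m.crossing x).1 : ℝ) - (m.crossing (D.white x)).1) = 0 := by
        have := congrArg Prod.fst hs
        rw [Prod.fst_sum] at this
        exact_mod_cast this
      have hs2 : ∑ x with D.facePerm.SameCycle e x,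
          (((m.crossing x).2 : ℝ) - (m.crossing (D.white x)).2) = 0 := by
        have := congrArg Prod.snd hs
        rw [Prod.snd_sum] at this
        exact_mod_cast this
      have hb := sum_sameCycle_comp D.facePerm (fun x => p.2.2 (Quotient.mk _ x)) e
      have : ∀ x, G p x - G p (D.white x) =
          p.1 0 * (((m.crossing x).1 : ℝ) - (m.crossing (D.white x)).1) +
          p.1 1 * (((m.crossing x).2 : ℝ) - (m.crossing (D.white x)).2) +
          (p.2.2 (Quotient.mk _ x) - p.2.2 (Quotient.mk _ (D.facePerm x))) := by
        intro x
        rw [hG, hG, cycles_mk_apply, facePerm_apply, cycles_mk_apply D.black]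
        ring
      rw [Finset.sum_congr rfl fun x _ => this x, Finset.sum_add_distrib, Finset.sum_add_distrib,
        ← Finset.mul_sum, ← Finset.mul_sum, hs1, hs2, Finset.sum_sub_distrib, hb]
      simp
  -- Euler's relation: the generators span at least `2 + V - 1 = E - F + 1` dimensions, the most
  -- that closed cochains can have.
  have hdim : Module.finrank ℝ (LinearMap.ker D.faceMatrix.mulVecLin) ≤
      Module.finrank ℝ (LinearMap.range G) := by
    have h1 := LinearMap.finrank_range_add_finrank_ker G
    have h2 := finrank_ker_faceMatrix (D := D)
    have h3 := D.euler
    have h4 : Fintype.card D.Face = Fintype.card (Cycles (D.black * D.white)) := rfl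
    simp only [Module.finrank_prod, Module.finrank_fintype_fun_eq_card, Fintype.card_fin] at h1
    omega
  have hmem : ψ ∈ LinearMap.ker D.faceMatrix.mulVecLin := by
    rw [LinearMap.mem_ker]
    ext f
    induction f using Quotient.inductionOn with
    | h e => exact (faceMatrix_mulVec _ e).trans (hψ e)
  rw [← Submodule.eq_of_le_of_finrank_le hle hdim] at hmem
  obtain ⟨p, rfl⟩ := hmem
  exact ⟨p.1 0, p.1 1, fun e => p.2.1 (Quotient.mk _ e), fun e => p.2.2 (Quotient.mk _ e),
    fun e => congrArg _ (cycles_mk_apply _ _), fun e => congrArg _ (cycles_mk_apply _ _), hG p⟩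

end Homology

end Dimer

/-! ### Zigzag paths and perfect matchings -/

namespace Dimer

section Strands

open Classical

variable {E : Type*} [Fintype E] {D : Dimer E}

variable (D) in
/-- The zigzag path of an edge. -/
def strand (e : E) : Cycles D.zigzagPerm := Quotient.mk _ e

variable (D) in
/-- The indicator function of the zigzag path `z`. -/
noncomputable def chi (z : Cycles D.zigzagPerm) (x : E) : ℝ := if D.strand x = z then 1 else 0

variable (D) in
/-- The charge that is `1` and `-1` alternately along the zigzag path `z`. -/
noncomputable def zeta (z : Cycles D.zigzagPerm) (x : E) : ℝ := D.chi z (D.white⁻¹ x) - D.chi z x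

theorem strand_eq_iff {x y : E} : D.strand x = D.strand y ↔ D.zigzagPerm.SameCycle x y :=
  cycles_mk_eq_iff

theorem strand_zigzag (x : E) : D.strand (D.zigzagPerm x) = D.strand x := cycles_mk_apply _ _

/-- The path that traverses `x` from white to black comes from `white⁻¹ x` and goes on to `black⁻¹
x`. -/
theorem strand_black_inv (x : E) : D.strand (D.black⁻¹ x) = D.strand (D.white⁻¹ x) := by
  rw [← strand_zigzag (D.white⁻¹ x), zigzagPerm_apply, perm_apply_inv]

theorem strand_white (x : E) : D.strand (D.white⁻¹ (D.black x)) = D.strand x := by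
  rw [← strand_black_inv, perm_inv_apply]

theorem chi_zigzag (z : Cycles D.zigzagPerm) (x : E) : D.chi z (D.zigzagPerm x) = D.chi z x := by
  simp only [chi, strand_zigzag]

theorem chi_black_inv (z : Cycles D.zigzagPerm) (x : E) :
    D.chi z (D.black⁻¹ x) = D.chi z (D.white⁻¹ x) := by
  simp only [chi, strand_black_inv]

theorem mem_zigzagEdges {e x : E} :
    x ∈ D.zigzagEdges e ↔ D.strand x = D.strand e ∨ D.strand (D.white⁻¹ x) = D.strand e := by
  simp only [zigzagEdges, Set.mem_ofPred_eq, ← strand_eq_iff, eq_comm]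

theorem sum_chi_mul (e : E) (g : E → ℝ) :
    ∑ x, D.chi (D.strand e) x * g x = ∑ x with D.zigzagPerm.SameCycle e x, g x := by
  rw [Finset.sum_filter]
  refine Finset.sum_congr rfl fun x _ => ?_
  simp only [chi, ← strand_eq_iff, eq_comm (a := D.strand e), ite_mul, one_mul, zero_mul]

theorem sum_chi_winding (m : D.Marking) (e : E) :
    ∑ x, D.chi (D.strand e) x * ((m.crossing (D.white x)).1 - (m.crossing x).1) =
      (D.winding m e).1 ∧
    ∑ x, D.chi (D.strand e) x * ((m.crossing (D.white x)).2 - (m.crossing x).2) =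
      (D.winding m e).2 := by
  constructor <;>
  · rw [sum_chi_mul, winding]
    simp only [Prod.fst_sum, Prod.snd_sum]
    push_cast
    exact Finset.sum_congr rfl fun x _ => by simp

theorem sum_sameCycle_sub {M : Type*} [AddCommGroup M] (π : Equiv.Perm E) (g : E → M) (e : E) :
    ∑ x with π.SameCycle e x, (g (π⁻¹ x) - g x) = 0 := by
  rw [Finset.sum_sub_distrib, sub_eq_zero, ← sum_sameCycle_comp π (fun x => g (π⁻¹ x))]
  simp only [perm_inv_apply]

theorem sum_zeta_white (z : Cycles D.zigzagPerm) (e : E) :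
    ∑ x with D.white.SameCycle e x, D.zeta z x = 0 :=
  sum_sameCycle_sub D.white (D.chi z) e

theorem sum_zeta_black (z : Cycles D.zigzagPerm) (e : E) :
    ∑ x with D.black.SameCycle e x, D.zeta z x = 0 := by
  rw [← sum_sameCycle_sub D.black (D.chi z) e]
  simp only [zeta, chi_black_inv]

theorem chi_white (z : Cycles D.zigzagPerm) (x : E) :
    D.chi z (D.white x) = D.chi z (D.white⁻¹ (D.facePerm x)) := by
  rw [← chi_black_inv, facePerm_apply, perm_inv_apply]

/-- The two sides of the face at a white corner together contribute a difference along `facePerm`,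
and these differences telescope. -/
theorem sum_zeta_face (z : Cycles D.zigzagPerm) (e : E) :
    ∑ x with D.facePerm.SameCycle e x, (D.zeta z x + D.zeta z (D.white x)) = 0 := by
  have : ∀ x, D.zeta z x + D.zeta z (D.white x) =
      D.chi z (D.white⁻¹ x) - D.chi z (D.white⁻¹ (D.facePerm x)) := by
    intro x
    rw [zeta, zeta, perm_inv_apply, chi_white]
    ring
  rw [Finset.sum_congr rfl fun x _ => this x, Finset.sum_sub_distrib,
    sum_sameCycle_comp D.facePerm (fun x => D.chi z (D.white⁻¹ x)), sub_self]

/-- Zigzag paths are directions in the affine space of charge assignments. Hence the dimension of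
this space bounds their number, and no edge of a path has a fixed charge unless the path meets
itself there. -/
theorem add_smul_zeta_mem {R : E → ℝ} (hR : R ∈ D.chargeAssignments)
    (z : Cycles D.zigzagPerm) (t : ℝ) : R + t • D.zeta z ∈ D.chargeAssignments := by
  refine ⟨fun e => ?_, fun e => ?_, fun e => ?_⟩
  · simp only [Pi.add_apply, Pi.smul_apply, smul_eq_mul, Finset.sum_add_distrib, hR.1 e,
      ← Finset.mul_sum, sum_zeta_white, mul_zero, add_zero]
  · simp only [Pi.add_apply, Pi.smul_apply, smul_eq_mul, Finset.sum_add_distrib, hR.2.1 e,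
      ← Finset.mul_sum, sum_zeta_black, mul_zero, add_zero]
  · have h := hR.2.2 e
    have : ∀ x, (1 - (R + t • D.zeta z) x) + (1 - (R + t • D.zeta z) (D.white x)) =
        ((1 - R x) + (1 - R (D.white x))) - t * (D.zeta z x + D.zeta z (D.white x)) := by
      intro x
      simp only [Pi.add_apply, Pi.smul_apply, smul_eq_mul]
      ring
    rw [Finset.sum_congr rfl fun x _ => this x, Finset.sum_sub_distrib, h, ← Finset.mul_sum,
      sum_zeta_face, mul_zero, sub_zero]

/-- The only relation between the charges of the zigzag paths is that their sum is zero. -/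
theorem eq_of_sum_smul_zeta (t : Cycles D.zigzagPerm → ℝ) (h : ∑ z, t z • D.zeta z = 0)
    (z z' : Cycles D.zigzagPerm) : t z = t z' := by
  have h1 : ∀ x, t (D.strand (D.white⁻¹ x)) = t (D.strand x) := by
    intro x
    have := congrFun h x
    simp only [Finset.sum_apply, Pi.smul_apply, smul_eq_mul, zeta, chi, mul_sub, mul_ite, mul_one,
      mul_zero, Finset.sum_sub_distrib, Finset.sum_ite_eq, Finset.mem_univ, if_true,
      Pi.zero_apply] at this
    linarith
  have h2 := D.eq_of_invariant (fun x => t (D.strand x))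
    (fun x => by rw [← h1, perm_inv_apply])
    (fun x => by rw [← h1, strand_white])
  induction z using Quotient.inductionOn with
  | h x => induction z' using Quotient.inductionOn with
    | h y => exact h2 x y

theorem sum_delta_white {M : Finset E} (hM : D.IsPerfectMatching M) (e : E) :
    ∑ x with D.white.SameCycle e x, delta M x = 2 := by
  obtain ⟨y, ⟨hy, hey⟩, hu⟩ := hM.1 e
  rw [Finset.sum_eq_single y]
  · simp [delta, hy]
  · intro x hx hxy
    have := (Finset.mem_filter.1 hx).2
    simp only [delta, ite_eq_right_iff]
    intro hxM
    exact absurd (hu x ⟨hxM, this⟩) hxy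
  · intro h
    exact absurd (Finset.mem_filter.2 ⟨Finset.mem_univ _, hey⟩) h

theorem sum_delta_black {M : Finset E} (hM : D.IsPerfectMatching M) (e : E) :
    ∑ x with D.black.SameCycle e x, delta M x = 2 := by
  obtain ⟨y, ⟨hy, hey⟩, hu⟩ := hM.2 e
  rw [Finset.sum_eq_single y]
  · simp [delta, hy]
  · intro x hx hxy
    have := (Finset.mem_filter.1 hx).2
    simp only [delta, ite_eq_right_iff]
    intro hxM
    exact absurd (hu x ⟨hxM, this⟩) hxy
  · intro h
    exact absurd (Finset.mem_filter.2 ⟨Finset.mem_univ _, hey⟩) h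

/-- An exact cochain pairs in the same way with every perfect matching; this is the origin of the
constants in the affine functions of the lattice point. -/
theorem sum_mul_eq_of_invariant (π : Equiv.Perm E) (φ g : E → ℝ) (hφ : ∀ e, φ (π e) = φ e)
    (hg : ∀ e, ∑ x with π.SameCycle e x, g x = 2) :
    ∑ e, φ e * g e = ∑ v : Cycles π, φ v.out * 2 := by
  rw [← sum_cycles π]
  refine Finset.sum_congr rfl fun v _ => ?_
  rw [← hg v.out, Finset.mul_sum]
  refine Finset.sum_congr rfl fun x hx => ?_
  obtain ⟨n, hn⟩ := (Finset.mem_filter.1 hx).2.exists_nat_pow_eq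
  have : ∀ n : ℕ, φ ((π ^ n) v.out) = φ v.out := by
    intro n
    induction n with
    | zero => rfl
    | succ n ih => rw [pow_succ', Equiv.Perm.mul_apply, hφ, ih]
  rw [← hn, this]

theorem sum_mul_delta (M : Finset E) (g : E → ℝ) : ∑ e, g e * delta M e = 2 * ∑ e ∈ M, g e := by
  simp only [delta, mul_ite, mul_zero, mul_comm (2 : ℝ)]
  rw [← Finset.sum_filter, Finset.filter_mem_eq_inter, Finset.univ_inter, Finset.sum_mul]

/-- The number of edges of a perfect matching, weighted with a closed cochain, is an affine
function of the lattice point of the matching. -/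
theorem Marking.exists_affine (m : D.Marking) (ψ : E → ℝ)
    (hψ : ∀ e, ∑ x with D.facePerm.SameCycle e x, (ψ x - ψ (D.white x)) = 0) :
    ∃ x y c : ℝ, ∀ M, D.IsPerfectMatching M →
      ∑ e, ψ e * delta M e = 2 * (x * (D.latticePoint m M).1 + y * (D.latticePoint m M).2) + c := by
  obtain ⟨x, y, φ, η, hφ, hη, h⟩ := m.exists_potential ψ hψ
  refine ⟨x, y, ∑ v : Cycles D.white, φ v.out * 2 + ∑ v : Cycles D.black, η v.out * 2,
    fun M hM => ?_⟩
  rw [← sum_mul_eq_of_invariant D.white φ (delta M) hφ (sum_delta_white hM),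
    ← sum_mul_eq_of_invariant D.black η (delta M) hη (sum_delta_black hM)]
  simp only [h, add_mul, Finset.sum_add_distrib, mul_assoc, ← Finset.mul_sum]
  rw [sum_mul_delta, sum_mul_delta, latticePoint]
  simp only [Prod.fst_sum, Prod.snd_sum, Int.cast_sum]
  ring

/-- A zigzag path, drawn through the midpoints of its edges, keeps the white nodes on one side. All
its crossings therefore count with the same sign, and their numbers form a closed cochain. -/
theorem sum_crossing_face (z : Cycles D.zigzagPerm) (e : E) :
    ∑ x with D.facePerm.SameCycle e x, ((D.chi z x + D.chi z (D.white⁻¹ x)) -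
      (D.chi z (D.white x) + D.chi z (D.white⁻¹ (D.white x)))) = 0 := by
  have : ∀ x, ((D.chi z x + D.chi z (D.white⁻¹ x)) -
      (D.chi z (D.white x) + D.chi z (D.white⁻¹ (D.white x)))) =
      D.chi z (D.white⁻¹ x) - D.chi z (D.white⁻¹ (D.facePerm x)) := by
    intro x
    rw [perm_inv_apply, chi_white]
    ring
  rw [Finset.sum_congr rfl fun x _ => this x, Finset.sum_sub_distrib,
    sum_sameCycle_comp D.facePerm (fun x => D.chi z (D.white⁻¹ x)), sub_self]

/-- The crossing numbers of the edges with a zigzag path, as a combination of the coordinates of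
the marking up to an exact cochain. -/
theorem Marking.exists_zigzag_potential (m : D.Marking) (e₀ : E) :
    ∃ φ η : E → ℝ, (∀ e, φ (D.white e) = φ e) ∧ (∀ e, η (D.black e) = η e) ∧
      ∀ e, D.chi (D.strand e₀) e + D.chi (D.strand e₀) (D.white⁻¹ e) =
        (D.winding m e₀).2 * (m.crossing e).1 - (D.winding m e₀).1 * (m.crossing e).2 +
          φ e + η e := by
  obtain ⟨x, y, φ, η, hφ, hη, h⟩ := m.exists_potential
    (fun e => D.chi (D.strand e₀) e + D.chi (D.strand e₀) (D.white⁻¹ e))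
    (sum_crossing_face (D.strand e₀))
  obtain ⟨hx, hy⟩ := m.coeff_of_zigzag (D.chi (D.strand e₀)) φ η x y (chi_zigzag _) hφ hη h
  obtain ⟨h1, h2⟩ := sum_chi_winding m e₀
  refine ⟨φ, η, hφ, hη, fun e => ?_⟩
  rw [h, hx, hy, h1, h2]
  ring

theorem sum_chi_reindex (z : Cycles D.zigzagPerm) (g : E → ℝ) :
    ∑ e, (D.chi z e + D.chi z (D.white⁻¹ e)) * g e =
      ∑ x, D.chi z x * (g x + g (D.white x)) := by
  simp only [add_mul, mul_add, Finset.sum_add_distrib]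
  congr 1
  rw [← sum_comp_perm D.white (fun e => D.chi z (D.white⁻¹ e) * g e)]
  simp only [perm_inv_apply]

theorem sum_zeta_reindex (z : Cycles D.zigzagPerm) (g : E → ℝ) :
    ∑ e, D.zeta z e * g e = ∑ x, D.chi z x * (g (D.white x) - g x) := by
  simp only [zeta, sub_mul, mul_sub, Finset.sum_sub_distrib]
  congr 1
  rw [← sum_comp_perm D.white (fun e => D.chi z (D.white⁻¹ e) * g e)]
  simp only [perm_inv_apply]

/-- The number of edges that a perfect matching shares with a zigzag path is an affine function of
its lattice point, with the winding as its gradient (rotated). -/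
theorem Marking.exists_count (m : D.Marking) (e₀ : E) :
    ∃ c : ℝ, ∀ M, D.IsPerfectMatching M →
      ∑ x, D.chi (D.strand e₀) x * (delta M x + delta M (D.white x)) =
        2 * wedge (D.latticePoint m M) (D.winding m e₀) + c := by
  obtain ⟨φ, η, hφ, hη, h⟩ := m.exists_zigzag_potential e₀
  refine ⟨∑ v : Cycles D.white, φ v.out * 2 + ∑ v : Cycles D.black, η v.out * 2,
    fun M hM => ?_⟩
  rw [← sum_chi_reindex, ← sum_mul_eq_of_invariant D.white φ (delta M) hφ (sum_delta_white hM),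
    ← sum_mul_eq_of_invariant D.black η (delta M) hη (sum_delta_black hM)]
  simp only [h, add_mul, sub_mul, Finset.sum_add_distrib, Finset.sum_sub_distrib, mul_assoc,
    ← Finset.mul_sum]
  rw [sum_mul_delta, sum_mul_delta, latticePoint, wedge]
  simp only [Prod.fst_sum, Prod.snd_sum]
  push_cast
  ring

theorem strand_ne_white (h : ∀ e, D.strand e ≠ D.strand (D.white⁻¹ e)) (x : E) :
    D.white x ≠ x := by
  intro hx
  have := h (D.white x)
  rw [perm_inv_apply, hx] at this
  exact this rfl

theorem strand_ne_black (h : ∀ e, D.strand e ≠ D.strand (D.white⁻¹ e)) (x : E) :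
    D.black x ≠ x := by
  intro hx
  have := h (D.black x)
  rw [strand_white, hx] at this
  exact this rfl

theorem IsPerfectMatching.eq_white {M : Finset E} (hM : D.IsPerfectMatching M) {x y : E}
    (hx : x ∈ M) (hy : y ∈ M) (h : D.white.SameCycle x y) : x = y :=
  (hM.1 x).unique ⟨hx, Equiv.Perm.SameCycle.refl _ _⟩ ⟨hy, h⟩

theorem IsPerfectMatching.eq_black {M : Finset E} (hM : D.IsPerfectMatching M) {x y : E}
    (hx : x ∈ M) (hy : y ∈ M) (h : D.black.SameCycle x y) : x = y :=
  (hM.2 x).unique ⟨hx, Equiv.Perm.SameCycle.refl _ _⟩ ⟨hy, h⟩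

theorem sameCycle_apply (π : Equiv.Perm E) (x : E) : π.SameCycle x (π x) :=
  Equiv.Perm.sameCycle_apply_right.2 (Equiv.Perm.SameCycle.refl _ _)

theorem sameCycle_inv_apply (π : Equiv.Perm E) (x : E) : π.SameCycle x (π⁻¹ x) := by
  rw [← Equiv.Perm.sameCycle_apply_right, perm_apply_inv]

/-- The two edges share a white node and are distinct, since no path meets itself. -/
theorem delta_add_white_le (h : ∀ e, D.strand e ≠ D.strand (D.white⁻¹ e)) {M : Finset E}
    (hM : D.IsPerfectMatching M) (x : E) : delta M x + delta M (D.white x) ≤ 2 := by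
  have : ¬(x ∈ M ∧ D.white x ∈ M) := fun hx =>
    strand_ne_white h x (hM.eq_white hx.1 hx.2 (sameCycle_apply _ _)).symm
  simp only [delta]
  split_ifs <;> first | tauto | norm_num

theorem delta_add_zigzag_le (h : ∀ e, D.strand e ≠ D.strand (D.white⁻¹ e)) {M : Finset E}
    (hM : D.IsPerfectMatching M) (x : E) : delta M (D.white x) + delta M (D.zigzagPerm x) ≤ 2 := by
  have : ¬(D.white x ∈ M ∧ D.zigzagPerm x ∈ M) := fun hx => by
    have := hM.eq_black hx.1 hx.2 (by rw [zigzagPerm_apply]; exact sameCycle_inv_apply _ _)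
    apply strand_ne_black h (D.zigzagPerm x)
    nth_rewrite 1 [zigzagPerm_apply]
    rw [perm_apply_inv, this]
  simp only [delta]
  split_ifs <;> first | tauto | norm_num

theorem forall_strand {P : E → Prop} (hP : ∀ x, P x → P (D.zigzagPerm x)) {x y : E} (hx : P x)
    (h : D.strand x = D.strand y) : P y := by
  obtain ⟨n, hn⟩ := (strand_eq_iff.1 h).exists_nat_pow_eq
  have : ∀ n : ℕ, P ((D.zigzagPerm ^ n) x) := by
    intro n
    induction n with
    | zero => exact hx
    | succ n ih => rw [pow_succ', Equiv.Perm.mul_apply]; exact hP _ ih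
  exact hn ▸ this n

/-- A perfect matching that contains half of the edges of a zigzag path contains every other
edge of it. -/
theorem alternate_of_half (h : ∀ e, D.strand e ≠ D.strand (D.white⁻¹ e)) {M : Finset E}
    (hM : D.IsPerfectMatching M) (z : Cycles D.zigzagPerm)
    (hz : ∑ x, D.chi z x * (delta M x + delta M (D.white x)) = 2 * ∑ x, D.chi z x) :
    (∀ x, D.strand x = z → x ∈ M ∧ D.white x ∉ M) ∨
      ∀ x, D.strand x = z → x ∉ M ∧ D.white x ∈ M := by
  have hnn : ∀ x, 0 ≤ D.chi z x := fun x => by unfold chi; split_ifs <;> norm_num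
  -- No white corner of the path contributes more than `2`, so equality of the sums is equality at
  -- each corner.
  have h1 : ∀ x, D.strand x = z → delta M x + delta M (D.white x) = 2 := by
    intro x hx
    rw [Finset.mul_sum, ← sub_eq_zero, ← Finset.sum_sub_distrib] at hz
    have hz' : ∑ x, D.chi z x * (2 - (delta M x + delta M (D.white x))) = 0 := by
      rw [← neg_eq_zero, ← hz, ← Finset.sum_neg_distrib]
      exact Finset.sum_congr rfl fun x _ => by ring
    have := (Finset.sum_eq_zero_iff_of_nonneg fun x _ => mul_nonneg (hnn x)
      (sub_nonneg.2 (delta_add_white_le h hM x))).1 hz' x (Finset.mem_univ _)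
    simp only [chi, hx, if_true, one_mul] at this
    linarith
  -- The same count with the edges of the path paired at black nodes.
  have h2 : ∀ x, D.strand x = z → delta M (D.white x) + delta M (D.zigzagPerm x) = 2 := by
    intro x hx
    have e1 : ∑ x, D.chi z x * (delta M x + delta M (D.white x)) =
        ∑ x, D.chi z x * (delta M (D.white x) + delta M (D.zigzagPerm x)) := by
      simp only [mul_add, Finset.sum_add_distrib]
      rw [add_comm, ← sum_comp_perm D.zigzagPerm (fun x => D.chi z x * delta M x)]
      simp only [chi_zigzag]
    rw [e1, Finset.mul_sum, ← sub_eq_zero, ← Finset.sum_sub_distrib] at hz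
    have hz' : ∑ x, D.chi z x * (2 - (delta M (D.white x) + delta M (D.zigzagPerm x))) = 0 := by
      rw [← neg_eq_zero, ← hz, ← Finset.sum_neg_distrib]
      exact Finset.sum_congr rfl fun x _ => by ring
    have := (Finset.sum_eq_zero_iff_of_nonneg fun x _ => mul_nonneg (hnn x)
      (sub_nonneg.2 (delta_add_zigzag_le h hM x))).1 hz' x (Finset.mem_univ _)
    simp only [chi, hx, if_true, one_mul] at this
    linarith
  have h3 : ∀ x, D.strand x = z → delta M (D.zigzagPerm x) = delta M x := by
    intro x hx
    linarith [h1 x hx, h2 x hx]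
  induction z using Quotient.inductionOn with
  | h e =>
    by_cases he : e ∈ M
    · left
      intro x hx
      have : D.strand x = D.strand e ∧ x ∈ M := by
        refine forall_strand (D := D) (P := fun y => D.strand y = D.strand e ∧ y ∈ M) ?_
          ⟨rfl, he⟩ hx.symm
        rintro y ⟨hy, hyM⟩
        refine ⟨(strand_zigzag y).trans hy, ?_⟩
        have := h3 y hy
        by_contra hn
        simp [delta, hyM, hn] at this
      refine ⟨this.2, fun hw => ?_⟩
      have h4 := h1 x hx
      simp only [delta, this.2, hw, if_true] at h4
      norm_num at h4
    · right
      intro x hx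
      have : D.strand x = D.strand e ∧ x ∉ M := by
        refine forall_strand (D := D) (P := fun y => D.strand y = D.strand e ∧ y ∉ M) ?_
          ⟨rfl, he⟩ hx.symm
        rintro y ⟨hy, hyM⟩
        refine ⟨(strand_zigzag y).trans hy, fun hn => ?_⟩
        have := h3 y hy
        simp [delta, hyM, hn] at this
      refine ⟨this.2, ?_⟩
      by_contra hw
      have h4 := h1 x hx
      simp [delta, this.2, hw] at h4

/-- If two zigzag paths have the same edges then there is no other. -/
theorem strand_eq_or_of_zigzagEdges_eq {e₁ e₂ : E}
    (hne : D.strand e₁ ≠ D.strand e₂) (heq : D.zigzagEdges e₁ = D.zigzagEdges e₂) (e : E) :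
    D.strand e = D.strand e₁ ∨ D.strand e = D.strand e₂ := by
  have key : ∀ a b, D.strand a ≠ D.strand b → D.zigzagEdges a = D.zigzagEdges b → ∀ x,
      D.strand x = D.strand a → D.strand (D.white x) = D.strand b := by
    intro a b hab hE x hx
    have h1 : D.white x ∈ D.zigzagEdges a := mem_zigzagEdges.2 (Or.inr (by rwa [perm_inv_apply]))
    rw [hE, mem_zigzagEdges, perm_inv_apply] at h1
    rcases h1 with h1 | h1
    · exact h1
    · exact absurd (hx.symm.trans h1) hab
  have hw : ∀ x, (D.strand x = D.strand e₁ ∨ D.strand x = D.strand e₂) →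
      (D.strand (D.white x) = D.strand e₁ ∨ D.strand (D.white x) = D.strand e₂) := by
    rintro x (hx | hx)
    · exact Or.inr (key e₁ e₂ hne heq x hx)
    · exact Or.inl (key e₂ e₁ hne.symm heq.symm x hx)
  have hw' : ∀ x, (D.strand (D.white x) = D.strand e₁ ∨ D.strand (D.white x) = D.strand e₂) →
      (D.strand x = D.strand e₁ ∨ D.strand x = D.strand e₂) := by
    intro x hx
    obtain ⟨n, hn⟩ := (sameCycle_apply D.white x).symm.exists_nat_pow_eq
    have : ∀ n : ℕ, D.strand ((D.white ^ n) (D.white x)) = D.strand e₁ ∨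
        D.strand ((D.white ^ n) (D.white x)) = D.strand e₂ := by
      intro n
      induction n with
      | zero => exact hx
      | succ n ih => rw [pow_succ', Equiv.Perm.mul_apply]; exact hw _ ih
    exact hn ▸ this n
  -- The edges whose path is one of the two form a set that is invariant under rotation about all
  -- nodes.
  have := D.eq_of_invariant (fun x => D.strand x = D.strand e₁ ∨ D.strand x = D.strand e₂)
    (fun x => propext ⟨hw' x, hw x⟩)
    (fun x => by
      have e1 := strand_white (D := D) x
      have : (D.strand (D.white⁻¹ (D.black x)) = D.strand e₁ ∨
        D.strand (D.white⁻¹ (D.black x)) = D.strand e₂) ↔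
        (D.strand (D.black x) = D.strand e₁ ∨ D.strand (D.black x) = D.strand e₂) := by
        constructor
        · intro hx
          have := hw _ hx
          rwa [perm_apply_inv] at this
        · intro hx
          apply hw'
          rwa [perm_apply_inv]
      rw [e1] at this
      exact propext this.symm)
    e e₁
  rw [this]
  exact Or.inl rfl

/-- If two perfect matchings differ by the edges of a zigzag path then they differ by the charge of
the zigzag path, which does not meet itself. -/
theorem delta_sub_of_symmDiff {M M' : Finset E} (hM : D.IsPerfectMatching M)
    (hM' : D.IsPerfectMatching M') {e₀ : E}
    (hs : symmDiff (M : Set E) (M' : Set E) = D.zigzagEdges e₀) :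
    (∀ e, D.strand e = D.strand e₀ → D.strand (D.white⁻¹ e) ≠ D.strand e₀) ∧
      ∃ ε : ℝ, (ε = 1 ∨ ε = -1) ∧ delta M' - delta M = (2 * ε) • D.zeta (D.strand e₀) := by
  have hmem : ∀ x, (x ∈ M ∧ x ∉ M' ∨ x ∈ M' ∧ x ∉ M) ↔
      (D.strand x = D.strand e₀ ∨ D.strand (D.white⁻¹ x) = D.strand e₀) := by
    intro x
    rw [← mem_zigzagEdges, ← hs, Set.mem_symmDiff]
    simp only [Finset.mem_coe]
  have hwM : ∀ x, D.strand x = D.strand e₀ →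
      (D.white x ∈ M ∧ D.white x ∉ M' ∨ D.white x ∈ M' ∧ D.white x ∉ M) := fun x hx =>
    (hmem _).2 (Or.inr (by rwa [perm_inv_apply]))
  have hzM : ∀ x, D.strand x = D.strand e₀ →
      (D.zigzagPerm x ∈ M ∧ D.zigzagPerm x ∉ M' ∨ D.zigzagPerm x ∈ M' ∧ D.zigzagPerm x ∉ M) :=
    fun x hx => (hmem _).2 (Or.inl ((strand_zigzag x).trans hx))
  -- the edges of the path lie alternately in the two matchings
  have step : ∀ {A B : Finset E}, D.IsPerfectMatching A → D.IsPerfectMatching B →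
      (∀ x, (x ∈ A ∧ x ∉ B ∨ x ∈ B ∧ x ∉ A) ↔
        (D.strand x = D.strand e₀ ∨ D.strand (D.white⁻¹ x) = D.strand e₀)) → e₀ ∈ A →
      ∀ x, D.strand x = D.strand e₀ → (x ∈ A ∧ x ∉ B) ∧ (D.white x ∈ B ∧ D.white x ∉ A) := by
    intro A B hA hB hAB h0 x hx
    have hwh : ∀ y, D.strand y = D.strand e₀ → y ∈ A → y ∉ B →
        D.white y ∈ B ∧ D.white y ∉ A := by
      intro y hy hyA hyB
      rcases (hAB (D.white y)).2 (Or.inr (by rwa [perm_inv_apply])) with h | h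
      -- Two edges of `A` at one white node coincide. The node would have degree one, and `B` would
      -- have to contain `y`.
      · have := hA.eq_white hyA h.1 (sameCycle_apply _ _)
        obtain ⟨w, ⟨hw, hwy⟩, -⟩ := hB.1 y
        have hfix : D.white y = y := this.symm
        have : y = w := hwy.eq_of_left hfix
        exact absurd (this ▸ hw) hyB
      · exact h
    have : D.strand x = D.strand e₀ ∧ x ∈ A ∧ x ∉ B := by
      refine forall_strand (D := D) (P := fun y => D.strand y = D.strand e₀ ∧ y ∈ A ∧ y ∉ B) ?_
        ⟨rfl, h0, ?_⟩ hx.symm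
      · rintro y ⟨hy, hyA, hyB⟩
        have hz : D.strand (D.zigzagPerm y) = D.strand e₀ := (strand_zigzag y).trans hy
        refine ⟨hz, ?_⟩
        obtain ⟨h1, h2⟩ := hwh y hy hyA hyB
        rcases (hAB (D.zigzagPerm y)).2 (Or.inl hz) with h | h
        · exact h
        · have := hB.eq_black h1 h.1 (by rw [zigzagPerm_apply]; exact sameCycle_inv_apply _ _)
          have hfix : D.black (D.white y) = D.white y := by
            nth_rewrite 1 [this]
            rw [zigzagPerm_apply, perm_apply_inv]
          obtain ⟨w, ⟨hw, hwy⟩, -⟩ := hA.2 (D.white y)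
          have : D.white y = w := hwy.eq_of_left hfix
          exact absurd (this ▸ hw) h2
      · rcases (hAB e₀).2 (Or.inl rfl) with h | h
        · exact h.2
        · exact absurd h0 h.2
    exact ⟨this.2, hwh x hx this.2.1 this.2.2⟩
  have fin : ∀ {A B : Finset E}, (∀ x, (x ∈ A ∧ x ∉ B ∨ x ∈ B ∧ x ∉ A) ↔
        (D.strand x = D.strand e₀ ∨ D.strand (D.white⁻¹ x) = D.strand e₀)) →
      (∀ x, D.strand x = D.strand e₀ → (x ∈ A ∧ x ∉ B) ∧ (D.white x ∈ B ∧ D.white x ∉ A)) →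
      (∀ e, D.strand e = D.strand e₀ → D.strand (D.white⁻¹ e) ≠ D.strand e₀) ∧
      ∀ e, delta B e - delta A e = 2 * D.zeta (D.strand e₀) e := by
    intro A B hAB hst
    have hsimple : ∀ e, D.strand e = D.strand e₀ → D.strand (D.white⁻¹ e) ≠ D.strand e₀ := by
      intro e he he'
      have := (hst _ he').2.2
      rw [perm_apply_inv] at this
      exact this (hst e he).1.1
    refine ⟨hsimple, fun e => ?_⟩
    by_cases h1 : D.strand e = D.strand e₀
    · have h2 := hsimple e h1
      have h3 := (hst e h1).1
      simp only [delta, zeta, chi, h1, h2, h3, if_true, if_false]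
      norm_num
    · by_cases h2 : D.strand (D.white⁻¹ e) = D.strand e₀
      · have h3 := (hst _ h2).2
        rw [perm_apply_inv] at h3
        simp only [delta, zeta, chi, h1, h2, h3, if_true, if_false]
        norm_num
      · have h3 := (hAB e).not.2 (by tauto)
        have h4 : e ∈ A ↔ e ∈ B := by tauto
        simp only [delta, zeta, chi, h1, h2, h4, if_false]
        norm_num
  have h0 : e₀ ∈ M ∨ e₀ ∈ M' := by
    rcases (hmem e₀).2 (Or.inl rfl) with h | h
    · exact Or.inl h.1
    · exact Or.inr h.1
  -- The sign `ε` records which of the two matchings contains `e₀`.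
  rcases h0 with h0 | h0
  · obtain ⟨f1, f2⟩ := fin hmem (step hM hM' hmem h0)
    refine ⟨f1, 1, Or.inl rfl, ?_⟩
    ext e
    simpa using f2 e
  · have hmem' : ∀ x, (x ∈ M' ∧ x ∉ M ∨ x ∈ M ∧ x ∉ M') ↔
        (D.strand x = D.strand e₀ ∨ D.strand (D.white⁻¹ x) = D.strand e₀) := fun x => by
      rw [or_comm, hmem]
    obtain ⟨f1, f2⟩ := fin hmem' (step hM' hM hmem' h0)
    refine ⟨f1, -1, Or.inr rfl, ?_⟩
    ext e
    have := f2 e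
    simp only [Pi.sub_apply, Pi.smul_apply, smul_eq_mul]
    linarith

end Strands

end Dimer

/-! ### Areas of triangles in the real plane -/

/-- The wedge of two vectors of the real plane. -/
def det2 (u v : ℝ × ℝ) : ℝ := u.1 * v.2 - u.2 * v.1

def dot2 (u v : ℝ × ℝ) : ℝ := u.1 * v.1 + u.2 * v.2

/-- The area of a triangle in the real plane. -/
noncomputable def planeArea (p q r : ℝ × ℝ) : ℝ := |det2 (q - p) (r - p)| / 2

theorem planeArea_swap_left (p q r : ℝ × ℝ) : planeArea p q r = planeArea q p r := by
  unfold planeArea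
  rw [← abs_neg]
  congr 2
  simp [det2]; ring

theorem planeArea_swap_right (p q r : ℝ × ℝ) : planeArea p q r = planeArea p r q := by
  unfold planeArea
  rw [← abs_neg]
  congr 2
  simp [det2]; ring

theorem planeArea_self (p q : ℝ × ℝ) : planeArea p q q = 0 := by
  simp [planeArea, det2]; ring

theorem planeArea_nonneg (p q r : ℝ × ℝ) : 0 ≤ planeArea p q r := by
  unfold planeArea; positivity

theorem det2_sub_affine (p q a b : ℝ × ℝ) (s t : ℝ) (hst : s + t = 1) :
    det2 (a - (s • p + t • q)) (b - (s • p + t • q)) =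
      s * det2 (a - p) (b - p) + t * det2 (a - q) (b - q) := by
  obtain rfl : t = 1 - s := by linarith
  simp [det2]; ring

theorem planeArea_convex (p q a b : ℝ × ℝ) (s t : ℝ) (hs : 0 ≤ s) (ht : 0 ≤ t) (hst : s + t = 1) :
    planeArea (s • p + t • q) a b ≤ s * planeArea p a b + t * planeArea q a b := by
  unfold planeArea
  rw [det2_sub_affine _ _ _ _ _ _ hst]
  have := abs_add_le (s * det2 (a - p) (b - p)) (t * det2 (a - q) (b - q))
  rw [abs_mul, abs_mul, abs_of_nonneg hs, abs_of_nonneg ht] at this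
  linarith

/-- The signed area is affine in one corner. Its absolute value stays affine as long as the line
through the other two corners does not separate `p` from `q`. -/
theorem planeArea_affine (p q a b : ℝ × ℝ) (s t : ℝ) (hs : 0 ≤ s) (ht : 0 ≤ t) (hst : s + t = 1)
    (h : 0 ≤ det2 (a - p) (b - p) * det2 (a - q) (b - q)) :
    planeArea (s • p + t • q) a b = s * planeArea p a b + t * planeArea q a b := by
  unfold planeArea
  rw [det2_sub_affine _ _ _ _ _ _ hst]
  have h1 : |s * det2 (a - p) (b - p) + t * det2 (a - q) (b - q)| =
      |s * det2 (a - p) (b - p)| + |t * det2 (a - q) (b - q)| := by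
    rw [abs_add_eq_add_abs_iff]
    rcases mul_nonneg_iff.1 h with h | h
    · exact Or.inl ⟨mul_nonneg hs h.1, mul_nonneg ht h.2⟩
    · exact Or.inr ⟨mul_nonpos_of_nonneg_of_nonpos hs h.1,
        mul_nonpos_of_nonneg_of_nonpos ht h.2⟩
  rw [h1, abs_mul, abs_mul, abs_of_nonneg hs, abs_of_nonneg ht]
  ring

/-! ### The cubic area form, corners and supporting lines -/

namespace AreaCubic

variable {ι : Type*} [Fintype ι] (P : ι → ℝ × ℝ)

/-- The weighted sum of the areas of the triangles with one corner at `p`. -/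
noncomputable def weight (y z : ι → ℝ) (p : ℝ × ℝ) : ℝ :=
  ∑ j, ∑ k, planeArea p (P j) (P k) * (y j * z k)

noncomputable def tri (x y z : ι → ℝ) : ℝ := ∑ i, x i * weight P y z (P i)

noncomputable def cubic (x : ι → ℝ) : ℝ := tri P x x x

theorem tri_eq (x y z : ι → ℝ) :
    tri P x y z = ∑ i, ∑ j, ∑ k, planeArea (P i) (P j) (P k) * (x i * y j * z k) := by
  simp only [tri, weight, Finset.mul_sum]
  refine Finset.sum_congr rfl fun i _ => Finset.sum_congr rfl fun j _ =>
    Finset.sum_congr rfl fun k _ => by ring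

theorem tri_swap_left (x y z : ι → ℝ) : tri P x y z = tri P y x z := by
  rw [tri_eq, tri_eq, Finset.sum_comm]
  refine Finset.sum_congr rfl fun i _ => Finset.sum_congr rfl fun j _ =>
    Finset.sum_congr rfl fun k _ => ?_
  rw [planeArea_swap_left]; ring

theorem tri_swap_right (x y z : ι → ℝ) : tri P x y z = tri P x z y := by
  rw [tri_eq, tri_eq]
  refine Finset.sum_congr rfl fun i _ => ?_
  rw [Finset.sum_comm]
  refine Finset.sum_congr rfl fun j _ => Finset.sum_congr rfl fun k _ => ?_
  rw [planeArea_swap_right]; ring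

theorem tri_add_smul (x v y z : ι → ℝ) (s : ℝ) :
    tri P (x + s • v) y z = tri P x y z + s * tri P v y z := by
  simp only [tri, Pi.add_apply, Pi.smul_apply, smul_eq_mul, add_mul, Finset.sum_add_distrib,
    Finset.mul_sum, mul_assoc]

theorem cubic_add_smul (x v : ι → ℝ) (s : ℝ) :
    cubic P (x + s • v) = cubic P x + 3 * s * tri P v x x + 3 * s ^ 2 * tri P v v x +
      s ^ 3 * cubic P v := by
  unfold cubic
  have h2 : ∀ a b, tri P a (x + s • v) b = tri P a x b + s * tri P a v b := fun a b => by
    rw [tri_swap_left, tri_add_smul, tri_swap_left, tri_swap_left P v]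
  have h3 : ∀ a b, tri P a b (x + s • v) = tri P a b x + s * tri P a b v := fun a b => by
    rw [tri_swap_right, h2, tri_swap_right, tri_swap_right P a v]
  rw [tri_add_smul, h2, h2, h3, h3, h3, h3]
  rw [tri_swap_left P x v x, tri_swap_right P x x v, tri_swap_left P x v x,
    tri_swap_left P x v v, tri_swap_right P v x v]
  ring

theorem cubic_eq_sum (x : ι → ℝ) :
    cubic P x = ∑ i, ∑ j, ∑ k, planeArea (P i) (P j) (P k) * x i * x j * x k := by
  rw [cubic, tri_eq]
  refine Finset.sum_congr rfl fun i _ => Finset.sum_congr rfl fun j _ =>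
    Finset.sum_congr rfl fun k _ => by ring

theorem continuous_cubic : Continuous (cubic P) := by
  unfold cubic tri weight
  fun_prop

/-- A corner: a point that is the only minimum of a linear function. -/
def IsCorner (i : ι) : Prop := ∃ u : ℝ × ℝ, ∀ k, k ≠ i → dot2 u (P i) < dot2 u (P k)

/-- The points are distinct, lie on the boundary of their convex hull, and are not collinear. -/
structure Boundary : Prop where
  injective : Function.Injective P
  support : ∀ i, ∃ u : ℝ × ℝ, u ≠ 0 ∧ ∀ k, dot2 u (P i) ≤ dot2 u (P k)
  nondegenerate : ∃ i j k, det2 (P j - P i) (P k - P i) ≠ 0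

variable {P}

/-- The vector `u` turned by a right angle. -/
def turn (u : ℝ × ℝ) : ℝ × ℝ := (u.2, -u.1)

/-- Determinants in the orthogonal frame `u`, `turn u`: with `u` normal to a supporting line, the
coordinates are the height above the line and the position along it. -/
theorem det2_mul_dot2 (u x y : ℝ × ℝ) :
    det2 x y * dot2 u u = dot2 (turn u) x * dot2 u y - dot2 u x * dot2 (turn u) y := by
  simp [det2, dot2, turn]; ring

theorem dot2_self_pos {u : ℝ × ℝ} (hu : u ≠ 0) : 0 < dot2 u u := by
  unfold dot2
  rcases eq_or_ne u.1 0 with h1 | h1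
  · have h2 : u.2 ≠ 0 := fun h2 => hu (Prod.ext h1 h2)
    exact add_pos_of_nonneg_of_pos (mul_self_nonneg _) (mul_self_pos.2 h2)
  · exact add_pos_of_pos_of_nonneg (mul_self_pos.2 h1) (mul_self_nonneg _)

theorem eq_of_dot2 {u x y : ℝ × ℝ} (hu : u ≠ 0) (h1 : dot2 u x = dot2 u y)
    (h2 : dot2 (turn u) x = dot2 (turn u) y) : x = y := by
  have := dot2_self_pos hu
  simp only [dot2, turn] at *
  have e1 : (x.1 - y.1) * (u.1 * u.1 + u.2 * u.2) = 0 := by linear_combination u.1 * h1 + u.2 * h2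
  have e2 : (x.2 - y.2) * (u.1 * u.1 + u.2 * u.2) = 0 := by linear_combination u.2 * h1 - u.1 * h2
  ext
  · linarith [(mul_eq_zero.1 e1).resolve_right this.ne']
  · linarith [(mul_eq_zero.1 e2).resolve_right this.ne']

theorem dot2_sub (u x y : ℝ × ℝ) : dot2 u (x - y) = dot2 u x - dot2 u y := by
  simp [dot2]; ring

theorem dot2_add_smul (u x y : ℝ × ℝ) (s t : ℝ) :
    dot2 u (s • x + t • y) = s * dot2 u x + t * dot2 u y := by
  simp [dot2]; ring

/-- Among finitely many points, a strict lexicographic minimum of `u` and `w` is the strict minimum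
of `u + ε w` for small positive `ε`. -/
theorem isCorner_of_lex {i : ι} (u w : ℝ × ℝ) (h1 : ∀ k, dot2 u (P i) ≤ dot2 u (P k))
    (h2 : ∀ k, k ≠ i → dot2 u (P k) = dot2 u (P i) → dot2 w (P i) < dot2 w (P k)) :
    IsCorner P i := by
  have key : ∀ᶠ ε : ℝ in 𝓝[>] 0, ∀ k, k ≠ i →
      0 < (dot2 u (P k) - dot2 u (P i)) + ε * (dot2 w (P k) - dot2 w (P i)) := by
    rw [Filter.eventually_all]
    intro k
    by_cases hk : k = i
    · exact Filter.Eventually.of_forall fun _ h => absurd hk h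
    rcases (h1 k).eq_or_lt with h | h
    · filter_upwards [self_mem_nhdsWithin] with ε hε _
      have := h2 k hk h.symm
      have := mul_pos (Set.mem_Ioi.1 hε) (sub_pos.2 this)
      linarith
    · have hc : Filter.Tendsto (fun ε : ℝ =>
          (dot2 u (P k) - dot2 u (P i)) + ε * (dot2 w (P k) - dot2 w (P i))) (𝓝[>] 0)
          (𝓝 ((dot2 u (P k) - dot2 u (P i)) + 0 * (dot2 w (P k) - dot2 w (P i)))) := by
        apply Filter.Tendsto.mono_left _ nhdsWithin_le_nhds
        apply Continuous.tendsto
        fun_prop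
      filter_upwards [hc.eventually_const_lt (u := 0) (by linarith)] with ε hε _
      exact hε
  obtain ⟨ε, hε⟩ := key.exists
  refine ⟨u + ε • w, fun k hk => ?_⟩
  have := hε k hk
  simp only [dot2, Prod.fst_add, Prod.snd_add, Prod.smul_fst, Prod.smul_snd, smul_eq_mul] at *
  linarith

/-- The end of a side is a lexicographic minimum; the sign of `σ` selects the end. -/
theorem Boundary.exists_corner_on_line (hP : Boundary P) {u : ℝ × ℝ} (hu : u ≠ 0) (i : ι)
    (hi : ∀ k, dot2 u (P i) ≤ dot2 u (P k)) (σ : ℝ) (hσ : σ ≠ 0) :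
    ∃ v, IsCorner P v ∧ dot2 u (P v) = dot2 u (P i) ∧
      ∀ k, dot2 u (P k) = dot2 u (P i) →
        σ * dot2 (turn u) (P v) ≤ σ * dot2 (turn u) (P k) := by
  classical
  obtain ⟨v, hv, hmin⟩ := Finset.exists_min_image
    (Finset.univ.filter fun k => dot2 u (P k) = dot2 u (P i))
    (fun k => σ * dot2 (turn u) (P k)) ⟨i, by simp⟩
  simp only [Finset.mem_filter, Finset.mem_univ, true_and] at hv hmin
  refine ⟨v, isCorner_of_lex u (σ • turn u) (fun k => hv ▸ hi k) fun k hk he => ?_, hv, hmin⟩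
  have h1 := hmin k (he.trans hv)
  have h2 : dot2 (turn u) (P v) ≠ dot2 (turn u) (P k) := fun h =>
    hk (hP.injective (eq_of_dot2 hu he h.symm))
  have h3 : σ * dot2 (turn u) (P v) ≠ σ * dot2 (turn u) (P k) := fun h =>
    h2 (mul_left_cancel₀ hσ h)
  have h4 := lt_of_le_of_ne h1 h3
  simp only [dot2, Prod.smul_fst, Prod.smul_snd, smul_eq_mul] at *
  linarith

theorem Boundary.exists_corner_min [Nonempty ι] (hP : Boundary P) {u : ℝ × ℝ} (hu : u ≠ 0) :
    ∃ v, IsCorner P v ∧ ∀ k, dot2 u (P v) ≤ dot2 u (P k) := by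
  obtain ⟨i, -, hi⟩ := Finset.exists_min_image Finset.univ (fun k => dot2 u (P k))
    Finset.univ_nonempty
  obtain ⟨v, hv, he, -⟩ := hP.exists_corner_on_line hu i (fun k => hi k (Finset.mem_univ _)) 1
    one_ne_zero
  exact ⟨v, hv, fun k => he ▸ hi k (Finset.mem_univ _)⟩

/-- A point that is not a corner lies on a supporting line, between other points. -/
theorem Boundary.exists_line_of_not_corner (hP : Boundary P) {i : ι} (hi : ¬IsCorner P i) :
    ∃ u : ℝ × ℝ, u ≠ 0 ∧ (∀ k, dot2 u (P i) ≤ dot2 u (P k)) ∧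
      (∃ a, dot2 u (P a) = dot2 u (P i) ∧ dot2 (turn u) (P a) < dot2 (turn u) (P i)) ∧
      ∃ b, dot2 u (P b) = dot2 u (P i) ∧ dot2 (turn u) (P i) < dot2 (turn u) (P b) := by
  obtain ⟨u, hu, hs⟩ := hP.support i
  have hne : ∀ k, k ≠ i → dot2 u (P k) = dot2 u (P i) →
      dot2 (turn u) (P k) ≠ dot2 (turn u) (P i) := fun k hk h1 h2 =>
    hk (hP.injective (eq_of_dot2 hu h1 h2))
  refine ⟨u, hu, hs, ?_, ?_⟩
  · by_contra! h
    refine hi (isCorner_of_lex u (turn u) hs fun k hk he => ?_)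
    exact lt_of_le_of_ne (h k he) (hne k hk he).symm
  · by_contra! h
    refine hi (isCorner_of_lex u (-turn u) hs fun k hk he => ?_)
    have := lt_of_le_of_ne (h k he) (hne k hk he)
    simp only [dot2, Prod.fst_neg, Prod.snd_neg] at *
    linarith

/-- A boundary point is not an inner point of a triangle. -/
theorem Boundary.det2_eq_zero_of_combination (hP : Boundary P) {j a b c : ι} {α β γ : ℝ}
    (hα : 0 < α) (hβ : 0 < β) (hγ : 0 < γ) (hs : α + β + γ = 1)
    (h : P j = α • P a + β • P b + γ • P c) : det2 (P a - P c) (P b - P c) = 0 := by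
  obtain ⟨u, hu, hsup⟩ := hP.support j
  have e : dot2 u (P j) = α * dot2 u (P a) + β * dot2 u (P b) + γ * dot2 u (P c) := by
    rw [h]; simp [dot2]; ring
  have ha := hsup a
  have hb := hsup b
  have hc := hsup c
  have e0 : α * (dot2 u (P a) - dot2 u (P j)) + β * (dot2 u (P b) - dot2 u (P j)) +
      γ * (dot2 u (P c) - dot2 u (P j)) = 0 := by
    linear_combination -e + (-dot2 u (P j)) * hs
  have p1 := mul_nonneg hα.le (sub_nonneg.2 ha)
  have p2 := mul_nonneg hβ.le (sub_nonneg.2 hb)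
  have p3 := mul_nonneg hγ.le (sub_nonneg.2 hc)
  have q1 : dot2 u (P a) - dot2 u (P j) = 0 :=
    (mul_eq_zero.1 (by linarith : α * (dot2 u (P a) - dot2 u (P j)) = 0)).resolve_left hα.ne'
  have q2 : dot2 u (P b) - dot2 u (P j) = 0 :=
    (mul_eq_zero.1 (by linarith : β * (dot2 u (P b) - dot2 u (P j)) = 0)).resolve_left hβ.ne'
  have q3 : dot2 u (P c) - dot2 u (P j) = 0 :=
    (mul_eq_zero.1 (by linarith : γ * (dot2 u (P c) - dot2 u (P j)) = 0)).resolve_left hγ.ne'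
  have := det2_mul_dot2 u (P a - P c) (P b - P c)
  rw [dot2_sub u (P b), dot2_sub u (P a), show dot2 u (P b) - dot2 u (P c) = 0 by linarith,
    show dot2 u (P a) - dot2 u (P c) = 0 by linarith] at this
  exact (mul_eq_zero.1 (this.trans (by ring))).resolve_right (dot2_self_pos hu).ne'

theorem IsCorner.not_combination {j a b c : ι} (hj : IsCorner P j) (ha : a ≠ j) (hb : b ≠ j)
    (hc : c ≠ j) {α β γ : ℝ} (hα : 0 ≤ α) (hβ : 0 ≤ β) (hγ : 0 ≤ γ) (hs : α + β + γ = 1)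
    (h : P j = α • P a + β • P b + γ • P c) : False := by
  obtain ⟨u, hu⟩ := hj
  have e : dot2 u (P j) = α * dot2 u (P a) + β * dot2 u (P b) + γ * dot2 u (P c) := by
    nth_rewrite 1 [h]; simp [dot2]; ring
  have e0 : α * (dot2 u (P a) - dot2 u (P j)) + β * (dot2 u (P b) - dot2 u (P j)) +
      γ * (dot2 u (P c) - dot2 u (P j)) = 0 := by
    linear_combination -e + (-dot2 u (P j)) * hs
  have ha' := sub_pos.2 (hu a ha)
  have hb' := sub_pos.2 (hu b hb)
  have hc' := sub_pos.2 (hu c hc)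
  have p1 := mul_nonneg hα ha'.le
  have p2 := mul_nonneg hβ hb'.le
  have p3 := mul_nonneg hγ hc'.le
  have q1 : α = 0 := (mul_eq_zero.1 (by linarith :
    α * (dot2 u (P a) - dot2 u (P j)) = 0)).resolve_right ha'.ne'
  have q2 : β = 0 := (mul_eq_zero.1 (by linarith :
    β * (dot2 u (P b) - dot2 u (P j)) = 0)).resolve_right hb'.ne'
  have q3 : γ = 0 := (mul_eq_zero.1 (by linarith :
    γ * (dot2 u (P c) - dot2 u (P j)) = 0)).resolve_right hc'.ne'
  linarith

end AreaCubic

/-! ### The maximum over the weights of the corners -/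

namespace AreaCubic

variable {ι : Type*} [Fintype ι] {P : ι → ℝ × ℝ}

theorem le_cubic {x : ι → ℝ} (hx : ∀ i, 0 ≤ x i) (i j k : ι) :
    planeArea (P i) (P j) (P k) * x i * x j * x k ≤ cubic P x := by
  have h : ∀ i j k, 0 ≤ planeArea (P i) (P j) (P k) * x i * x j * x k := fun i j k =>
    mul_nonneg (mul_nonneg (mul_nonneg (planeArea_nonneg _ _ _) (hx i)) (hx j)) (hx k)
  rw [cubic_eq_sum]
  calc _ ≤ ∑ k, planeArea (P i) (P j) (P k) * x i * x j * x k :=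
        Finset.single_le_sum (f := fun k => planeArea (P i) (P j) (P k) * x i * x j * x k)
          (fun k _ => h i j k) (Finset.mem_univ k)
    _ ≤ ∑ j, ∑ k, planeArea (P i) (P j) (P k) * x i * x j * x k :=
        Finset.single_le_sum (f := fun j => ∑ k, planeArea (P i) (P j) (P k) * x i * x j * x k)
          (fun j _ => Finset.sum_nonneg fun k _ => h i j k) (Finset.mem_univ j)
    _ ≤ _ := Finset.single_le_sum
          (f := fun i => ∑ j, ∑ k, planeArea (P i) (P j) (P k) * x i * x j * x k)
          (fun i _ => Finset.sum_nonneg fun j _ => Finset.sum_nonneg fun k _ => h i j k)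
          (Finset.mem_univ i)

theorem dot2_turn (x y : ℝ × ℝ) : dot2 (turn x) y = -det2 x y := by
  simp [dot2, det2, turn]; ring

theorem turn_ne_zero {u : ℝ × ℝ} (hu : u ≠ 0) : turn u ≠ 0 := by
  intro h
  apply hu
  have h1 := congrArg Prod.fst h
  have h2 := congrArg Prod.snd h
  simp only [turn, Prod.fst_zero, Prod.snd_zero, neg_eq_zero] at h1 h2
  exact Prod.ext h2 h1

theorem dot2_neg_left (u x : ℝ × ℝ) : dot2 (-u) x = -dot2 u x := by
  simp [dot2]; ring

/-- Linear functions take their extremes at corners. If all corners lay on the line through two of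
them, then so would all points. -/
theorem Boundary.exists_corner_triangle (hP : Boundary P) :
    ∃ i j k, IsCorner P i ∧ IsCorner P j ∧ IsCorner P k ∧
      det2 (P j - P i) (P k - P i) ≠ 0 := by
  obtain ⟨i, j, k, hd⟩ := hP.nondegenerate
  have : Nonempty ι := ⟨i⟩
  have hu : P j - P i ≠ 0 := by
    intro h; rw [h] at hd; simp [det2] at hd
  obtain ⟨a, ha, ha'⟩ := hP.exists_corner_min hu
  obtain ⟨b, hb, hb'⟩ := hP.exists_corner_min (neg_ne_zero.2 hu)
  have hab : P b - P a ≠ 0 := by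
    intro h
    have h1 := ha' i
    have h2 := hb' j
    rw [sub_eq_zero.1 h, dot2_neg_left, dot2_neg_left] at h2
    have h3 := dot2_self_pos hu
    rw [dot2_sub] at h3
    linarith
  by_contra! h
  have hn := turn_ne_zero hab
  obtain ⟨c, hc, hc'⟩ := hP.exists_corner_min hn
  obtain ⟨d, hd1, hd'⟩ := hP.exists_corner_min (neg_ne_zero.2 hn)
  have h1 := h a b c ha hb hc
  have h2 := h a b d ha hb hd1
  have e1 := dot2_turn (P b - P a) (P c - P a)
  have e2 := dot2_turn (P b - P a) (P d - P a)
  rw [h1, dot2_sub] at e1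
  rw [h2, dot2_sub] at e2
  have hall : ∀ k, dot2 (turn (P b - P a)) (P k) = dot2 (turn (P b - P a)) (P a) := by
    intro k
    have f1 := hc' k
    have f2 := hd' k
    rw [dot2_neg_left, dot2_neg_left] at f2
    linarith
  apply hd
  have := det2_mul_dot2 (turn (P b - P a)) (P j - P i) (P k - P i)
  rw [dot2_sub (turn _) (P k), dot2_sub (turn (P b - P a)) (P j), hall k, hall j, hall i] at this
  exact (mul_eq_zero.1 (this.trans (by ring))).resolve_right (dot2_self_pos hn).ne'

theorem tri_single [DecidableEq ι] (p : ι) (y z : ι → ℝ) :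
    tri P (Pi.single p 1) y z = weight P y z (P p) := by
  simp [tri, Pi.single_apply]

/-- Divide by `ε` and let it tend to zero. -/
theorem nonpos_of_forall_cubic {a b c : ℝ}
    (h : ∀ ε : ℝ, 0 < ε → ε ≤ 1 → 3 * ε * a + 3 * ε ^ 2 * b + ε ^ 3 * c ≤ 0) : a ≤ 0 := by
  have hc : Filter.Tendsto (fun ε : ℝ => 3 * a + 3 * ε * b + ε ^ 2 * c) (𝓝[>] 0)
      (𝓝 (3 * a + 3 * 0 * b + 0 ^ 2 * c)) := by
    apply Filter.Tendsto.mono_left _ nhdsWithin_le_nhds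
    apply Continuous.tendsto (f := fun ε : ℝ => 3 * a + 3 * ε * b + ε ^ 2 * c)
    fun_prop
  have : 3 * a + 3 * 0 * b + 0 ^ 2 * c ≤ 0 := by
    refine le_of_tendsto hc ?_
    filter_upwards [Ioc_mem_nhdsGT (zero_lt_one (α := ℝ))] with ε hε
    have h1 := h ε hε.1 hε.2
    have h2 : 3 * ε * a + 3 * ε ^ 2 * b + ε ^ 3 * c = ε * (3 * a + 3 * ε * b + ε ^ 2 * c) := by
      ring
    rw [h2] at h1
    exact nonpos_of_mul_nonpos_right h1 hε.1
  linarith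

variable (P) in
/-- The weights that are supported on the corners. -/
def cornerSimplex : Set (ι → ℝ) :=
  {x | (∀ i, 0 ≤ x i) ∧ ∑ i, x i = 1 ∧ ∀ i, ¬IsCorner P i → x i = 0}

/-- First-order condition: the derivative from `x` toward the vertex of `p` is `3 (weight - cubic)`.
-/
theorem weight_le_of_isMax {x : ι → ℝ} (hx : x ∈ cornerSimplex P)
    (hmax : ∀ y ∈ cornerSimplex P, cubic P y ≤ cubic P x) {p : ι} (hp : IsCorner P p) :
    weight P x x (P p) ≤ cubic P x := by
  classical
  obtain ⟨h0, h1, h2⟩ := hx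
  have key : weight P x x (P p) - cubic P x ≤ 0 := by
    refine nonpos_of_forall_cubic (b := tri P (Pi.single p 1 + (-1 : ℝ) • x)
      (Pi.single p 1 + (-1 : ℝ) • x) x) (c := cubic P (Pi.single p 1 + (-1 : ℝ) • x))
      fun ε hε hε1 => ?_
    have hm := hmax (x + ε • (Pi.single p 1 + (-1 : ℝ) • x)) ⟨fun i => ?_, ?_, fun i hi => ?_⟩
    · rw [cubic_add_smul, tri_add_smul, tri_single] at hm
      unfold cubic at hm ⊢
      linarith
    · have := h0 i
      simp only [Pi.add_apply, Pi.smul_apply, smul_eq_mul, Pi.single_apply]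
      split_ifs <;> nlinarith
    · simp only [Pi.add_apply, Pi.smul_apply, smul_eq_mul, Finset.sum_add_distrib,
        ← Finset.mul_sum, h1]
      rw [Finset.sum_pi_single']
      simp
    · have hip : i ≠ p := fun h => hi (h ▸ hp)
      simp [h2 i hi, hip]
  linarith

/-- Uniform weights on the corners already give a positive value. -/
theorem cubic_pos_of_isMax (hP : Boundary P) {x : ι → ℝ}
    (hmax : ∀ y ∈ cornerSimplex P, cubic P y ≤ cubic P x) : 0 < cubic P x := by
  classical
  obtain ⟨i, j, k, hi, hj, hk, hd⟩ := hP.exists_corner_triangle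
  set c : ℝ := ((Finset.univ.filter fun i => IsCorner P i).card : ℝ) with hc
  have hc0 : 0 < c := by
    rw [hc]
    exact_mod_cast Finset.card_pos.2 ⟨i, by simpa using hi⟩
  let y : ι → ℝ := fun i => if IsCorner P i then 1 / c else 0
  have hy : y ∈ cornerSimplex P := by
    refine ⟨fun i => ?_, ?_, fun i hi => by simp [y, hi]⟩
    · simp only [y]; split_ifs <;> positivity
    · simp only [y]
      rw [← Finset.sum_filter, Finset.sum_const, nsmul_eq_mul, ← hc]
      field_simp
  refine lt_of_lt_of_le ?_ ((le_cubic hy.1 i j k).trans (hmax y hy))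
  have : 0 < planeArea (P i) (P j) (P k) := by
    unfold planeArea
    have := abs_pos.2 hd
    linarith
  have hyp : ∀ i, IsCorner P i → 0 < y i := fun i hi => by simp only [y, hi, if_true]; positivity
  exact mul_pos (mul_pos (mul_pos this (hyp i hi)) (hyp j hj)) (hyp k hk)

theorem sum_mul_weight (x : ι → ℝ) : ∑ i, x i * weight P x x (P i) = cubic P x := rfl

/-- Complementary slackness: the average of `weight` with respect to `x` is `cubic`, which bounds it
at every corner. -/
theorem weight_eq_of_isMax {x : ι → ℝ} (hx : x ∈ cornerSimplex P)
    (hmax : ∀ y ∈ cornerSimplex P, cubic P y ≤ cubic P x) {p : ι} (hp : x p ≠ 0) :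
    weight P x x (P p) = cubic P x := by
  have h1 : ∑ i, x i * (cubic P x - weight P x x (P i)) = 0 := by
    simp only [mul_sub, Finset.sum_sub_distrib, sum_mul_weight, ← Finset.sum_mul, hx.2.1]
    ring
  have h2 : ∀ i ∈ Finset.univ, 0 ≤ x i * (cubic P x - weight P x x (P i)) := by
    intro i _
    by_cases hi : IsCorner P i
    · exact mul_nonneg (hx.1 i) (sub_nonneg.2 (weight_le_of_isMax hx hmax hi))
    · rw [hx.2.2 i hi, zero_mul]
  have h3 := (Finset.sum_eq_zero_iff_of_nonneg h2).1 h1 p (Finset.mem_univ _)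
  linarith [(mul_eq_zero.1 h3).resolve_left hp]

/-- The maximum of the cubic form over the weights of the corners has positive weights. -/
theorem pos_of_isMax (hP : Boundary P) {x : ι → ℝ} (hx : x ∈ cornerSimplex P)
    (hmax : ∀ y ∈ cornerSimplex P, cubic P y ≤ cubic P x) {i : ι} (hi : IsCorner P i) :
    0 < x i := by
  classical
  -- If `i` has weight zero, let `a`, `b` be the extreme weighted points as seen from `P i` and `c`
  -- a third one. The segment from `P i` to `P c` meets the segment from `P a` to `P b` at `y`, and
  -- the value of `weight` at `y` is contradictory.
  by_contra hxi
  have hxi : x i = 0 := le_antisymm (not_lt.1 hxi) (hx.1 i)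
  have hcorner : ∀ {k}, x k ≠ 0 → IsCorner P k := fun {k} hk => by
    by_contra h; exact hk (hx.2.2 k h)
  have hki : ∀ {k}, x k ≠ 0 → k ≠ i := fun {k} hk h => hk (h ▸ hxi)
  obtain ⟨u, hui⟩ := id hi
  have hne : ∃ k, k ≠ i := by
    by_contra! h
    have := hx.2.1
    rw [Finset.sum_congr rfl fun k _ => by rw [h k, hxi]] at this
    simp at this
  have hu : u ≠ 0 := by
    rintro rfl
    obtain ⟨k, hk⟩ := hne
    have := hui k hk
    simp [dot2] at this
  -- Coordinates centered at `P i`: `N` is the height above a supporting line, and the quotient `W /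
  -- N` orders the other points by direction.
  set N : ι → ℝ := fun k => dot2 u (P k - P i) with hN
  set W : ι → ℝ := fun k => dot2 (turn u) (P k - P i) with hW
  have hNpos : ∀ {k}, k ≠ i → 0 < N k := fun {k} hk => by
    simp only [hN, dot2_sub]; linarith [hui k hk]
  -- `d j k` is `det2 (P j - P i) (P k - P i)`, scaled by `dot2 u u`.
  set d : ι → ι → ℝ := fun j k => W j * N k - N j * W k with hd
  have hdd : ∀ j, d j j = 0 := fun j => by simp only [hd]; ring
  have hds : ∀ j k, d k j = -d j k := fun j k => by simp only [hd]; ring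
  have huu := dot2_self_pos hu
  have hdet : ∀ a j k, det2 (P j - P a) (P k - P a) * dot2 u u = d a j + d j k - d a k := by
    intro a j k
    rw [det2_mul_dot2]
    simp only [hd, hN, hW, dot2_sub]
    ring
  have hcomb : ∀ {p q r : ι}, d p r ≠ 0 → P q =
      (1 - d q r / d p r - d p q / d p r) • P i + (d q r / d p r) • P p +
        (d p q / d p r) • P r := by
    intro p q r h
    refine eq_of_dot2 hu ?_ ?_
    · have : dot2 u (P q) - dot2 u (P i) = d q r / d p r * (dot2 u (P p) - dot2 u (P i)) +
          d p q / d p r * (dot2 u (P r) - dot2 u (P i)) := by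
        simp only [← dot2_sub]
        change N q = d q r / d p r * N p + d p q / d p r * N r
        field_simp
        simp only [hd]; ring
      have e : ∀ s t w : ℝ, dot2 u (s • P i + t • P p + w • P r) =
          s * dot2 u (P i) + t * dot2 u (P p) + w * dot2 u (P r) := by
        intro s t w; simp [dot2]; ring
      rw [e]; linarith
    · have : dot2 (turn u) (P q) - dot2 (turn u) (P i) =
          d q r / d p r * (dot2 (turn u) (P p) - dot2 (turn u) (P i)) +
          d p q / d p r * (dot2 (turn u) (P r) - dot2 (turn u) (P i)) := by
        simp only [← dot2_sub]
        change W q = d q r / d p r * W p + d p q / d p r * W r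
        field_simp
        simp only [hd]; ring
      have e : ∀ s t w : ℝ, dot2 (turn u) (s • P i + t • P p + w • P r) =
          s * dot2 (turn u) (P i) + t * dot2 (turn u) (P p) + w * dot2 (turn u) (P r) := by
        intro s t w; simp [dot2]; ring
      rw [e]; linarith
  -- Otherwise the corner `q` would lie in the triangle with vertices `i`, `p`, `r`.
  have hconv : ∀ {p q r : ι}, x q ≠ 0 → 0 < d p q → 0 < d q r → 0 < d p r →
      d p r < d p q + d q r := by
    intro p q r hq h1 h2 h3
    by_contra h
    have hpq : p ≠ q := fun e => by rw [e, hdd] at h1; exact lt_irrefl _ h1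
    have hrq : r ≠ q := fun e => by rw [e, hdd] at h2; exact lt_irrefl _ h2
    refine (hcorner hq).not_combination (hki hq).symm hpq hrq (α := 1 - d q r / d p r - d p q / d p r)
      (β := d q r / d p r) (γ := d p q / d p r) ?_ (by positivity) (by positivity) (by ring)
      (hcomb h3.ne')
    have : d q r / d p r + d p q / d p r ≤ 1 := by
      rw [← add_div, div_le_one h3]; linarith
    linarith
  -- Of two weighted points in the same direction from `P i`, the nearer would lie on a segment and
  -- be no corner.
  have hslope : ∀ {j k}, x j ≠ 0 → x k ≠ 0 → j ≠ k → d j k ≠ 0 := by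
    have aux : ∀ {j k}, x j ≠ 0 → x k ≠ 0 → j ≠ k → d j k = 0 → N j ≤ N k → False := by
      intro j k hj hk hjk h0 hle
      have hk0 := hNpos (hki hk)
      have hj0 := hNpos (hki hj)
      have e : P j = (1 - N j / N k) • P i + (N j / N k) • P k + (0 : ℝ) • P k := by
        have e : ∀ (w : ℝ × ℝ) (s t : ℝ), dot2 w (s • P i + t • P k + (0 : ℝ) • P k) =
          s * dot2 w (P i) + t * dot2 w (P k) := by
          intro w s t; simp [dot2]; ring
        refine eq_of_dot2 hu ?_ ?_
        · rw [e]
          have : N j = N j / N k * N k := by field_simp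
          simp only [hN, dot2_sub] at this ⊢
          linarith
        · rw [e]
          have : W j = N j / N k * W k := by
            field_simp
            simp only [hd] at h0
            linarith
          simp only [hW, dot2_sub] at this
          linarith
      refine (hcorner hj).not_combination (hki hj).symm hjk.symm hjk.symm
        (sub_nonneg.2 ((div_le_one hk0).2 hle)) (by positivity) le_rfl (by ring) e
    intro j k hj hk hjk h0
    rcases le_total (N j) (N k) with h | h
    · exact aux hj hk hjk h0 h
    · exact aux hk hj hjk.symm (by rw [hds, h0, neg_zero]) h
  obtain ⟨s₀, hs₀⟩ : ∃ k, x k ≠ 0 := by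
    by_contra! h
    have := hx.2.1
    simp [h] at this
  have hS : (Finset.univ.filter fun k => x k ≠ 0).Nonempty := ⟨s₀, by simpa using hs₀⟩
  obtain ⟨a, ha, hamax⟩ := Finset.exists_max_image _ (fun k => W k / N k) hS
  obtain ⟨b, hb, hbmin⟩ := Finset.exists_min_image _ (fun k => W k / N k) hS
  simp only [Finset.mem_filter, Finset.mem_univ, true_and] at ha hb hamax hbmin
  have hda : ∀ {s}, x s ≠ 0 → s ≠ a → 0 < d a s := by
    intro s hs hsa
    refine lt_of_le_of_ne ?_ (hslope ha hs hsa.symm).symm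
    have := hamax s hs
    rw [div_le_div_iff₀ (hNpos (hki hs)) (hNpos (hki ha))] at this
    simp only [hd]; linarith
  have hdb : ∀ {s}, x s ≠ 0 → s ≠ b → 0 < d s b := by
    intro s hs hsb
    refine lt_of_le_of_ne ?_ (hslope hs hb hsb).symm
    have := hbmin s hs
    rw [div_le_div_iff₀ (hNpos (hki hb)) (hNpos (hki hs))] at this
    simp only [hd]; linarith
  have hpos := cubic_pos_of_isMax hP hmax
  -- A cubic form of areas is zero when only two points have weight.
  obtain ⟨c, hc, hca, hcb⟩ : ∃ c, x c ≠ 0 ∧ c ≠ a ∧ c ≠ b := by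
    by_contra! h
    have h0 : cubic P x = 0 := by
      rw [cubic_eq_sum]
      refine Finset.sum_eq_zero fun j _ => Finset.sum_eq_zero fun k _ =>
        Finset.sum_eq_zero fun l _ => ?_
      by_contra hn
      have hj : x j ≠ 0 := fun e => hn (by rw [e]; ring)
      have hk : x k ≠ 0 := fun e => hn (by rw [e]; ring)
      have hl : x l ≠ 0 := fun e => hn (by rw [e]; ring)
      have hA : planeArea (P j) (P k) (P l) ≠ 0 := fun e => hn (by rw [e]; ring)
      have hjk : j ≠ k := fun e => hA (by
        rw [e, planeArea_swap_right, planeArea_swap_left, planeArea_self])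
      have hkl : k ≠ l := fun e => hA (by rw [e, planeArea_self])
      have hjl : j ≠ l := fun e => hA (by rw [e, planeArea_swap_left, planeArea_self])
      have h1 := h j hj
      have h2 := h k hk
      have h3 := h l hl
      by_cases e1 : j = a
      · have e2 := h2 (fun e => hjk (e1.trans e.symm))
        have e3 := h3 (fun e => hjl (e1.trans e.symm))
        exact hkl (e2.trans e3.symm)
      · have e1' := h1 e1
        by_cases e2 : k = a
        · exact hjl (e1'.trans (h3 (fun e => hkl (e2.trans e.symm))).symm)
        · exact hjk (e1'.trans (h2 e2).symm)
    exact hpos.ne' h0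
  have hac := hda hc hca
  have hcb' := hdb hc hcb
  have hab : a ≠ b := by
    rintro rfl
    rw [hds] at hcb'
    linarith
  have hdab := hdb ha hab
  set α := d c b / d a b with hα
  set β := d a c / d a b with hβ
  have hα0 : 0 < α := div_pos hcb' hdab
  have hβ0 : 0 < β := div_pos hac hdab
  have hαβ : 1 < α + β := by
    rw [hα, hβ, ← add_div, one_lt_div hdab]
    linarith [hconv hc hac hcb' hdab]
  have hT : 0 < α + β := by linarith
  have hPc := hcomb (p := a) (q := c) (r := b) hdab.ne'
  rw [← hα, ← hβ] at hPc
  set y : ℝ × ℝ := (α / (α + β)) • P a + (β / (α + β)) • P b with hy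
  -- Since `α + β > 1`, the point `y` lies strictly between `P i` and `P c`.
  have hy2 : y = (1 - 1 / (α + β)) • P i + (1 / (α + β)) • P c := by
    rw [hPc, hy]
    ext <;>
    · simp only [Prod.fst_add, Prod.snd_add, Prod.smul_fst, Prod.smul_snd, smul_eq_mul]
      field_simp
      ring
  -- The segment from `P a` to `P b` is a side of the hull of the weighted points, so no line
  -- through two of these separates its ends.
  have hsign : ∀ {j k}, x j ≠ 0 → x k ≠ 0 →
      0 ≤ det2 (P j - P a) (P k - P a) * det2 (P j - P b) (P k - P b) := by
    have aux : ∀ {j k}, x j ≠ 0 → x k ≠ 0 → 0 < d j k →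
        0 ≤ d a j + d j k - d a k ∧ 0 ≤ d b j + d j k - d b k := by
      intro j k hj hk hjk
      constructor
      · by_cases hja : j = a
        · rw [hja, hdd]; linarith
        · have hka : k ≠ a := by
            rintro rfl
            rw [hds] at hjk
            linarith [hda hj hja]
          linarith [hconv hj (hda hj hja) hjk (hda hk hka)]
      · by_cases hkb : k = b
        · rw [hkb, hdd, hds]; linarith
        · have hjb : j ≠ b := by
            rintro rfl
            rw [hds] at hjk
            linarith [hdb hk hkb]
          have := hconv hk hjk (hdb hk hkb) (hdb hj hjb)
          rw [hds j b, hds k b]; linarith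
    intro j k hj hk
    have e1 := hdet a j k
    have e2 := hdet b j k
    have : 0 ≤ (det2 (P j - P a) (P k - P a) * dot2 u u) *
        (det2 (P j - P b) (P k - P b) * dot2 u u) := by
      rw [e1, e2]
      rcases eq_or_ne j k with rfl | hjk
      · rw [hdd]; simp
      · rcases lt_or_gt_of_ne (hslope hj hk hjk) with h | h
        · obtain ⟨f1, f2⟩ := aux hk hj (by rw [hds]; linarith)
          rw [hds j k] at f1 f2
          exact mul_nonneg_of_nonpos_of_nonpos (by linarith) (by linarith)
        · obtain ⟨f1, f2⟩ := aux hj hk h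
          exact mul_nonneg f1 f2
    have h2 : 0 ≤ (det2 (P j - P a) (P k - P a) * det2 (P j - P b) (P k - P b)) *
        (dot2 u u * dot2 u u) := by
      calc _ ≤ _ := this
        _ = _ := by ring
    exact nonneg_of_mul_nonneg_left h2 (by positivity)
  -- By affinity: `weight` has the maximal value at both `P a` and `P b`.
  have hwy : weight P x x y = cubic P x := by
    have : weight P x x y = α / (α + β) * weight P x x (P a) + β / (α + β) * weight P x x (P b) := by
      simp only [weight, Finset.mul_sum, ← Finset.sum_add_distrib]
      refine Finset.sum_congr rfl fun j _ => Finset.sum_congr rfl fun k _ => ?_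
      by_cases hj : x j = 0
      · simp [hj]
      by_cases hk : x k = 0
      · simp [hk]
      rw [hy, planeArea_affine _ _ _ _ _ _ (by positivity) (by positivity) (by field_simp)
        (hsign hj hk)]
      ring
    rw [this, weight_eq_of_isMax hx hmax ha, weight_eq_of_isMax hx hmax hb]
    field_simp
  set s := 1 / (α + β) with hs
  have hs0 : 0 < s := by positivity
  have hs1 : s < 1 := by rw [hs, div_lt_one hT]; exact hαβ
  -- Convexity along the segment from `P i` to `P c`. It is strict because of the pair `a`, `b`: the
  -- triangle with `y` is degenerate, the one with `P i` is not.
  have hlt : weight P x x y < (1 - s) * weight P x x (P i) + s * weight P x x (P c) := by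
    rw [← sub_pos]
    have : (1 - s) * weight P x x (P i) + s * weight P x x (P c) - weight P x x y =
        ∑ j, ∑ k, ((1 - s) * planeArea (P i) (P j) (P k) + s * planeArea (P c) (P j) (P k) -
          planeArea y (P j) (P k)) * (x j * x k) := by
      simp only [weight, Finset.mul_sum, ← Finset.sum_add_distrib, ← Finset.sum_sub_distrib]
      refine Finset.sum_congr rfl fun j _ => Finset.sum_congr rfl fun k _ => by ring
    rw [this]
    have hnn : ∀ j k, 0 ≤ ((1 - s) * planeArea (P i) (P j) (P k) +
        s * planeArea (P c) (P j) (P k) - planeArea y (P j) (P k)) * (x j * x k) := by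
      intro j k
      refine mul_nonneg ?_ (mul_nonneg (hx.1 j) (hx.1 k))
      rw [hy2]
      have := planeArea_convex (P i) (P c) (P j) (P k) (1 - s) s (by linarith) hs0.le (by ring)
      linarith
    refine Finset.sum_pos' (fun j _ => Finset.sum_nonneg fun k _ => hnn j k)
      ⟨a, Finset.mem_univ _, Finset.sum_pos' (fun k _ => hnn a k) ⟨b, Finset.mem_univ _, ?_⟩⟩
    have hxa : 0 < x a := lt_of_le_of_ne (hx.1 a) ha.symm
    have hxb : 0 < x b := lt_of_le_of_ne (hx.1 b) hb.symm
    refine mul_pos ?_ (mul_pos hxa hxb)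
    have h0 : planeArea y (P a) (P b) = 0 := by
      rw [hy, planeArea_affine _ _ _ _ _ _ (by positivity) (by positivity) (by field_simp)
        (hsign ha hb), planeArea_swap_right, planeArea_swap_left, planeArea_self,
        planeArea_swap_left, planeArea_self]
      ring
    have h1 : 0 < planeArea (P i) (P a) (P b) := by
      unfold planeArea
      have e := hdet i a b
      have : d i a + d a b - d i b = d a b := by
        simp [hd, hN, hW, dot2]
      rw [this] at e
      have : 0 < det2 (P a - P i) (P b - P i) := by
        by_contra hn
        have := mul_nonpos_of_nonpos_of_nonneg (not_lt.1 hn) huu.le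
        linarith
      rw [abs_of_pos this]; linarith
    rw [h0]
    have := planeArea_nonneg (P c) (P a) (P b)
    have := mul_pos (sub_pos.2 hs1) h1
    have := mul_nonneg hs0.le (planeArea_nonneg (P c) (P a) (P b))
    linarith
  rw [hwy, weight_eq_of_isMax hx hmax hc] at hlt
  have := weight_le_of_isMax hx hmax hi
  have h1 : 0 < (1 - s) * (weight P x x (P i) - cubic P x) := by linarith
  have := mul_nonpos_of_nonneg_of_nonpos (sub_pos.2 hs1).le (sub_nonpos.2 this)
  linarith

end AreaCubic

/-! ### Points inside the sides, and uniqueness of the local maximum -/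

namespace AreaCubic

variable {ι : Type*} [Fintype ι] {P : ι → ℝ × ℝ}

/-- A point that is not a corner lies between two neighbors (among the corners and any set of other
points); no line through two of these points separates the neighbors. -/
theorem Boundary.exists_neighbors (hP : Boundary P) (U : Finset ι) {i : ι} (hi : ¬IsCorner P i)
    (hiU : i ∉ U) : ∃ a b : ι, ∃ t : ℝ, ∃ u : ℝ × ℝ, (IsCorner P a ∨ a ∈ U) ∧
      (IsCorner P b ∨ b ∈ U) ∧ 0 < t ∧ t < 1 ∧ P i = t • P a + (1 - t) • P b ∧ P a ≠ P b ∧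
      u ≠ 0 ∧ (∀ k, dot2 u (P a) ≤ dot2 u (P k)) ∧ dot2 u (P b) = dot2 u (P a) ∧
      ∀ j k, (IsCorner P j ∨ j ∈ U) → (IsCorner P k ∨ k ∈ U) →
        0 ≤ det2 (P j - P a) (P k - P a) * det2 (P j - P b) (P k - P b) := by
  classical
  obtain ⟨u, hu, hs, ⟨a', ha1, ha2⟩, ⟨b', hb1, hb2⟩⟩ := hP.exists_line_of_not_corner hi
  have hne : ∀ {j}, (IsCorner P j ∨ j ∈ U) → j ≠ i := by
    rintro j (h | h) rfl
    · exact hi h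
    · exact hiU h
  obtain ⟨va, hva, hva1, hva2⟩ := hP.exists_corner_on_line hu i hs 1 one_ne_zero
  obtain ⟨vb, hvb, hvb1, hvb2⟩ := hP.exists_corner_on_line hu i hs (-1) (by norm_num)
  have hvai : dot2 (turn u) (P va) < dot2 (turn u) (P i) := by linarith [hva2 a' ha1]
  have hvbi : dot2 (turn u) (P i) < dot2 (turn u) (P vb) := by linarith [hvb2 b' hb1]
  -- The nearest admissible points on the supporting line, on either side of `P i`; the corners at
  -- the ends of the side are candidates.
  obtain ⟨a, ha, hamax⟩ := Finset.exists_max_image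
    (Finset.univ.filter fun k => (IsCorner P k ∨ k ∈ U) ∧ dot2 u (P k) = dot2 u (P i) ∧
      dot2 (turn u) (P k) < dot2 (turn u) (P i)) (fun k => dot2 (turn u) (P k))
    ⟨va, by simp [hva, hva1, hvai]⟩
  obtain ⟨b, hb, hbmin⟩ := Finset.exists_min_image
    (Finset.univ.filter fun k => (IsCorner P k ∨ k ∈ U) ∧ dot2 u (P k) = dot2 u (P i) ∧
      dot2 (turn u) (P i) < dot2 (turn u) (P k)) (fun k => dot2 (turn u) (P k))
    ⟨vb, by simp [hvb, hvb1, hvbi]⟩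
  simp only [Finset.mem_filter, Finset.mem_univ, true_and] at ha hb hamax hbmin
  obtain ⟨haU, haN, haW⟩ := ha
  obtain ⟨hbU, hbN, hbW⟩ := hb
  have huu := dot2_self_pos hu
  set W : ι → ℝ := fun k => dot2 (turn u) (P k) with hW
  set N : ι → ℝ := fun k => dot2 u (P k) - dot2 u (P i) with hN
  have hN0 : ∀ k, 0 ≤ N k := fun k => sub_nonneg.2 (hs k)
  have hNa : N a = 0 := sub_eq_zero.2 haN
  have hNb : N b = 0 := sub_eq_zero.2 hbN
  have hWab : 0 < W b - W a := by linarith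
  have hPab : P a ≠ P b := by
    intro h
    have : W a = W b := by simp only [hW, h]
    linarith
  have hdet : ∀ a, N a = 0 → ∀ j k, det2 (P j - P a) (P k - P a) * dot2 u u =
      W j * N k - N j * W k - W a * (N k - N j) := by
    intro a ha j k
    rw [det2_mul_dot2]
    simp only [dot2_sub]
    have : dot2 u (P a) = dot2 u (P i) := sub_eq_zero.1 ha
    simp only [hW, hN, this]
    ring
  have hsign : ∀ j k, (IsCorner P j ∨ j ∈ U) → (IsCorner P k ∨ k ∈ U) → N j ≤ N k →
      0 ≤ (W j * N k - N j * W k - W a * (N k - N j)) *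
        (W j * N k - N j * W k - W b * (N k - N j)) := by
    intro j k hj hk hjk
    by_contra hneg
    push Not at hneg
    set X := W j * N k - N j * W k with hX
    rcases hjk.eq_or_lt with h | h
    · rw [h] at hneg
      have : X - W a * (N k - N k) = X := by ring
      rw [this, show X - W b * (N k - N k) = X by ring] at hneg
      exact absurd hneg (not_lt.2 (mul_self_nonneg X))
    have hM : 0 < N k - N j := sub_pos.2 h
    -- the line meets the side strictly between the neighbors
    have h1 : W a * (N k - N j) < X ∧ X < W b * (N k - N j) := by
      have hlt : W a * (N k - N j) < W b * (N k - N j) :=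
        mul_lt_mul_of_pos_right (by linarith) hM
      rcases mul_neg_iff.1 hneg with h | h
      · exact ⟨by linarith, by linarith⟩
      · exfalso; linarith
    rcases (hN0 j).eq_or_lt with hj0 | hj0
    · have hX' : X = W j * (N k - N j) := by rw [hX, ← hj0]; ring
      rw [hX'] at h1
      have g1 := lt_of_mul_lt_mul_right h1.1 hM.le
      have g2 := lt_of_mul_lt_mul_right h1.2 hM.le
      have hjN : dot2 u (P j) = dot2 u (P i) := (sub_eq_zero.1 hj0.symm)
      rcases lt_trichotomy (W j) (W i) with h | h | h
      · linarith [hamax j ⟨hj, hjN, h⟩]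
      · exact hne hj (hP.injective (eq_of_dot2 hu hjN h))
      · linarith [hbmin j ⟨hj, hjN, h⟩]
    · have hk0 : 0 < N k := by linarith
      -- the point `j` would be inside of the triangle `a b k`
      set q := X / (N k - N j) with hq
      have hq1 : W a < q := by rw [hq, lt_div_iff₀ hM]; exact h1.1
      have hq2 : q < W b := by rw [hq, div_lt_iff₀ hM]; exact h1.2
      have hqX : q * (N k - N j) = X := by rw [hq]; field_simp
      have e1 : 0 < (1 - N j / N k) := by rw [sub_pos, div_lt_one hk0]; exact h
      refine absurd (hP.det2_eq_zero_of_combination (j := j) (a := a) (b := b) (c := k)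
        (α := (1 - N j / N k) * ((W b - q) / (W b - W a)))
        (β := (1 - N j / N k) * ((q - W a) / (W b - W a))) (γ := N j / N k)
        (mul_pos e1 (div_pos (by linarith) hWab)) (mul_pos e1 (div_pos (by linarith) hWab))
        (div_pos hj0 hk0) (by field_simp; ring) ?_) ?_
      · have e : ∀ (w : ℝ × ℝ) (r s t : ℝ), dot2 w (r • P a + s • P b + t • P k) =
            r * dot2 w (P a) + s * dot2 w (P b) + t * dot2 w (P k) := by
          intro w r s t; simp [dot2]; ring
        refine eq_of_dot2 hu ?_ ?_
        · rw [e, haN, hbN]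
          have f1 : (1 - N j / N k) * ((W b - q) / (W b - W a)) +
            (1 - N j / N k) * ((q - W a) / (W b - W a)) + N j / N k = 1 := by field_simp; ring
          have f2 : N j / N k * N k = N j := by field_simp
          simp only [hN] at f2 ⊢
          simp only [hN] at f1
          linear_combination (-dot2 u (P i)) * f1 - f2
        · rw [e]
          change W j = _ * W a + _ * W b + _ * W k
          have f : (1 - N j / N k) * ((W b - q) / (W b - W a)) * W a +
            (1 - N j / N k) * ((q - W a) / (W b - W a)) * W b = (1 - N j / N k) * q := by
            field_simp; ring
          rw [f]
          have f2 : (1 - N j / N k) * q = X / N k := by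
            rw [← hqX]; field_simp
          rw [f2, hX]
          field_simp
          ring
      · intro h0
        have := det2_mul_dot2 u (P a - P k) (P b - P k)
        rw [h0, dot2_sub, dot2_sub, dot2_sub, dot2_sub, haN, hbN] at this
        have h2 : (W b - W a) * N k = 0 := by
          simp only [hW, hN]
          linear_combination -this
        exact (mul_pos hWab hk0).ne' h2
  set t := (W b - W i) / (W b - W a) with ht
  refine ⟨a, b, t, u, haU, hbU, div_pos (by linarith) hWab,
    (div_lt_one hWab).2 (by linarith), ?_, hPab, hu, fun k => haN ▸ hs k, hbN.trans haN.symm,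
    fun j k hj hk => ?_⟩
  · refine eq_of_dot2 hu ?_ ?_
    · rw [dot2_add_smul, haN, hbN]; ring
    · rw [dot2_add_smul]
      change W i = t * W a + (1 - t) * W b
      rw [ht]; field_simp; ring
  · have h2 : 0 ≤ (det2 (P j - P a) (P k - P a) * det2 (P j - P b) (P k - P b)) *
        (dot2 u u * dot2 u u) := by
      have : (det2 (P j - P a) (P k - P a) * det2 (P j - P b) (P k - P b)) *
          (dot2 u u * dot2 u u) = (det2 (P j - P a) (P k - P a) * dot2 u u) *
          (det2 (P j - P b) (P k - P b) * dot2 u u) := by ring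
      rw [this, hdet a hNa, hdet b hNb]
      rcases le_total (N j) (N k) with h | h
      · exact hsign j k hj hk h
      · have := hsign k j hk hj h
        calc _ ≤ _ := this
          _ = _ := by ring
    exact nonneg_of_mul_nonneg_left h2 (by positivity)

variable [DecidableEq ι]

theorem tri_combination (i a b : ι) (t : ℝ) (y z : ι → ℝ) :
    tri P (Pi.single i 1 + (-t) • Pi.single a 1 + (-(1 - t)) • Pi.single b 1) y z =
      weight P y z (P i) - t * weight P y z (P a) - (1 - t) * weight P y z (P b) := by
  rw [tri_add_smul, tri_add_smul, tri_single, tri_single, tri_single]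
  ring

theorem weight_single (i : ι) (z : ι → ℝ) (p : ℝ × ℝ) :
    weight P (Pi.single i 1) z p = ∑ k, planeArea p (P i) (P k) * z k := by
  unfold weight
  rw [Finset.sum_eq_single i]
  · simp
  · intro j _ hj; simp [hj]
  · simp

theorem weight_add_smul (x v z : ι → ℝ) (s : ℝ) (p : ℝ × ℝ) :
    weight P (x + s • v) z p = weight P x z p + s * weight P v z p := by
  simp only [weight, Pi.add_apply, Pi.smul_apply, smul_eq_mul, Finset.mul_sum,
    ← Finset.sum_add_distrib]
  refine Finset.sum_congr rfl fun j _ => Finset.sum_congr rfl fun k _ => by ring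

/-- With one corner at `P k`, the triangles on the subsegments from `P i` to `P a` and `P b` have
the fractions `1 - t` and `t` of the area over the whole segment. The second difference is therefore
a negative multiple of that area. -/
theorem tri_combination_self {i a b : ι} {t : ℝ} (ht0 : 0 < t) (ht1 : t < 1)
    (hi : P i = t • P a + (1 - t) • P b) (z : ι → ℝ) :
    tri P (Pi.single i 1 + (-t) • Pi.single a 1 + (-(1 - t)) • Pi.single b 1)
      (Pi.single i 1 + (-t) • Pi.single a 1 + (-(1 - t)) • Pi.single b 1) z =
      -(2 * t * (1 - t)) * ∑ k, planeArea (P a) (P b) (P k) * z k := by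
  have h1 : ∀ k, planeArea (P i) (P a) (P k) = (1 - t) * planeArea (P a) (P b) (P k) := by
    intro k
    rw [hi, planeArea_affine _ _ _ _ _ _ ht0.le (by linarith) (by ring) (by simp [det2]),
      planeArea_swap_left (P b), planeArea_swap_right (P a), planeArea_swap_left (P a) (P k),
      planeArea_self]
    ring
  have h2 : ∀ k, planeArea (P i) (P b) (P k) = t * planeArea (P a) (P b) (P k) := by
    intro k
    rw [hi, planeArea_affine _ _ _ _ _ _ ht0.le (by linarith) (by ring) (by simp [det2]),
      planeArea_swap_right (P b) (P b), planeArea_swap_left (P b) (P k), planeArea_self]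
    ring
  have h0 : ∀ p q : ℝ × ℝ, planeArea p p q = 0 := fun p q => by
    rw [planeArea_swap_right, planeArea_swap_left, planeArea_self]
  rw [tri_combination]
  simp only [weight_add_smul, weight_single, planeArea_swap_left (P a) (P i),
    planeArea_swap_left (P b) (P i), planeArea_swap_left (P b) (P a), h1, h2, h0, Finset.mul_sum,
    ← Finset.sum_add_distrib, ← Finset.sum_sub_distrib]
  refine Finset.sum_congr rfl fun k _ => by ring

/-- The area is proportional to the height above the side. The greatest height occurs at a corner,
whose weight alone exceeds the total absolute weight of `U`. -/
theorem Boundary.sum_planeArea_pos (hP : Boundary P) (U : Finset ι) (hU : ∀ k ∈ U, ¬IsCorner P k)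
    {a b : ι} {u : ℝ × ℝ} (hab : P a ≠ P b) (hu : u ≠ 0) (hs : ∀ k, dot2 u (P a) ≤ dot2 u (P k))
    (hb : dot2 u (P b) = dot2 u (P a)) {x : ι → ℝ} (hx0 : ∀ k, ¬IsCorner P k → k ∉ U → x k = 0)
    (hx : ∀ v, IsCorner P v → ∑ k ∈ U, |x k| < x v) :
    0 < ∑ k, planeArea (P a) (P b) (P k) * x k := by
  classical
  have huu := dot2_self_pos hu
  set κ := |dot2 (turn u) (P b) - dot2 (turn u) (P a)| / (2 * dot2 u u) with hκ
  have hκ0 : 0 < κ := by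
    refine div_pos (abs_pos.2 (sub_ne_zero.2 fun h => hab (eq_of_dot2 hu hb h).symm)) (by linarith)
  have hA : ∀ k, planeArea (P a) (P b) (P k) = κ * (dot2 u (P k) - dot2 u (P a)) := by
    intro k
    have := det2_mul_dot2 u (P b - P a) (P k - P a)
    rw [dot2_sub, dot2_sub, dot2_sub, dot2_sub, hb, sub_self, zero_mul, sub_zero] at this
    have h2 : |det2 (P b - P a) (P k - P a)| * dot2 u u =
        |dot2 (turn u) (P b) - dot2 (turn u) (P a)| * (dot2 u (P k) - dot2 u (P a)) := by
      have h1 : |det2 (P b - P a) (P k - P a)| * dot2 u u =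
          |det2 (P b - P a) (P k - P a) * dot2 u u| := by rw [abs_mul, abs_of_pos huu]
      rw [h1, this, abs_mul, abs_of_nonneg (sub_nonneg.2 (hs k))]
    rw [planeArea, hκ]
    field_simp
    linarith
  have : Nonempty ι := ⟨a⟩
  obtain ⟨w, hw, hwmax⟩ := hP.exists_corner_min (neg_ne_zero.2 hu)
  simp only [dot2_neg_left, neg_le_neg_iff] at hwmax
  have hwpos : 0 < dot2 u (P w) - dot2 u (P a) := by
    by_contra hn
    obtain ⟨i, j, k, hd⟩ := hP.nondegenerate
    have hall : ∀ k, dot2 u (P k) = dot2 u (P a) := fun k =>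
      le_antisymm (by linarith [hwmax k]) (hs k)
    apply hd
    have := det2_mul_dot2 u (P j - P i) (P k - P i)
    rw [dot2_sub u (P k), dot2_sub u (P j), hall k, hall j, hall i] at this
    exact (mul_eq_zero.1 (this.trans (by ring))).resolve_right huu.ne'
  have hwU : w ∉ U := fun h => hU w h hw
  have hterm : ∀ k, k ∉ U → 0 ≤ planeArea (P a) (P b) (P k) * x k := by
    intro k hk
    by_cases hkc : IsCorner P k
    · exact mul_nonneg (planeArea_nonneg _ _ _)
        (le_trans (Finset.sum_nonneg fun _ _ => abs_nonneg _) (hx k hkc).le)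
    · rw [hx0 k hkc hk, mul_zero]
  have h1 : planeArea (P a) (P b) (P w) * x w ≤
      ∑ k ∈ Finset.univ \ U, planeArea (P a) (P b) (P k) * x k :=
    Finset.single_le_sum (f := fun k => planeArea (P a) (P b) (P k) * x k)
      (fun k hk => hterm k (Finset.mem_sdiff.1 hk).2) (by simp [hwU])
  have h2 : -(planeArea (P a) (P b) (P w) * ∑ k ∈ U, |x k|) ≤
      ∑ k ∈ U, planeArea (P a) (P b) (P k) * x k := by
    rw [Finset.mul_sum, ← Finset.sum_neg_distrib]
    refine Finset.sum_le_sum fun k _ => ?_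
    have e1 : planeArea (P a) (P b) (P k) ≤ planeArea (P a) (P b) (P w) := by
      rw [hA, hA]
      exact mul_le_mul_of_nonneg_left (by linarith [hwmax k]) hκ0.le
    have e2 := neg_abs_le (x k)
    have e3 := mul_le_mul_of_nonneg_right e1 (abs_nonneg (x k))
    have e4 := mul_le_mul_of_nonneg_left e2 (planeArea_nonneg (P a) (P b) (P k))
    linarith
  rw [← Finset.sum_sdiff (Finset.subset_univ U)]
  have h3 : 0 < planeArea (P a) (P b) (P w) * (x w - ∑ k ∈ U, |x k|) := by
    refine mul_pos ?_ (sub_pos.2 (hx w hw))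
    rw [hA]; exact mul_pos hκ0 hwpos
  linarith

/-- Moving the weights of points that are not corners to the corners increases the cubic form. -/
theorem Boundary.cubic_le_of_move (hP : Boundary P) (U : Finset ι) :
    (∀ k ∈ U, ¬IsCorner P k) → ∀ x : ι → ℝ, ∑ i, x i = 1 →
    (∀ k, ¬IsCorner P k → k ∉ U → x k = 0) → (∀ v, IsCorner P v → ∑ k ∈ U, |x k| < x v) →
    ∃ y ∈ cornerSimplex P, cubic P x ≤ cubic P y ∧ ((∃ k ∈ U, x k ≠ 0) → cubic P x < cubic P y) := by
  induction U using Finset.induction_on with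
  | empty =>
    intro _ x hx1 hx0 hx
    refine ⟨x, ⟨fun i => ?_, hx1, fun i hi => hx0 i hi (Finset.notMem_empty i)⟩, le_rfl, by simp⟩
    by_cases hi : IsCorner P i
    · exact (by simpa using hx i hi : 0 < x i).le
    · rw [hx0 i hi (Finset.notMem_empty i)]
  | insert i U hiU ih =>
    intro hU x hx1 hx0 hx
    have hi := hU i (Finset.mem_insert_self _ _)
    have hU' : ∀ k ∈ U, ¬IsCorner P k := fun k hk => hU k (Finset.mem_insert_of_mem hk)
    obtain ⟨a, b, t, u, ha, hb, ht0, ht1, hPi, hab, hu, hsup, hub, hsign⟩ :=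
      hP.exists_neighbors U hi hiU
    have hai : a ≠ i := by
      rintro rfl
      exact ha.elim hi hiU
    have hbi : b ≠ i := by
      rintro rfl
      exact hb.elim hi hiU
    -- The direction `v` preserves the total weight and the weighted sum of the points.
    set v : ι → ℝ := Pi.single i 1 + (-t) • Pi.single a 1 + (-(1 - t)) • Pi.single b 1 with hv
    have hvsum : ∑ k, v k = 0 := by
      simp only [hv, Pi.add_apply, Pi.smul_apply, smul_eq_mul, Finset.sum_add_distrib,
        ← Finset.mul_sum, Finset.sum_pi_single', Finset.mem_univ, if_true]
      ring
    set y : ι → ℝ := x + (-x i) • v with hy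
    have hxy : x = y + x i • v := by rw [hy]; simp
    have hyv : ∀ k, k ≠ i → y k = x k + x i * (t * (if k = a then 1 else 0) +
        (1 - t) * (if k = b then 1 else 0)) := by
      intro k hk
      simp only [hy, hv, Pi.add_apply, Pi.smul_apply, smul_eq_mul, Pi.single_apply, hk, if_false]
      ring
    have hyi : y i = 0 := by
      simp [hy, hv, hai.symm, hbi.symm]
    have hysum : ∑ k, y k = 1 := by
      simp only [hy, Pi.add_apply, Pi.smul_apply, smul_eq_mul, Finset.sum_add_distrib,
        ← Finset.mul_sum, hvsum, hx1]
      ring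
    have hy0 : ∀ k, ¬IsCorner P k → k ∉ U → y k = 0 := by
      intro k hk hkU
      by_cases hki : k = i
      · rw [hki, hyi]
      · have hka : k ≠ a := by rintro rfl; exact ha.elim hk hkU
        have hkb : k ≠ b := by rintro rfl; exact hb.elim hk hkU
        rw [hyv k hki, hx0 k hk (by simp [hki, hkU])]
        simp [hka, hkb]
    have hyU : ∑ k ∈ U, |y k| ≤ ∑ k ∈ U, |x k| + |x i| * (t * (if a ∈ U then 1 else 0) +
        (1 - t) * (if b ∈ U then 1 else 0)) := by
      calc ∑ k ∈ U, |y k| ≤ ∑ k ∈ U, (|x k| + |x i| * (t * (if k = a then 1 else 0) +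
            (1 - t) * (if k = b then 1 else 0))) := by
            refine Finset.sum_le_sum fun k hk => ?_
            have hki : k ≠ i := fun e => hiU (e ▸ hk)
            rw [hyv k hki]
            refine (abs_add_le _ _).trans (add_le_add le_rfl ?_)
            rw [abs_mul, abs_of_nonneg (a := t * _ + _)]
            have : 0 ≤ 1 - t := by linarith
            split_ifs <;> simp <;> linarith
        _ = _ := by
            rw [Finset.sum_add_distrib, ← Finset.mul_sum, Finset.sum_add_distrib, ← Finset.mul_sum,
              ← Finset.mul_sum, Finset.sum_ite_eq', Finset.sum_ite_eq']
    -- The gain of `U` and the loss of a corner `w` are together at most `|x i|`, because a neighbor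
    -- is not both in `U` and equal to `w`. The hypothesis on `insert i U` has exactly this margin.
    have hyc : ∀ w, IsCorner P w → ∑ k ∈ U, |y k| < y w := by
      intro w hw
      have hwi : w ≠ i := fun e => hi (e ▸ hw)
      have h1 := hx w hw
      rw [Finset.sum_insert hiU] at h1
      rw [hyv w hwi]
      have habs := abs_nonneg (x i)
      have hneg := neg_abs_le (x i)
      have c1 : (if a ∈ U then (1 : ℝ) else 0) + (if w = a then 1 else 0) ≤ 1 := by
        by_cases hwa : w = a
        · have : a ∉ U := fun h => hU' a h (hwa ▸ hw)
          simp [hwa, this]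
        · simp only [hwa, if_false]; split_ifs <;> norm_num
      have c2 : (if b ∈ U then (1 : ℝ) else 0) + (if w = b then 1 else 0) ≤ 1 := by
        by_cases hwb : w = b
        · have : b ∉ U := fun h => hU' b h (hwb ▸ hw)
          simp [hwb, this]
        · simp only [hwb, if_false]; split_ifs <;> norm_num
      have c3 : 0 ≤ (if w = a then (1 : ℝ) else 0) := by split_ifs <;> norm_num
      have c4 : 0 ≤ (if w = b then (1 : ℝ) else 0) := by split_ifs <;> norm_num
      set A1 := (if a ∈ U then (1 : ℝ) else 0)
      set B1 := (if b ∈ U then (1 : ℝ) else 0)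
      set A2 := (if w = a then (1 : ℝ) else 0)
      set B2 := (if w = b then (1 : ℝ) else 0)
      have d1 : -(|x i| * (t * A2 + (1 - t) * B2)) ≤ x i * (t * A2 + (1 - t) * B2) := by
        have : 0 ≤ t * A2 + (1 - t) * B2 :=
          add_nonneg (mul_nonneg ht0.le c3) (mul_nonneg (by linarith) c4)
        have := mul_le_mul_of_nonneg_right hneg this
        linarith
      have d2 : t * (A1 + A2) + (1 - t) * (B1 + B2) ≤ 1 := by
        have := mul_le_mul_of_nonneg_left c1 ht0.le
        have := mul_le_mul_of_nonneg_left c2 (by linarith : 0 ≤ 1 - t)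
        linarith
      have d3 := mul_le_mul_of_nonneg_left d2 habs
      linarith
    obtain ⟨z, hz, hyz, hyz'⟩ := ih hU' y hysum hy0 hyc
    have hsupp : ∀ {k}, y k ≠ 0 → IsCorner P k ∨ k ∈ U := by
      intro k hk
      by_contra h
      push Not at h
      exact hk (hy0 k h.1 h.2)
    -- The first-order term vanishes: between the neighbors no line through two weighted points
    -- intervenes, so `weight` is affine there.
    have t1 : tri P v y y = 0 := by
      rw [hv, tri_combination]
      have : weight P y y (P i) = t * weight P y y (P a) + (1 - t) * weight P y y (P b) := by
        simp only [weight, Finset.mul_sum, ← Finset.sum_add_distrib]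
        refine Finset.sum_congr rfl fun j _ => Finset.sum_congr rfl fun k _ => ?_
        by_cases hj : y j = 0
        · simp [hj]
        by_cases hk : y k = 0
        · simp [hk]
        rw [hPi, planeArea_affine _ _ _ _ _ _ ht0.le (by linarith) (by ring)
          (hsign j k (hsupp hj) (hsupp hk))]
        ring
      rw [this]; ring
    have t2 := tri_combination_self ht0 ht1 hPi y
    rw [← hv] at t2
    have t3 : cubic P v = 0 := by
      have h := tri_combination_self ht0 ht1 hPi v
      rw [← hv] at h
      unfold cubic
      rw [h]
      have hz : planeArea (P a) (P b) (P i) = 0 := by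
        rw [planeArea_swap_right, planeArea_swap_left, hPi,
          planeArea_affine _ _ _ _ _ _ ht0.le (by linarith) (by ring) (by simp [det2]),
          planeArea_swap_right (P a) (P a), planeArea_swap_left (P a) (P b), planeArea_self,
          planeArea_swap_left (P b) (P a), planeArea_self]
        ring
      have : ∑ k, planeArea (P a) (P b) (P k) * v k = 0 := by
        have h0 : planeArea (P a) (P b) (P a) = 0 := by
          rw [planeArea_swap_left, planeArea_self]
        simp [hv, mul_add, Finset.sum_add_distrib, Pi.single_apply, hz, h0, planeArea_self]
      rw [this, mul_zero]
    have hpos := hP.sum_planeArea_pos U hU' hab hu hsup hub hy0 hyc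
    -- Only the second-order term is left, since the points weighted by `v` are collinear and `cubic
    -- P v` is zero.
    have hcub : cubic P x = cubic P y - 3 * x i ^ 2 * (2 * t * (1 - t) *
        ∑ k, planeArea (P a) (P b) (P k) * y k) := by
      conv_lhs => rw [hxy]
      rw [cubic_add_smul, t1, t2, t3]
      ring
    have hC : 0 < 2 * t * (1 - t) * ∑ k, planeArea (P a) (P b) (P k) * y k :=
      mul_pos (mul_pos (by linarith) (by linarith)) hpos
    refine ⟨z, hz, ?_, ?_⟩
    · have := mul_nonneg (mul_nonneg zero_le_three (sq_nonneg (x i))) hC.le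
      linarith
    · rintro ⟨k, hk, hk0⟩
      by_cases hxi : x i = 0
      · have hxy' : x = y := by rw [hy, hxi]; simp
        have hkU : k ∈ U := by
          rcases Finset.mem_insert.1 hk with rfl | h
          · exact absurd hxi hk0
          · exact h
        rw [hxy'] at hk0 ⊢
        exact hyz' ⟨k, hkU, hk0⟩
      · have := mul_pos (mul_pos zero_lt_three (pow_pos (abs_pos.2 hxi) 2)) hC
        rw [sq_abs] at this
        linarith

/-- Compactness provides the maximum on the corner simplex. As its corner weights are positive, the
hypotheses of `cubic_le_of_move` hold in a neighborhood, where arbitrary real weights of sum one can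
thus be compared with weights of the corners. -/
theorem Boundary.exists_max (hP : Boundary P) : ∃ x : ι → ℝ, x ∈ cornerSimplex P ∧
    (∀ i, IsCorner P i → 0 < x i) ∧ 0 < cubic P x ∧
    (∀ p, IsCorner P p → weight P x x (P p) ≤ cubic P x) ∧
    (∀ᶠ y in 𝓝 x, ∑ i, y i = 1 → cubic P y ≤ cubic P x) ∧
    ∀ d : ι → ℝ, ∑ i, d i = 0 → d ≠ 0 → ∃ s : ℝ, cubic P (x + s • d) ≠ cubic P x := by
  classical
  have hcomp : IsCompact (cornerSimplex P) := by
    have hsub : cornerSimplex P = stdSimplex ℝ ι ∩ {x | ∀ i, ¬IsCorner P i → x i = 0} := by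
      ext x; simp [cornerSimplex, stdSimplex, and_assoc]
    rw [hsub]
    refine (isCompact_stdSimplex ℝ ι).inter_right ?_
    simp only [Set.ofPred_forall]
    exact isClosed_iInter fun i => isClosed_iInter fun _ =>
      isClosed_eq (continuous_apply i) continuous_const
  have hne : (cornerSimplex P).Nonempty := by
    obtain ⟨i, -, -, hi, -⟩ := hP.exists_corner_triangle
    refine ⟨Pi.single i 1, fun k => ?_, by simp, fun k hk => ?_⟩
    · simp only [Pi.single_apply]; split_ifs <;> norm_num
    · have : k ≠ i := fun e => hk (e ▸ hi)
      simp [this]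
  obtain ⟨x, hx, hmax⟩ := hcomp.exists_isMaxOn hne (continuous_cubic P).continuousOn
  have hmax : ∀ y ∈ cornerSimplex P, cubic P y ≤ cubic P x := fun y hy => hmax hy
  set U : Finset ι := Finset.univ.filter fun k => ¬IsCorner P k with hU
  have hxpos : ∀ i, IsCorner P i → 0 < x i := fun i hi => pos_of_isMax hP hx hmax hi
  have hUmem : ∀ k, k ∈ U ↔ ¬IsCorner P k := fun k => by simp [hU]
  have hnear : ∀ᶠ y in 𝓝 x, ∀ v, IsCorner P v → ∑ k ∈ U, |y k| < y v := by
    rw [Filter.eventually_all]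
    intro v
    by_cases hv : IsCorner P v
    · have hc : Continuous fun y : ι → ℝ => y v - ∑ k ∈ U, |y k| := by fun_prop
      have h0 : ∑ k ∈ U, |x k| = 0 :=
        Finset.sum_eq_zero fun k hk => by rw [hx.2.2 k ((hUmem k).1 hk), abs_zero]
      have := (hc.tendsto x).eventually_const_lt (u := 0) (by
        simp only [h0, sub_zero]; exact hxpos v hv)
      filter_upwards [this] with y hy _
      linarith
    · exact Filter.Eventually.of_forall fun _ h => absurd h hv
  have hbound : ∀ y : ι → ℝ, ∑ i, y i = 1 → (∀ v, IsCorner P v → ∑ k ∈ U, |y k| < y v) →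
      cubic P y ≤ cubic P x ∧ ((∃ k ∈ U, y k ≠ 0) → cubic P y < cubic P x) := by
    intro y hy1 hy
    obtain ⟨z, hz, h1, h2⟩ := hP.cubic_le_of_move U (fun k hk => (hUmem k).1 hk) y hy1
      (fun k hk hk' => absurd ((hUmem k).2 hk) hk') hy
    exact ⟨h1.trans (hmax z hz), fun h => (h2 h).trans_le (hmax z hz)⟩
  refine ⟨x, hx, hxpos, cubic_pos_of_isMax hP hmax,
    fun p hp => weight_le_of_isMax hx hmax hp, ?_, fun d hd hd0 => ?_⟩
  · filter_upwards [hnear] with y hy hy1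
    exact (hbound y hy1 hy).1
  · by_contra! hconst
    -- A small step along `d` that gave weight to a point off the corners would strictly lower the
    -- form.
    have hdU : ∀ k, ¬IsCorner P k → d k = 0 := by
      have hc : Continuous fun s : ℝ => x + s • d := by fun_prop
      have h0 : Filter.Tendsto (fun s : ℝ => x + s • d) (𝓝[>] 0) (𝓝 x) := by
        have := hc.tendsto 0
        simp only [zero_smul, add_zero] at this
        exact this.mono_left nhdsWithin_le_nhds
      obtain ⟨s, hs, hs0⟩ := ((h0.eventually hnear).and self_mem_nhdsWithin).exists
      have hs0 : 0 < s := hs0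
      have h1 := hbound (x + s • d) (by
        simp [Finset.sum_add_distrib, ← Finset.mul_sum, hd, hx.2.1]) hs
      intro k hk
      by_contra hdk
      have := h1.2 ⟨k, (hUmem k).2 hk, by simp [hx.2.2 k hk, hs0.ne', hdk]⟩
      exact this.ne (hconst s)
    obtain ⟨v₀, hv₀⟩ : ∃ v, d v < 0 := by
      by_contra! h
      apply hd0
      ext k
      exact (Finset.sum_eq_zero_iff_of_nonneg fun k _ => h k).1 hd k (Finset.mem_univ k)
    -- Follow the line until it leaves the simplex. There a corner weight vanishes at what is still
    -- a maximum, against `pos_of_isMax`.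
    obtain ⟨v, hv, hvmin⟩ := Finset.exists_min_image (Finset.univ.filter fun v => d v < 0)
      (fun v => x v / (-d v)) ⟨v₀, by simpa using hv₀⟩
    simp only [Finset.mem_filter, Finset.mem_univ, true_and] at hv hvmin
    have hvc : IsCorner P v := by
      by_contra h
      rw [hdU v h] at hv
      exact lt_irrefl _ hv
    set s := x v / (-d v) with hs
    have hs0 : 0 < s := div_pos (hxpos v hvc) (by linarith)
    have hz : x + s • d ∈ cornerSimplex P := by
      refine ⟨fun k => ?_, by simp [Finset.sum_add_distrib, ← Finset.mul_sum, hd, hx.2.1],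
        fun k hk => by simp [hx.2.2 k hk, hdU k hk]⟩
      simp only [Pi.add_apply, Pi.smul_apply, smul_eq_mul]
      rcases lt_or_ge (d k) 0 with h | h
      · have := hvmin k h
        rw [le_div_iff₀ (by linarith)] at this
        linarith
      · exact add_nonneg (hx.1 k) (mul_nonneg hs0.le h)
    have hzv : (x + s • d) v = 0 := by
      have : d v ≠ 0 := hv.ne
      simp only [Pi.add_apply, Pi.smul_apply, smul_eq_mul, hs]
      field_simp
      ring
    have := pos_of_isMax hP hz (fun y hy => by rw [hconst s]; exact hmax y hy) hvc
    exact this.ne' hzv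

theorem eq_zero_of_localMax {a b c : ℝ}
    (h : ∀ᶠ s : ℝ in 𝓝 0, a * s + b * s ^ 2 + c * s ^ 3 ≤ 0) : a = 0 ∧ b ≤ 0 := by
  have ha : a = 0 := by
    have hmax : IsLocalMax (fun s : ℝ => a * s + b * s ^ 2 + c * s ^ 3) 0 := by
      filter_upwards [h] with s hs
      simpa using hs
    have hder : HasDerivAt (fun s : ℝ => a * s + b * s ^ 2 + c * s ^ 3)
        (a * 1 + b * (2 * 0 ^ 1 * 1) + c * (3 * 0 ^ 2 * 1)) 0 := by
      have h1 := (hasDerivAt_id' (0 : ℝ)).const_mul a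
      have h2 := (hasDerivAt_pow 2 (0 : ℝ)).const_mul b
      have h3 := (hasDerivAt_pow 3 (0 : ℝ)).const_mul c
      exact ((h1.add h2).add h3).congr_deriv (by norm_num)
    have := hmax.hasDerivAt_eq_zero hder
    linarith
  refine ⟨ha, ?_⟩
  have hc : Filter.Tendsto (fun s : ℝ => b + c * s) (𝓝[>] 0) (𝓝 (b + c * 0)) := by
    apply Filter.Tendsto.mono_left _ nhdsWithin_le_nhds
    apply Continuous.tendsto (f := fun s : ℝ => b + c * s)
    fun_prop
  have : b + c * 0 ≤ 0 := by
    refine le_of_tendsto hc ?_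
    filter_upwards [nhdsWithin_le_nhds h, self_mem_nhdsWithin] with s hs hs0
    have hs0 : 0 < s := hs0
    have e : a * s + b * s ^ 2 + c * s ^ 3 = s ^ 2 * (b + c * s) := by rw [ha]; ring
    rw [e] at hs
    exact nonpos_of_mul_nonpos_right hs (by positivity)
  linarith

/-- A cubic polynomial with two local maxima is constant. -/
theorem eq_of_two_localMax {x y : ι → ℝ}
    (hx : ∀ᶠ s : ℝ in 𝓝 0, cubic P (x + s • (y - x)) ≤ cubic P x)
    (hy : ∀ᶠ s : ℝ in 𝓝 0, cubic P (y + s • (y - x)) ≤ cubic P y) (s : ℝ) :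
    cubic P (x + s • (y - x)) = cubic P x := by
  set d := y - x with hd
  have hyx : ∀ s : ℝ, y + s • d = x + (1 + s) • d := by
    intro s; rw [hd]; module
  have hy0 : cubic P y = cubic P (x + (1 : ℝ) • d) := by
    rw [hd, one_smul, add_sub_cancel]
  obtain ⟨h1, h2⟩ := eq_zero_of_localMax (a := 3 * tri P d x x) (b := 3 * tri P d d x)
    (c := cubic P d) (by
      filter_upwards [hx] with s hs
      rw [cubic_add_smul] at hs
      linarith)
  obtain ⟨h3, h4⟩ := eq_zero_of_localMax
    (a := 3 * tri P d x x + 6 * tri P d d x + 3 * cubic P d)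
    (b := 3 * tri P d d x + 3 * cubic P d)
    (c := cubic P d) (by
      filter_upwards [hy] with s hs
      rw [hyx, hy0, cubic_add_smul, cubic_add_smul] at hs
      nlinarith [hs])
  rw [cubic_add_smul]
  -- With `T = tri P d d x`, the first-order conditions give `cubic P d = -2 T`, and the
  -- second-order conditions give `T ≤ 0` and `T + cubic P d = -T ≤ 0`.
  have e1 : cubic P d = 0 := by linarith
  have e2 : tri P d d x = 0 := by linarith
  have e3 : tri P d x x = 0 := by linarith
  rw [e1, e2, e3]; ring

end AreaCubic

/-! ### The toric diagram and its boundary lattice points -/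

namespace Dimer

section Polygon

open Classical AreaCubic

variable {E : Type*} [Fintype E] {D : Dimer E} {m : D.Marking}

theorem convex_halfplane (u : ℝ × ℝ) (c : ℝ) : Convex ℝ {x : ℝ × ℝ | c ≤ dot2 u x} := by
  intro x hx y hy s t hs ht hst
  simp only [Set.mem_ofPred_eq] at *
  rw [dot2_add_smul]
  calc c = s * c + t * c := by rw [← add_mul, hst, one_mul]
    _ ≤ _ := add_le_add (mul_le_mul_of_nonneg_left hx hs) (mul_le_mul_of_nonneg_left hy ht)

theorem notMem_interior_of_le {K : Set (ℝ × ℝ)} {u x : ℝ × ℝ} (hu : u ≠ 0)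
    (h : ∀ y ∈ K, dot2 u x ≤ dot2 u y) : x ∉ interior K := by
  intro hx
  have hc : Filter.Tendsto (fun t : ℝ => x + t • (-u)) (𝓝[>] 0) (𝓝 (x + (0 : ℝ) • (-u))) := by
    apply Filter.Tendsto.mono_left _ nhdsWithin_le_nhds
    apply Continuous.tendsto (f := fun t : ℝ => x + t • (-u))
    fun_prop
  rw [zero_smul, add_zero] at hc
  obtain ⟨t, ht, ht0⟩ := ((hc.eventually (mem_interior_iff_mem_nhds.1 hx)).and
    self_mem_nhdsWithin).exists
  have ht0 : 0 < t := ht0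
  have h1 := h _ ht
  have h2 := mul_pos ht0 (dot2_self_pos hu)
  simp only [dot2, Prod.fst_add, Prod.snd_add, Prod.smul_fst, Prod.smul_snd, Prod.fst_neg,
    Prod.snd_neg, smul_eq_mul] at h1 h2
  linarith

/-- Hahn–Banach separates the point from the open interior; the inequality extends to the closure,
which contains `K`. -/
theorem exists_support {K : Set (ℝ × ℝ)} (hK : Convex ℝ K) (hne : (interior K).Nonempty)
    {x : ℝ × ℝ} (hx : x ∉ interior K) : ∃ u : ℝ × ℝ, u ≠ 0 ∧ ∀ y ∈ K, dot2 u x ≤ dot2 u y := by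
  obtain ⟨f, hf⟩ := geometric_hahn_banach_open_point hK.interior isOpen_interior hx
  have hrep : ∀ y, f y = -dot2 (-f (1, 0), -f (0, 1)) y := by
    intro y
    have : y = y.1 • ((1 : ℝ), (0 : ℝ)) + y.2 • ((0 : ℝ), (1 : ℝ)) := by ext <;> simp
    conv_lhs => rw [this]
    rw [map_add, map_smul, map_smul]
    simp [dot2]
    ring
  refine ⟨(-f (1, 0), -f (0, 1)), fun h0 => ?_, fun y hy => ?_⟩
  · obtain ⟨a, ha⟩ := hne
    have := hf a ha
    rw [hrep, hrep x, h0] at this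
    simp [dot2] at this
  · have hcl : y ∈ closure (interior K) := by
      rw [hK.closure_interior_eq_closure_of_nonempty_interior hne]
      exact subset_closure hy
    have : closure (interior K) ⊆ {y | f y ≤ f x} :=
      closure_minimal (fun a ha => (hf a ha).le) (isClosed_le f.continuous continuous_const)
    have h2 : f y ≤ f x := this hcl
    rw [hrep, hrep x] at h2
    linarith

theorem toricDiagram_finite :
    {p | ∃ M, D.IsPerfectMatching M ∧ p = toPlane (D.latticePoint m M)}.Finite :=
  (Set.finite_range fun M : Finset E => toPlane (D.latticePoint m M)).subset (by
    rintro p ⟨M, -, rfl⟩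
    exact ⟨M, rfl⟩)

theorem isClosed_toricDiagram : IsClosed (D.toricDiagram m) :=
  toricDiagram_finite.isClosed_convexHull ℝ

theorem toPlane_injective : Function.Injective toPlane := by
  intro p q h
  simp only [toPlane, Prod.mk.injEq, Int.cast_inj] at h
  exact Prod.ext h.1 h.2

namespace BoundaryBasis

variable (B : D.BoundaryBasis m)

/-- The boundary lattice points in the real plane. -/
def pt (i : Fin B.n) : ℝ × ℝ := toPlane (B.point i)

theorem pt_mem_frontier (i : Fin B.n) : B.pt i ∈ frontier (D.toricDiagram m) := by
  have : B.point i ∈ D.boundaryPoints m := B.range_point ▸ Set.mem_range_self i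
  exact this

theorem exists_pt {r : ℤ × ℤ} (h : toPlane r ∈ frontier (D.toricDiagram m)) :
    ∃ k, B.point k = r := by
  have : r ∈ Set.range B.point := B.range_point ▸ h
  exact this

theorem pt_mem (i : Fin B.n) : B.pt i ∈ D.toricDiagram m :=
  isClosed_toricDiagram.frontier_subset (B.pt_mem_frontier i)

/-- Krein–Milman: the extreme points of the diagram are lattice points of matchings and lie on its
frontier. -/
theorem hull_pt : convexHull ℝ (Set.range B.pt) = D.toricDiagram m := by
  apply Set.Subset.antisymm
  · refine convexHull_min ?_ (convex_convexHull ℝ _)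
    rintro _ ⟨i, rfl⟩
    exact B.pt_mem i
  · have h1 : (D.toricDiagram m).extremePoints ℝ ⊆ Set.range B.pt := by
      intro x hx
      obtain ⟨M, hM, rfl⟩ := extremePoints_convexHull_subset hx
      have : toPlane (D.latticePoint m M) ∈ frontier (D.toricDiagram m) := by
        refine ⟨subset_closure hx.1, fun hi => ?_⟩
        exact Set.disjoint_left.1 (disjoint_interior_extremePoints _) hi hx
      obtain ⟨k, hk⟩ := B.exists_pt this
      exact ⟨k, by rw [pt, hk]⟩
    have h2 := closure_convexHull_extremePoints
      ((toricDiagram_finite (D := D) (m := m)).isCompact_convexHull ℝ) (convex_convexHull ℝ _)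
    have h3 : closure (convexHull ℝ ((D.toricDiagram m).extremePoints ℝ)) = D.toricDiagram m := h2
    rw [← h3]
    exact closure_minimal (convexHull_mono h1) ((Set.finite_range B.pt).isClosed_convexHull ℝ)

theorem le_of_forall_pt {u : ℝ × ℝ} {c : ℝ} (h : ∀ k, c ≤ dot2 u (B.pt k)) :
    ∀ y ∈ D.toricDiagram m, c ≤ dot2 u y := by
  rw [← B.hull_pt]
  exact convexHull_min (by rintro _ ⟨k, rfl⟩; exact h k) (convex_halfplane u c)

theorem boundary : Boundary B.pt where
  injective := toPlane_injective.comp B.point_injective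
  support i := by
    obtain ⟨u, hu, h⟩ := exists_support (convex_convexHull ℝ _) B.polygon (B.pt_mem_frontier i).2
    exact ⟨u, hu, fun k => h _ (B.pt_mem k)⟩
  nondegenerate := by
    by_contra! h
    obtain ⟨x, hx⟩ := B.polygon
    have hn : ∃ i : Fin B.n, True := by
      by_contra! hn
      have : Set.range B.pt = ∅ := by
        ext y
        simp only [Set.mem_range, Set.mem_empty_iff_false, iff_false, not_exists]
        exact fun i => (hn i).elim
      have h1 := interior_subset hx
      rw [← B.hull_pt, this, convexHull_empty] at h1
      exact h1
    obtain ⟨i, -⟩ := hn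
    have : ∃ v : ℝ × ℝ, v ≠ 0 ∧ ∀ k, dot2 v (B.pt k) = dot2 v (B.pt i) := by
      by_cases hj : ∃ j, B.pt j ≠ B.pt i
      · obtain ⟨j, hj⟩ := hj
        refine ⟨turn (B.pt j - B.pt i), turn_ne_zero (sub_ne_zero.2 hj), fun k => ?_⟩
        have := h i j k
        rw [← sub_eq_zero, ← dot2_sub, dot2_turn, this, neg_zero]
      · push Not at hj
        exact ⟨(1, 0), by simp, fun k => by rw [hj k]⟩
    obtain ⟨v, hv, hc⟩ := this
    have h1 := B.le_of_forall_pt (u := v) fun k => (hc k).ge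
    have h2 := B.le_of_forall_pt (u := -v) (c := dot2 (-v) (B.pt i)) fun k => by
      rw [dot2_neg_left, dot2_neg_left, hc k]
    have h3 : dot2 v x = dot2 v (B.pt i) := by
      have e1 := h1 x (interior_subset hx)
      have e2 := h2 x (interior_subset hx)
      rw [dot2_neg_left, dot2_neg_left] at e2
      linarith
    exact notMem_interior_of_le hv (fun y hy => h3 ▸ h1 y hy) hx

/-- Neighbors on a side of the polygon are consecutive. -/
theorem consecutive {u : ℝ × ℝ} (hu : u ≠ 0) {a b : Fin B.n}
    (hs : ∀ k, dot2 u (B.pt a) ≤ dot2 u (B.pt k)) (hb : dot2 u (B.pt b) = dot2 u (B.pt a))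
    (hab : a ≠ b)
    (hn : ∀ k, dot2 u (B.pt k) = dot2 u (B.pt a) → k ≠ a → k ≠ b →
      ¬(0 ≤ (dot2 (turn u) (B.pt k) - dot2 (turn u) (B.pt a)) *
        (dot2 (turn u) (B.pt b) - dot2 (turn u) (B.pt k)))) :
    D.Consecutive m (B.point a) (B.point b) := by
  have hseg : ∀ x ∈ segment ℝ (B.pt a) (B.pt b), x ∈ frontier (D.toricDiagram m) ∧
      dot2 u x = dot2 u (B.pt a) := by
    rintro x ⟨s, t, hs0, ht0, hst, rfl⟩
    have e : dot2 u (s • B.pt a + t • B.pt b) = dot2 u (B.pt a) := by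
      rw [dot2_add_smul, hb, ← add_mul, hst, one_mul]
    refine ⟨⟨subset_closure (convex_convexHull ℝ _ (B.pt_mem a) (B.pt_mem b) hs0 ht0 hst), ?_⟩, e⟩
    exact notMem_interior_of_le hu fun y hy => e ▸ B.le_of_forall_pt hs y hy
  refine ⟨fun h => hab (B.point_injective h), fun x hx => (hseg x hx).1, fun r hr => ?_⟩
  obtain ⟨k, rfl⟩ := B.exists_pt (hseg _ hr).1
  by_contra! hk
  refine hn k (hseg _ hr).2 (fun h => hk.1 (by rw [h])) (fun h => hk.2 (by rw [h])) ?_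
  obtain ⟨s, t, hs0, ht0, hst, he⟩ := hr
  have he : B.pt k = s • B.pt a + t • B.pt b := he.symm
  rw [he, dot2_add_smul]
  have : s = 1 - t := by linarith
  subst this
  have e : ((1 - t) * dot2 (turn u) (B.pt a) + t * dot2 (turn u) (B.pt b) -
      dot2 (turn u) (B.pt a)) * (dot2 (turn u) (B.pt b) - ((1 - t) * dot2 (turn u) (B.pt a) +
      t * dot2 (turn u) (B.pt b))) = t * (1 - t) *
      (dot2 (turn u) (B.pt b) - dot2 (turn u) (B.pt a)) ^ 2 := by ring
  rw [e]
  positivity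

/-- The next boundary point on a side. -/
theorem exists_next {u : ℝ × ℝ} (hu : u ≠ 0) {a b : Fin B.n}
    (hs : ∀ k, dot2 u (B.pt a) ≤ dot2 u (B.pt k)) (hb : dot2 u (B.pt b) = dot2 u (B.pt a))
    (hab : dot2 (turn u) (B.pt a) < dot2 (turn u) (B.pt b)) :
    ∃ c, dot2 u (B.pt c) = dot2 u (B.pt a) ∧
      dot2 (turn u) (B.pt a) < dot2 (turn u) (B.pt c) ∧
      (∀ k, dot2 u (B.pt k) = dot2 u (B.pt a) → dot2 (turn u) (B.pt a) < dot2 (turn u) (B.pt k) →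
        dot2 (turn u) (B.pt c) ≤ dot2 (turn u) (B.pt k)) ∧
      D.Consecutive m (B.point a) (B.point c) := by
  obtain ⟨c, hc, hmin⟩ := Finset.exists_min_image
    (Finset.univ.filter fun k => dot2 u (B.pt k) = dot2 u (B.pt a) ∧
      dot2 (turn u) (B.pt a) < dot2 (turn u) (B.pt k)) (fun k => dot2 (turn u) (B.pt k))
    ⟨b, by simp [hb, hab]⟩
  simp only [Finset.mem_filter, Finset.mem_univ, true_and] at hc hmin
  refine ⟨c, hc.1, hc.2, fun k h1 h2 => hmin k ⟨h1, h2⟩, ?_⟩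
  refine B.consecutive hu hs hc.1 (fun h => by rw [h] at hc; exact lt_irrefl _ hc.2)
    fun k hk hka hkc => ?_
  have n1 : dot2 (turn u) (B.pt k) ≠ dot2 (turn u) (B.pt a) := fun h =>
    hka (B.boundary.injective (eq_of_dot2 hu hk h))
  have n2 : dot2 (turn u) (B.pt k) ≠ dot2 (turn u) (B.pt c) := fun h =>
    hkc (B.boundary.injective (eq_of_dot2 hu (hk.trans hc.1.symm) h))
  rw [not_le]
  rcases lt_or_gt_of_ne n1 with h | h
  · exact mul_neg_of_neg_of_pos (by linarith) (by linarith [hc.2])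
  · have := lt_of_le_of_ne (hmin k ⟨hk, h⟩) n2.symm
    exact mul_neg_of_pos_of_neg (by linarith) (by linarith)

/-- The next boundary point in the circular order. -/
theorem exists_succ (i : Fin B.n) : ∃ s, D.Consecutive m (B.point i) (B.point s) ∧
    ∀ k, 0 ≤ det2 (B.pt s - B.pt i) (B.pt k - B.pt i) := by
  have side : ∀ u : ℝ × ℝ, u ≠ 0 → (∀ k, dot2 u (B.pt i) ≤ dot2 u (B.pt k)) →
      (∃ b, dot2 u (B.pt b) = dot2 u (B.pt i) ∧
        dot2 (turn u) (B.pt i) < dot2 (turn u) (B.pt b)) →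
      ∃ s, D.Consecutive m (B.point i) (B.point s) ∧
        ∀ k, 0 ≤ det2 (B.pt s - B.pt i) (B.pt k - B.pt i) := by
    rintro u hu hs ⟨b, hb, hib⟩
    obtain ⟨s, h1, h2, -, h3⟩ := B.exists_next hu hs hb hib
    refine ⟨s, h3, fun k => ?_⟩
    have := det2_mul_dot2 u (B.pt s - B.pt i) (B.pt k - B.pt i)
    rw [dot2_sub, dot2_sub, dot2_sub, dot2_sub, h1, sub_self, zero_mul, sub_zero] at this
    exact nonneg_of_mul_nonneg_left
      (this ▸ mul_nonneg (sub_nonneg.2 h2.le) (sub_nonneg.2 (hs k))) (dot2_self_pos hu)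
  obtain ⟨u, hu, hs⟩ := B.boundary.support i
  by_cases hline : ∃ b, dot2 u (B.pt b) = dot2 u (B.pt i) ∧
      dot2 (turn u) (B.pt i) < dot2 (turn u) (B.pt b)
  · exact side u hu hs hline
  push Not at hline
  set N : Fin B.n → ℝ := fun k => dot2 u (B.pt k - B.pt i) with hN
  set W : Fin B.n → ℝ := fun k => dot2 (turn u) (B.pt k - B.pt i) with hW
  have hN0 : ∀ k, 0 ≤ N k := fun k => by rw [hN]; simp only [dot2_sub]; linarith [hs k]
  have hNW : ∀ k, N k = 0 → W k ≤ 0 := fun k hk => by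
    simp only [hN, hW, dot2_sub] at hk ⊢
    linarith [hline k (by linarith)]
  have hdet : ∀ j k, det2 (B.pt j - B.pt i) (B.pt k - B.pt i) * dot2 u u =
      W j * N k - N j * W k := fun j k => det2_mul_dot2 u _ _
  obtain ⟨b, hb⟩ : ∃ b, 0 < N b := by
    by_contra! hn
    have hz : ∀ k, N k = 0 := fun k => le_antisymm (hn k) (hN0 k)
    obtain ⟨a, j, k, hd⟩ := B.boundary.nondegenerate
    apply hd
    have h0 := det2_mul_dot2 u (B.pt j - B.pt a) (B.pt k - B.pt a)
    have e : ∀ k, dot2 u (B.pt k) = dot2 u (B.pt i) := fun k => by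
      have := hz k
      simp only [hN, dot2_sub] at this
      linarith
    rw [dot2_sub u (B.pt k), dot2_sub u (B.pt j), e k, e j, e a] at h0
    exact (mul_eq_zero.1 (h0.trans (by ring))).resolve_right (dot2_self_pos hu).ne'
  -- `P i` is the last point of its side in the direction of `turn u`. Rotate the supporting line
  -- about it until it meets further points: those of greatest slope `W / N`.
  obtain ⟨s, hs', hmax⟩ := Finset.exists_max_image (Finset.univ.filter fun k => 0 < N k)
    (fun k => W k / N k) ⟨b, by simpa using hb⟩
  simp only [Finset.mem_filter, Finset.mem_univ, true_and] at hs' hmax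
  have hkey : ∀ k, 0 ≤ det2 (B.pt s - B.pt i) (B.pt k - B.pt i) := by
    intro k
    refine nonneg_of_mul_nonneg_left (?_ : 0 ≤ _ * dot2 u u) (dot2_self_pos hu)
    rw [hdet]
    rcases (hN0 k).eq_or_lt with h | h
    · rw [← h, mul_zero, zero_sub, neg_nonneg]
      exact mul_nonpos_of_nonneg_of_nonpos hs'.le (hNW k h.symm)
    · have := hmax k h
      rw [div_le_div_iff₀ h hs'] at this
      linarith
  have hne : B.pt s - B.pt i ≠ 0 := by
    intro h
    simp only [hN, h, dot2, Prod.fst_zero, Prod.snd_zero, mul_zero, add_zero, lt_irrefl] at hs'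
  -- The line through `i` and `s` now supports the polygon and has `s` ahead of `i`, so the first
  -- case applies to it.
  refine side (-turn (B.pt s - B.pt i)) (neg_ne_zero.2 (turn_ne_zero hne)) (fun k => ?_)
    ⟨s, ?_, ?_⟩
  · rw [← sub_nonneg, ← dot2_sub, dot2_neg_left, dot2_turn, neg_neg]
    exact hkey k
  · rw [← sub_eq_zero, ← dot2_sub, dot2_neg_left, dot2_turn]
    simp [det2]; ring
  · rw [← sub_pos, ← dot2_sub]
    have := dot2_self_pos hne
    have e : dot2 (turn (-turn (B.pt s - B.pt i))) (B.pt s - B.pt i) =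
        dot2 (B.pt s - B.pt i) (B.pt s - B.pt i) := by simp [turn, dot2]
    rw [e]
    exact this

end BoundaryBasis

end Polygon

end Dimer

/-! ### Every edge lies in the matching of a corner -/

namespace Dimer

section Positivity

open Classical AreaCubic

variable {E : Type*} [Fintype E] {D : Dimer E} {m : D.Marking}

/-- Pair both sides with the coordinates of the marking: `zeta` gives the winding, and `delta` twice
the sum over the matching. -/
theorem latticePoint_sub {A B : Finset E} {e₀ : E} {ε : ℝ}
    (h : delta B - delta A = (2 * ε) • D.zeta (D.strand e₀)) :
    toPlane (D.latticePoint m B) - toPlane (D.latticePoint m A) =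
      ε • toPlane (D.winding m e₀) := by
  obtain ⟨h1, h2⟩ := sum_chi_winding m e₀
  have key : ∀ g : E → ℝ, (∑ e ∈ B, g e) - ∑ e ∈ A, g e =
      ε * ∑ x, D.chi (D.strand e₀) x * (g (D.white x) - g x) := by
    intro g
    rw [← sum_zeta_reindex]
    have e1 := sum_mul_delta B g
    have e2 := sum_mul_delta A g
    have e3 : ∑ e, g e * (delta B - delta A) e =
        ∑ e, g e * ((2 * ε) • D.zeta (D.strand e₀)) e := by rw [h]
    simp only [Pi.sub_apply, mul_sub, Finset.sum_sub_distrib, e1, e2, Pi.smul_apply,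
      smul_eq_mul] at e3
    have e4 : ∑ e, g e * (2 * ε * D.zeta (D.strand e₀) e) =
        2 * ε * ∑ e, D.zeta (D.strand e₀) e * g e := by
      rw [Finset.mul_sum]
      exact Finset.sum_congr rfl fun e _ => by ring
    rw [e4] at e3
    linarith
  have hp : ∀ M : Finset E, toPlane (D.latticePoint m M) = ((∑ e ∈ M, ((m.crossing e).1 : ℝ)),
      ∑ e ∈ M, ((m.crossing e).2 : ℝ)) := by
    intro M
    simp only [latticePoint, toPlane, Prod.fst_sum, Prod.snd_sum, Int.cast_sum]
  rw [hp, hp]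
  ext
  · simp only [Prod.fst_sub, key fun e => ((m.crossing e).1 : ℝ), Prod.smul_fst, toPlane,
      smul_eq_mul, h1]
  · simp only [Prod.snd_sub, key fun e => ((m.crossing e).2 : ℝ), Prod.smul_snd, toPlane,
      smul_eq_mul, h2]

/-- The map `t ↦ ∑ t_z ζ_z + (∑ t_z) δ_M` is injective. The sum at a white node sees only the second
term, so `∑ t_z = 0`; then `t` is constant by the only relation between the `ζ_z`, hence zero. -/
theorem card_strands_le_finrank {V : Submodule ℝ (E → ℝ)} {M : Finset E}
    (hM : D.IsPerfectMatching M) (hδ : delta M ∈ V) (hζ : ∀ z, D.zeta z ∈ V) :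
    Fintype.card (Cycles D.zigzagPerm) ≤ Module.finrank ℝ V := by
  obtain ⟨e₀⟩ := D.nonempty
  let L : (Cycles D.zigzagPerm → ℝ) →ₗ[ℝ] V :=
    { toFun := fun t => ⟨∑ z, t z • D.zeta z + (∑ z, t z) • delta M,
        V.add_mem (V.sum_mem fun z _ => V.smul_mem _ (hζ z)) (V.smul_mem _ hδ)⟩
      map_add' := fun s t => by
        ext1
        simp only [Pi.add_apply, add_smul, Finset.sum_add_distrib, Submodule.coe_add]
        abel
      map_smul' := fun c t => by
        ext1
        simp only [Pi.smul_apply, smul_eq_mul, mul_smul, ← Finset.smul_sum, ← Finset.mul_sum,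
          RingHom.id_apply, Submodule.coe_smul, smul_add] }
  have hinj : Function.Injective L := by
    rw [← LinearMap.ker_eq_bot, LinearMap.ker_eq_bot']
    intro t ht
    have ht' : ∑ z, t z • D.zeta z + (∑ z, t z) • delta M = 0 :=
      congrArg Subtype.val ht
    have hs : ∑ z, t z = 0 := by
      have h1 : ∑ x with D.white.SameCycle e₀ x, (∑ z, t z • D.zeta z +
          (∑ z, t z) • delta M) x = 0 := by
        rw [ht']; simp
      simp only [Pi.add_apply, Finset.sum_apply, Pi.smul_apply, smul_eq_mul,
        Finset.sum_add_distrib, ← Finset.mul_sum, sum_delta_white hM] at h1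
      rw [Finset.sum_comm] at h1
      simp only [← Finset.mul_sum, sum_zeta_white, mul_zero, Finset.sum_const_zero, zero_add] at h1
      linarith
    rw [hs, zero_smul, add_zero] at ht'
    have hc := eq_of_sum_smul_zeta t ht'
    ext z
    have hsum : ∑ z', t z' = Fintype.card (Cycles D.zigzagPerm) * t z := by
      rw [Finset.sum_congr rfl fun z' _ => hc z' z]
      simp
    rw [hs] at hsum
    have : (Fintype.card (Cycles D.zigzagPerm) : ℝ) ≠ 0 := by
      have : 0 < Fintype.card (Cycles D.zigzagPerm) := Fintype.card_pos_iff.2 ⟨z⟩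
      exact_mod_cast this.ne'
    exact (mul_eq_zero.1 hsum.symm).resolve_left this
  have h := LinearMap.finrank_le_finrank_of_injective hinj
  rwa [Module.finrank_fintype_fun_eq_card] at h

namespace BoundaryBasis

variable (B : D.BoundaryBasis m)

theorem step {i j : Fin B.n} (h : D.Consecutive m (B.point i) (B.point j)) :
    ∃ e₀ : E, (∀ e, D.strand e = D.strand e₀ → D.strand (D.white⁻¹ e) ≠ D.strand e₀) ∧
      ∃ ε : ℝ, (ε = 1 ∨ ε = -1) ∧
        delta (B.matching j) - delta (B.matching i) = (2 * ε) • D.zeta (D.strand e₀) := by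
  obtain ⟨e₀, he⟩ := B.zigzag i j h
  exact ⟨e₀, delta_sub_of_symmDiff (B.isPerfectMatching i) (B.isPerfectMatching j) he⟩

/-- Differences of two matchings of the basis that agree up to a sign. -/
theorem eq_of_sub_eq {i j k l : Fin B.n} (hij : i ≠ j) {ε : ℝ} (hε : ε = 1 ∨ ε = -1)
    (h : delta (B.matching j) - delta (B.matching i) =
      ε • (delta (B.matching l) - delta (B.matching k))) :
    (k = i ∧ l = j) ∨ (k = j ∧ l = i) := by
  have hcoef := Fintype.linearIndependent_iff.1 B.independent
    (Pi.single j 1 - Pi.single i 1 - ε • (Pi.single l 1 - Pi.single k 1)) (by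
      simp only [Pi.sub_apply, Pi.smul_apply, sub_smul, Finset.sum_sub_distrib, smul_eq_mul,
        mul_sub, mul_smul, ← Finset.smul_sum]
      have hs : ∀ a : Fin B.n, ∑ x, (Pi.single a (1 : ℝ) : Fin B.n → ℝ) x •
          (delta (B.matching x) : E → ℝ) = delta (B.matching a) := by
        intro a
        rw [Finset.sum_eq_single a]
        · simp
        · intro b _ hb; simp [hb]
        · simp
      rw [hs, hs, hs, hs, ← smul_sub, h, sub_self])
  have h1 := hcoef j
  have h2 := hcoef i
  simp only [Pi.sub_apply, Pi.smul_apply, Pi.single_apply, smul_eq_mul, hij, hij.symm, if_true,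
    if_false] at h1 h2
  rcases hε with rfl | rfl
  · left
    constructor
    · by_contra hk
      rw [if_neg (Ne.symm hk)] at h2
      split_ifs at h2 <;> norm_num at h2
    · by_contra hl
      rw [if_neg (Ne.symm hl)] at h1
      split_ifs at h1 <;> norm_num at h1
  · right
    constructor
    · by_contra hk
      rw [if_neg (Ne.symm hk)] at h1
      split_ifs at h1 <;> norm_num at h1
    · by_contra hl
      rw [if_neg (Ne.symm hl)] at h2
      split_ifs at h2 <;> norm_num at h2

theorem eq_of_step_eq {i j k l : Fin B.n} (hij : i ≠ j) {z : Cycles D.zigzagPerm} {ε ε' : ℝ}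
    (hε : ε = 1 ∨ ε = -1) (hε' : ε' = 1 ∨ ε' = -1)
    (h : delta (B.matching j) - delta (B.matching i) = (2 * ε) • D.zeta z)
    (h' : delta (B.matching l) - delta (B.matching k) = (2 * ε') • D.zeta z) :
    (k = i ∧ l = j) ∨ (k = j ∧ l = i) := by
  refine B.eq_of_sub_eq hij (ε := ε * ε') ?_ ?_
  · rcases hε with rfl | rfl <;> rcases hε' with rfl | rfl <;> norm_num
  · rw [h, h', smul_smul]
    congr 1
    rcases hε' with rfl | rfl <;> ring

theorem sum_smul_mem (R : E → ℝ) (hR : R ∈ D.chargeAssignments) :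
    R ∈ Submodule.span ℝ (Set.range fun i => (delta (B.matching i) : E → ℝ)) := by
  obtain ⟨lam, -, rfl⟩ := (B.spanning R).1 hR
  exact Submodule.sum_mem _ fun i _ => Submodule.smul_mem _ _
    (Submodule.subset_span (Set.mem_range_self i))

theorem delta_mem (i : Fin B.n) : delta (B.matching i) ∈ D.chargeAssignments := by
  refine (B.spanning _).2 ⟨Pi.single i 1, by simp, ?_⟩
  rw [Finset.sum_eq_single i]
  · simp
  · intro b _ hb; simp [hb]
  · simp

/-- A boundary point, for the existence of charge assignments. -/
theorem exists_index : Nonempty (Fin B.n) := by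
  obtain ⟨i, -⟩ := B.boundary.nondegenerate
  exact ⟨i⟩

theorem card_strands_le : Fintype.card (Cycles D.zigzagPerm) ≤ B.n := by
  obtain ⟨i₀⟩ := B.exists_index
  set V := Submodule.span ℝ (Set.range fun i => (delta (B.matching i) : E → ℝ)) with hV
  have hδ : (delta (B.matching i₀) : E → ℝ) ∈ V := B.sum_smul_mem _ (B.delta_mem i₀)
  have h := card_strands_le_finrank (V := V) (B.isPerfectMatching i₀) hδ fun z => by
    have h1 := B.sum_smul_mem _ (add_smul_zeta_mem (B.delta_mem i₀) z 1)
    have h2 := V.sub_mem h1 hδ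
    simpa using h2
  rw [hV, finrank_span_eq_card B.independent] at h
  simpa using h

/-- Each boundary point is sent to the path of the step to its successor. If two points had the same
path, each would be the successor of the other, so all points would lie on both sides of one line.
Surjectivity follows by counting. -/
theorem exists_step_strand : ∃ f : Fin B.n → Cycles D.zigzagPerm, Function.Bijective f ∧
    ∀ i, ∃ j, j ≠ i ∧ (∀ e, D.strand e = f i → D.strand (D.white⁻¹ e) ≠ f i) ∧
      ∃ ε : ℝ, (ε = 1 ∨ ε = -1) ∧
        delta (B.matching j) - delta (B.matching i) = (2 * ε) • D.zeta (f i) := by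
  choose s hs hs' using B.exists_succ
  have hne : ∀ i, s i ≠ i := fun i h => (hs i).1 (by rw [h])
  choose e he ε hε hδ using fun i => B.step (hs i)
  have hinj : Function.Injective fun i => D.strand (e i) := by
    intro i j hij
    by_contra hne'
    have hij : D.strand (e i) = D.strand (e j) := hij
    have h1 := hδ i
    rw [hij] at h1
    rcases B.eq_of_step_eq (hne i).symm (hε i) (hε j) h1 (hδ j) with h | h
    · exact hne' h.1.symm
    · have hz : ∀ k, det2 (B.pt j - B.pt i) (B.pt k - B.pt i) = 0 := by
        intro k
        have h1 := hs' i k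
        have h2 := hs' j k
        rw [← h.1] at h1
        rw [h.2] at h2
        refine le_antisymm ?_ h1
        have : det2 (B.pt i - B.pt j) (B.pt k - B.pt j) =
            -det2 (B.pt j - B.pt i) (B.pt k - B.pt i) := by simp [det2]; ring
        linarith
      obtain ⟨a, b, c, hd⟩ := B.boundary.nondegenerate
      apply hd
      have hv : B.pt j - B.pt i ≠ 0 :=
        sub_ne_zero.2 fun h => hne' (B.boundary.injective h).symm
      have h0 := det2_mul_dot2 (turn (B.pt j - B.pt i)) (B.pt b - B.pt a) (B.pt c - B.pt a)
      have hk : ∀ k, dot2 (turn (B.pt j - B.pt i)) (B.pt k) =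
          dot2 (turn (B.pt j - B.pt i)) (B.pt i) := fun k => by
        rw [← sub_eq_zero, ← dot2_sub, dot2_turn, hz, neg_zero]
      rw [dot2_sub (turn (B.pt j - B.pt i)) (B.pt c), dot2_sub (turn (B.pt j - B.pt i)) (B.pt b),
        hk a, hk b, hk c] at h0
      exact (mul_eq_zero.1 (h0.trans (by ring))).resolve_right
        (dot2_self_pos (turn_ne_zero hv)).ne'
  refine ⟨fun i => D.strand (e i), ?_, fun i => ⟨s i, hne i, he i, ε i, hε i, hδ i⟩⟩
  rw [Fintype.bijective_iff_injective_and_card]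
  refine ⟨hinj, le_antisymm (Fintype.card_le_of_injective _ hinj) ?_⟩
  simpa using B.card_strands_le

/-- Every zigzag path belongs to a step, and the path of a step does not meet itself. -/
theorem strand_ne (B : D.BoundaryBasis m) (e : E) : D.strand e ≠ D.strand (D.white⁻¹ e) := by
  obtain ⟨f, hf, h⟩ := B.exists_step_strand
  obtain ⟨i, hi⟩ := hf.2 (D.strand e)
  obtain ⟨j, -, hs, -⟩ := h i
  have := hs e hi.symm
  rw [hi] at this
  exact this.symm

theorem three_le : 3 ≤ B.n := by
  obtain ⟨i, j, k, hd⟩ := B.boundary.nondegenerate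
  have hij : i ≠ j := by rintro rfl; simp [det2] at hd
  have hik : i ≠ k := by rintro rfl; simp [det2] at hd
  have hjk : j ≠ k := by rintro rfl; apply hd; simp [det2]; ring
  have : ({i, j, k} : Finset (Fin B.n)).card = 3 := by
    rw [Finset.card_eq_three]; exact ⟨i, j, k, hij, hik, hjk, rfl⟩
  rw [← this]
  simpa using Finset.card_le_univ ({i, j, k} : Finset (Fin B.n))

theorem three_le_card (B : D.BoundaryBasis m) : 3 ≤ Fintype.card (Cycles D.zigzagPerm) := by
  obtain ⟨f, hf, -⟩ := B.exists_step_strand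
  rw [← Fintype.card_of_bijective hf, Fintype.card_fin]
  exact B.three_le

/-- Otherwise the charge of `e` would be zero in every charge assignment, but adding the `zeta` of
its path changes it. -/
theorem exists_mem_matching (e : E) : ∃ i, e ∈ B.matching i := by
  by_contra! h
  have hzero : ∀ R ∈ D.chargeAssignments, R e = 0 := by
    intro R hR
    obtain ⟨lam, -, rfl⟩ := (B.spanning R).1 hR
    simp [delta, h]
  obtain ⟨i₀⟩ := B.exists_index
  have h1 := hzero _ (B.delta_mem i₀)
  have h2 := hzero _ (add_smul_zeta_mem (B.delta_mem i₀) (D.strand e) 1)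
  have h3 := B.strand_ne e
  rw [Pi.add_apply, h1, Pi.smul_apply] at h2
  simp only [zeta, chi, if_neg h3.symm] at h2
  norm_num at h2

/-- The step between two matchings lies along the winding of its zigzag path. -/
theorem point_sub {i j : Fin B.n} {e₀ : E} {ε : ℝ}
    (h : delta (B.matching j) - delta (B.matching i) = (2 * ε) • D.zeta (D.strand e₀)) :
    B.pt j - B.pt i = ε • toPlane (D.winding m e₀) := by
  rw [pt, pt, ← B.latticePoint_matching, ← B.latticePoint_matching]
  exact latticePoint_sub h

/-- Along the side of a step, the matchings contain every other edge of the zigzag path. -/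
theorem alternate {u : ℝ × ℝ} (hu : u ≠ 0) {i j : Fin B.n}
    (hd : dot2 u (B.pt j) = dot2 u (B.pt i)) {e₀ : E} {ε : ℝ} (hε : ε = 1 ∨ ε = -1)
    (h : delta (B.matching j) - delta (B.matching i) = (2 * ε) • D.zeta (D.strand e₀))
    {k : Fin B.n} (hk : dot2 u (B.pt k) = dot2 u (B.pt i)) :
    (∀ x, D.strand x = D.strand e₀ → x ∈ B.matching k ∧ D.white x ∉ B.matching k) ∨
      ∀ x, D.strand x = D.strand e₀ → x ∉ B.matching k ∧ D.white x ∈ B.matching k := by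
  refine alternate_of_half B.strand_ne (B.isPerfectMatching k) _ ?_
  obtain ⟨c, hc⟩ := m.exists_count e₀
  have hw := B.point_sub h
  have hε0 : ε ≠ 0 := by rcases hε with rfl | rfl <;> norm_num
  -- The count of shared edges depends only on the wedge with the winding. The winding is parallel
  -- to the side, so the count is the same for `k` as for `i`.
  have hwedge : (wedge (B.point k) (D.winding m e₀) : ℝ) = wedge (B.point i) (D.winding m e₀) := by
    have e1 : ε * ((wedge (B.point k) (D.winding m e₀) : ℝ) - wedge (B.point i) (D.winding m e₀)) =
        det2 (B.pt k - B.pt i) (ε • toPlane (D.winding m e₀)) := by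
      simp only [wedge, det2, pt, toPlane, Prod.fst_sub, Prod.snd_sub, Prod.smul_fst,
        Prod.smul_snd, smul_eq_mul]
      push_cast
      ring
    rw [← hw] at e1
    have e2 := det2_mul_dot2 u (B.pt k - B.pt i) (B.pt j - B.pt i)
    rw [dot2_sub u (B.pt k), dot2_sub u (B.pt j), hk, hd, sub_self, mul_zero, zero_mul,
      sub_zero] at e2
    rw [(mul_eq_zero.1 e2).resolve_right (dot2_self_pos hu).ne'] at e1
    linarith [(mul_eq_zero.1 e1).resolve_left hε0]
  rw [hc _ (B.isPerfectMatching k), B.latticePoint_matching, hwedge, ← B.latticePoint_matching,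
    ← hc _ (B.isPerfectMatching i), Finset.mul_sum]
  refine Finset.sum_congr rfl fun x _ => ?_
  by_cases hx : D.strand x = D.strand e₀
  · have hx' : D.chi (D.strand e₀) x = 1 := by simp [chi, hx]
    have n1 : D.chi (D.strand e₀) (D.white⁻¹ x) = 0 := by
      have := B.strand_ne x
      rw [hx] at this
      simp only [chi, this.symm, if_false]
    have n2 : D.chi (D.strand e₀) (D.white x) = 0 := by
      have := B.strand_ne (D.white x)
      rw [perm_inv_apply, hx] at this
      simp only [chi, this, if_false]
    have f1 := congrFun h x
    have f2 := congrFun h (D.white x)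
    simp only [Pi.sub_apply, Pi.smul_apply, zeta, smul_eq_mul, n1, n2, hx', perm_inv_apply,
      delta] at f1 f2
    rw [hx']
    simp only [delta]
    rcases hε with rfl | rfl <;> split_ifs at f1 f2 ⊢ <;> linarith
  · simp [chi, hx]

/-- Each matching contains every other edge of the path of `e₀`. As they disagree at one of its
edges, they alternate oppositely and disagree along the whole path, whereas they can differ only on
the path of `e₁`. -/
theorem flip {k l : Fin B.n} {e₀ e₁ e : E}
    (halt : ∀ k', (k' = k ∨ k' = l) →
      (∀ x, D.strand x = D.strand e₀ → x ∈ B.matching k' ∧ D.white x ∉ B.matching k') ∨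
      ∀ x, D.strand x = D.strand e₀ → x ∉ B.matching k' ∧ D.white x ∈ B.matching k')
    (he : e ∈ D.zigzagEdges e₀) (hek : e ∉ B.matching k) (hel : e ∈ B.matching l) {ε : ℝ}
    (h : delta (B.matching l) - delta (B.matching k) = (2 * ε) • D.zeta (D.strand e₁)) :
    D.zigzagEdges e₀ ⊆ D.zigzagEdges e₁ := by
  have hz : ∀ y, (y ∈ B.matching l ∧ y ∉ B.matching k ∨ y ∈ B.matching k ∧ y ∉ B.matching l) →
      y ∈ D.zigzagEdges e₁ := by
    intro y hy
    rw [mem_zigzagEdges]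
    by_contra! hn
    have f := congrFun h y
    simp only [Pi.sub_apply, Pi.smul_apply, zeta, chi, hn, if_false, sub_self, smul_zero,
      delta] at f
    rcases hy with hy | hy <;> simp [hy] at f
  have hflip : ∀ x, D.strand x = D.strand e₀ → x ∈ D.zigzagEdges e₁ ∧
      D.white x ∈ D.zigzagEdges e₁ := by
    intro x hx
    have hk := halt k (Or.inl rfl)
    have hl := halt l (Or.inr rfl)
    rw [mem_zigzagEdges] at he
    rcases hk with hk | hk <;> rcases hl with hl | hl
    · exfalso
      rcases he with he | he
      · exact hek (hk e he).1
      · have := (hl _ he).2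
        rw [perm_apply_inv] at this
        exact this hel
    · exact ⟨hz _ (Or.inr ⟨(hk x hx).1, (hl x hx).1⟩), hz _ (Or.inl ⟨(hl x hx).2, (hk x hx).2⟩)⟩
    · exact ⟨hz _ (Or.inl ⟨(hl x hx).1, (hk x hx).1⟩), hz _ (Or.inr ⟨(hk x hx).2, (hl x hx).2⟩)⟩
    · exfalso
      rcases he with he | he
      · exact (hl e he).1 hel
      · have := (hk _ he).2
        rw [perm_apply_inv] at this
        exact hek this
  intro y hy
  rw [mem_zigzagEdges] at hy
  rcases hy with hy | hy
  · exact (hflip y hy).1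
  · have := (hflip _ hy).2
    rwa [perm_apply_inv] at this

/-- Every edge lies in the matching of a corner. -/
theorem exists_corner_mem (e : E) : ∃ v, IsCorner B.pt v ∧ e ∈ B.matching v := by
  by_contra! hcor
  obtain ⟨i, hi⟩ := B.exists_mem_matching e
  have hinc : ¬IsCorner B.pt i := fun h => hcor i h hi
  obtain ⟨u, hu, hs, ⟨a', ha1, ha2⟩, ⟨b', hb1, hb2⟩⟩ := B.boundary.exists_line_of_not_corner hinc
  obtain ⟨va, hva, hva1, hva2⟩ := B.boundary.exists_corner_on_line hu i hs 1 one_ne_zero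
  obtain ⟨vb, hvb, hvb1, hvb2⟩ := B.boundary.exists_corner_on_line hu i hs (-1) (by norm_num)
  set W : Fin B.n → ℝ := fun k => dot2 (turn u) (B.pt k) with hW
  -- the last matching on the side that contains `e`
  obtain ⟨p, hp, hpmax⟩ := Finset.exists_max_image
    (Finset.univ.filter fun k => dot2 u (B.pt k) = dot2 u (B.pt i) ∧ e ∈ B.matching k) W
    ⟨i, by simp [hi]⟩
  -- The last matching before `i` that misses `e`: the step after `p'` brings `e` in, the step after
  -- `p` removes it.
  obtain ⟨p', hp', hpmax'⟩ := Finset.exists_max_image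
    (Finset.univ.filter fun k => dot2 u (B.pt k) = dot2 u (B.pt i) ∧ e ∉ B.matching k ∧ W k < W i) W
    ⟨va, by simp only [Finset.mem_filter, Finset.mem_univ, true_and]
            exact ⟨hva1, hcor va hva, by linarith [hva2 a' ha1]⟩⟩
  simp only [Finset.mem_filter, Finset.mem_univ, true_and] at hp hp' hpmax hpmax'
  have hpi : W i ≤ W p := hpmax i ⟨rfl, hi⟩
  have hpb : W p < W vb := by
    have h1 : W p ≤ W vb := by linarith [hvb2 p hp.1]
    refine lt_of_le_of_ne h1 fun h => ?_
    have : p = vb := B.boundary.injective (eq_of_dot2 hu (hp.1.trans hvb1.symm) h)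
    exact hcor vb hvb (this ▸ hp.2)
  obtain ⟨q, hq, hpq, hqmin, hcons⟩ := B.exists_next hu (a := p) (b := vb)
    (fun k => hp.1 ▸ hs k) (hvb1.trans hp.1.symm) hpb
  obtain ⟨q', hq', hpq', hqmin', hcons'⟩ := B.exists_next hu (a := p') (b := i)
    (fun k => hp'.1 ▸ hs k) hp'.1.symm hp'.2.2
  have heq : e ∉ B.matching q := fun h => by
    have := hpmax q ⟨hq.trans hp.1, h⟩
    linarith
  have hqi' : W q' ≤ W i := hqmin' i hp'.1.symm hp'.2.2
  have heq' : e ∈ B.matching q' := by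
    by_contra h
    rcases hqi'.eq_or_lt with h1 | h1
    · have : q' = i := B.boundary.injective (eq_of_dot2 hu (hq'.trans hp'.1) h1)
      exact h (this ▸ hi)
    · have := hpmax' q' ⟨hq'.trans hp'.1, h, h1⟩
      linarith
  obtain ⟨e₀, -, ε, hε, hδ⟩ := B.step hcons
  obtain ⟨e₁, -, ε', hε', hδ'⟩ := B.step hcons'
  have hpq0 : p ≠ q := fun h => by rw [h] at hpq; exact lt_irrefl _ hpq
  have hpq0' : p' ≠ q' := fun h => by rw [h] at hpq'; exact lt_irrefl _ hpq'
  have hmem : ∀ {k l : Fin B.n} {e₂ : E} {η : ℝ}, delta (B.matching l) - delta (B.matching k) =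
      (2 * η) • D.zeta (D.strand e₂) → (e ∈ B.matching l ∧ e ∉ B.matching k ∨
      e ∉ B.matching l ∧ e ∈ B.matching k) → e ∈ D.zigzagEdges e₂ := by
    intro k l e₂ η h hy
    rw [mem_zigzagEdges]
    by_contra! hn
    have f := congrFun h e
    simp only [Pi.sub_apply, Pi.smul_apply, zeta, chi, hn, if_false, sub_self, smul_zero,
      delta] at f
    rcases hy with hy | hy <;> simp [hy] at f
  have he₀ := hmem hδ (Or.inr ⟨heq, hp.2⟩)
  have he₁ := hmem hδ' (Or.inl ⟨heq', hp'.2.1⟩)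
  have hne : D.strand e₀ ≠ D.strand e₁ := by
    intro h
    rw [← h] at hδ'
    rcases B.eq_of_step_eq hpq0 hε hε' hδ hδ' with ⟨h1, -⟩ | ⟨h1, h2⟩
    · exact hp'.2.1 (h1 ▸ hp.2)
    · rw [h1, h2] at hpq'
      linarith
  have hline : ∀ k, k = p ∨ k = q ∨ k = p' ∨ k = q' → dot2 u (B.pt k) = dot2 u (B.pt i) := by
    rintro k (rfl | rfl | rfl | rfl)
    · exact hp.1
    · exact hq.trans hp.1
    · exact hp'.1
    · exact hq'.trans hp'.1
  -- At each of the two steps the other path is flipped too, because `e` lies on both.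
  have hE : D.zigzagEdges e₀ = D.zigzagEdges e₁ := by
    apply Set.Subset.antisymm
    · refine B.flip (k := p') (l := q') (fun k hk => ?_) he₀ hp'.2.1 heq' hδ'
      exact B.alternate hu hq hε hδ
        ((hline k (by tauto)).trans hp.1.symm)
    · refine B.flip (k := q) (l := p) (ε := -ε) (fun k hk => ?_) he₁ heq hp.2 ?_
      · exact B.alternate hu hq' hε' hδ'
          ((hline k (by tauto)).trans hp'.1.symm)
      · rw [← neg_sub, hδ, ← neg_smul]
        congr 1
        ring
  -- Two distinct paths with the same edges are the only ones, but a genuine polygon has at least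
  -- three steps.
  have htwo : Fintype.card (Cycles D.zigzagPerm) ≤ 2 := by
    have : (Finset.univ : Finset (Cycles D.zigzagPerm)) ⊆ {D.strand e₀, D.strand e₁} := by
      intro z _
      obtain ⟨x, rfl⟩ := Quotient.exists_rep z
      have := strand_eq_or_of_zigzagEdges_eq hne hE x
      exact Finset.mem_insert.2 (this.imp id Finset.mem_singleton.2)
    exact (Finset.card_le_card this).trans Finset.card_le_two
  linarith [B.three_le_card]

end BoundaryBasis

end Positivity

end Dimer

/-! ### Mesonic loops and the unitarity bound -/

/-- The value of an affine function at a point, from its values at the vertices of a triangle. -/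
theorem mul_planeArea_le {a b c : ℝ} {h : ℝ × ℝ → ℝ} (hh : ∀ p, h p = a * p.1 + b * p.2 + c)
    {p q r s : ℝ × ℝ} (hp : 0 ≤ h p) (hq : 0 ≤ h q) (hr : 0 ≤ h r) (hs : 0 ≤ h s) :
    h p * planeArea q r s ≤ h q * planeArea p r s + h r * planeArea q p s +
      h s * planeArea q r p := by
  have e : h p * det2 (r - q) (s - q) = h q * det2 (r - p) (s - p) +
      h r * det2 (p - q) (s - q) + h s * det2 (r - q) (p - q) := by
    simp only [hh, det2, Prod.fst_sub, Prod.snd_sub]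
    ring
  have h1 : |h p * det2 (r - q) (s - q)| ≤ |h q * det2 (r - p) (s - p)| +
      |h r * det2 (p - q) (s - q)| + |h s * det2 (r - q) (p - q)| := by
    rw [e]
    exact abs_add_three _ _ _
  simp only [abs_mul, abs_of_nonneg hp, abs_of_nonneg hq, abs_of_nonneg hr, abs_of_nonneg hs] at h1
  simp only [planeArea]
  linarith

namespace Dimer

section Unitarity

open Classical AreaCubic

variable {E : Type*} [Fintype E] {D : Dimer E} {m : D.Marking}

theorem triangleArea_eq (p q r : ℤ × ℤ) :
    triangleArea p q r = planeArea (toPlane p) (toPlane q) (toPlane r) := by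
  simp only [triangleArea, planeArea, wedge, det2, toPlane, Prod.fst_sub, Prod.snd_sub]
  push_cast
  rfl

/-- The number of arrows of a loop across an edge. -/
noncomputable def QuiverLoop.count (l : D.QuiverLoop) (e : E) : ℝ :=
  ∑ i, if l.arrow i = e then 1 else 0

theorem QuiverLoop.sum_count_mul (l : D.QuiverLoop) (g : E → ℝ) :
    ∑ e, l.count e * g e = ∑ i, g (l.arrow i) := by
  simp only [count, Finset.sum_mul]
  rw [Finset.sum_comm]
  simp

/-- A loop leaves each face as often as it enters it; the shift of the cyclic index matches entries
with exits. -/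
theorem QuiverLoop.count_closed (l : D.QuiverLoop) (e : E) :
    ∑ x with D.facePerm.SameCycle e x, (l.count x - l.count (D.white x)) = 0 := by
  rw [Finset.sum_filter]
  have h1 : ∀ x, (if D.facePerm.SameCycle e x then l.count x - l.count (D.white x) else 0) =
      l.count x * (if D.leftFace x = D.leftFace e then 1 else 0) -
      l.count (D.white x) * (if D.rightFace (D.white x) = D.leftFace e then 1 else 0) := by
    intro x
    rw [rightFace_white]
    have : D.leftFace x = D.leftFace e ↔ D.facePerm.SameCycle e x := by
      rw [eq_comm, leftFace_eq_iff]
    simp only [this]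
    split_ifs <;> ring
  simp only [h1, Finset.sum_sub_distrib]
  rw [sum_comp_perm D.white
    (fun x => l.count x * (if D.rightFace x = D.leftFace e then (1 : ℝ) else 0)),
    l.sum_count_mul, l.sum_count_mul, sub_eq_zero]
  simp only [l.composable]
  exact Equiv.sum_comp (Equiv.addRight (1 : Fin (l.k + 1)))
    (fun i => if D.rightFace (l.arrow i) = D.leftFace e then (1 : ℝ) else 0)

namespace BoundaryBasis

variable (B : D.BoundaryBasis m)

/-- The combination of the matchings with given weights. -/
noncomputable def combination : (Fin B.n → ℝ) →ₗ[ℝ] (E → ℝ) :=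
  Fintype.linearCombination ℝ fun i => (delta (B.matching i) : E → ℝ)

theorem combination_apply (x : Fin B.n → ℝ) :
    B.combination x = ∑ i, x i • delta (B.matching i) := rfl

theorem combination_injective : Function.Injective B.combination := by
  rw [← LinearMap.ker_eq_bot, LinearMap.ker_eq_bot']
  intro x hx
  ext i
  exact Fintype.linearIndependent_iff.1 B.independent x hx i

theorem mem_chargeAssignments {R : E → ℝ} :
    R ∈ D.chargeAssignments ↔ ∃ x, ∑ i, x i = 1 ∧ R = B.combination x := B.spanning R

theorem pos_of_corner {x : Fin B.n → ℝ} (hx : x ∈ cornerSimplex B.pt)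
    (hpos : ∀ i, IsCorner B.pt i → 0 < x i) (e : E) : 0 < B.combination x e := by
  obtain ⟨v, hv, he⟩ := B.exists_corner_mem e
  rw [combination_apply, Finset.sum_apply]
  refine Finset.sum_pos' (fun i _ => ?_) ⟨v, Finset.mem_univ v, ?_⟩
  · have : 0 ≤ (delta (B.matching i) e : ℝ) := by unfold delta; split_ifs <;> norm_num
    exact mul_nonneg (hx.1 i) this
  · simp [delta, he, hpos v hv]

/-- The affine function `h` counts the arrows of the loop that lie in a matching. Averaging the
barycentric inequality turns `h(p) ≥ 1` at one corner into a lower bound for its mean value. -/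
theorem meson_bound {x : Fin B.n → ℝ} (hx : x ∈ cornerSimplex B.pt) (hf : 0 < cubic B.pt x)
    (hw : ∀ p, IsCorner B.pt p → weight B.pt x x (B.pt p) ≤ cubic B.pt x) (l : D.QuiverLoop) :
    2 / 3 ≤ l.charge (B.combination x) := by
  obtain ⟨a, b, c, habc⟩ := m.exists_affine l.count l.count_closed
  set h : ℝ × ℝ → ℝ := fun p => a * p.1 + b * p.2 + c / 2 with hh
  have hcount : ∀ k, 2 * h (B.pt k) = ∑ i, delta (B.matching k) (l.arrow i) := by
    intro k
    rw [← l.sum_count_mul, habc _ (B.isPerfectMatching k), B.latticePoint_matching]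
    simp only [hh, pt, toPlane]
    ring
  have hnn : ∀ k, 0 ≤ h (B.pt k) := by
    intro k
    have : 0 ≤ ∑ i, (delta (B.matching k) (l.arrow i) : ℝ) :=
      Finset.sum_nonneg fun i _ => by unfold delta; split_ifs <;> norm_num
    linarith [hcount k]
  -- The loop has an arrow; this is where the trivial loop is excluded.
  obtain ⟨p, hp, hmem⟩ := B.exists_corner_mem (l.arrow 0)
  have hp1 : 1 ≤ h (B.pt p) := by
    have h1 : (delta (B.matching p) (l.arrow 0) : ℝ) ≤ ∑ i, delta (B.matching p) (l.arrow i) :=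
      Finset.single_le_sum (f := fun i => (delta (B.matching p) (l.arrow i) : ℝ))
        (fun i _ => by simp only [delta]; split_ifs <;> norm_num) (Finset.mem_univ 0)
    have h2 : (delta (B.matching p) (l.arrow 0) : ℝ) = 2 := by simp [delta, hmem]
    linarith [hcount p]
  have hcharge : l.charge (B.combination x) = 2 * ∑ k, h (B.pt k) * x k := by
    simp only [QuiverLoop.charge, combination_apply, Finset.sum_apply, Pi.smul_apply, smul_eq_mul]
    rw [Finset.sum_comm, Finset.mul_sum]
    refine Finset.sum_congr rfl fun k _ => ?_
    rw [← Finset.mul_sum, ← hcount]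
    ring
  set hb := ∑ k, h (B.pt k) * x k with hhb
  -- By the symmetry of the area, the three terms of the barycentric inequality have the same total;
  -- this is the factor `3`.
  have hsum : h (B.pt p) * cubic B.pt x ≤ 3 * (hb * weight B.pt x x (B.pt p)) := by
    have e0 : ∀ g : Fin B.n → Fin B.n → Fin B.n → ℝ, ∀ g' : Fin B.n → Fin B.n → Fin B.n → ℝ,
        (∀ i j k, g i j k ≤ g' i j k) →
        ∑ i, ∑ j, ∑ k, g i j k ≤ ∑ i, ∑ j, ∑ k, g' i j k := fun g g' hg =>
      Finset.sum_le_sum fun i _ => Finset.sum_le_sum fun j _ => Finset.sum_le_sum fun k _ => hg i j k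
    have e1 : hb * weight B.pt x x (B.pt p) = ∑ i, ∑ j, ∑ k,
        h (B.pt i) * planeArea (B.pt p) (B.pt j) (B.pt k) * (x i * x j * x k) := by
      rw [hhb, Finset.sum_mul]
      refine Finset.sum_congr rfl fun i _ => ?_
      simp only [weight, Finset.mul_sum]
      refine Finset.sum_congr rfl fun j _ => Finset.sum_congr rfl fun k _ => by ring
    have e2 : hb * weight B.pt x x (B.pt p) = ∑ i, ∑ j, ∑ k,
        h (B.pt j) * planeArea (B.pt i) (B.pt p) (B.pt k) * (x i * x j * x k) := by
      rw [e1, Finset.sum_comm]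
      refine Finset.sum_congr rfl fun i _ => Finset.sum_congr rfl fun j _ =>
        Finset.sum_congr rfl fun k _ => ?_
      rw [planeArea_swap_left (B.pt p)]
      ring
    have e3 : hb * weight B.pt x x (B.pt p) = ∑ i, ∑ j, ∑ k,
        h (B.pt k) * planeArea (B.pt i) (B.pt j) (B.pt p) * (x i * x j * x k) := by
      rw [e2]
      refine Finset.sum_congr rfl fun i _ => ?_
      rw [Finset.sum_comm]
      refine Finset.sum_congr rfl fun j _ => Finset.sum_congr rfl fun k _ => ?_
      rw [planeArea_swap_right (B.pt i) (B.pt p)]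
      ring
    have e4 : h (B.pt p) * cubic B.pt x = ∑ i, ∑ j, ∑ k,
        h (B.pt p) * planeArea (B.pt i) (B.pt j) (B.pt k) * (x i * x j * x k) := by
      rw [cubic_eq_sum]
      simp only [Finset.mul_sum]
      refine Finset.sum_congr rfl fun i _ => Finset.sum_congr rfl fun j _ =>
        Finset.sum_congr rfl fun k _ => by ring
    have e5 : 3 * (hb * weight B.pt x x (B.pt p)) = hb * weight B.pt x x (B.pt p) +
        hb * weight B.pt x x (B.pt p) + hb * weight B.pt x x (B.pt p) := by ring
    rw [e4, e5]
    nth_rewrite 1 [e1]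
    nth_rewrite 1 [e2]
    rw [e3]
    simp only [← Finset.sum_add_distrib]
    refine e0 _ _ fun i j k => ?_
    have := mul_planeArea_le (h := h) (fun _ => rfl) (hnn p) (hnn i) (hnn j) (hnn k)
    have hxx : 0 ≤ x i * x j * x k := mul_nonneg (mul_nonneg (hx.1 i) (hx.1 j)) (hx.1 k)
    have := mul_le_mul_of_nonneg_right this hxx
    linarith
  have hb0 : 0 ≤ hb := Finset.sum_nonneg fun k _ => mul_nonneg (hnn k) (hx.1 k)
  have h2 := mul_le_mul_of_nonneg_left (hw p hp) hb0
  have h3 : 1 * cubic B.pt x ≤ (3 * hb) * cubic B.pt x := by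
    have := mul_le_mul_of_nonneg_right hp1 hf.le
    linarith
  have h4 := le_of_mul_le_mul_right h3 hf
  rw [hcharge]
  linarith

end BoundaryBasis

theorem HasAreaForm.satisfiesUnitarityBound (h : D.HasAreaForm m) :
    D.SatisfiesUnitarityBound := by
  obtain ⟨B, hB⟩ := h
  obtain ⟨x, hx, hpos, hf, hw, hmax, hnc⟩ := B.boundary.exists_max
  have hanom : ∀ (N : ℕ) (y : Fin B.n → ℝ), ∑ i, y i = 1 →
      D.anomaly N (B.combination y) = 9 * (N : ℝ) ^ 2 / 4 * cubic B.pt y := by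
    intro N y hy
    rw [B.combination_apply, hB N y hy, cubic_eq_sum]
    simp only [triangleArea_eq]
    rfl
  have hanom_le : ∀ {N : ℕ}, 0 < N → ∀ {y z : Fin B.n → ℝ}, ∑ i, y i = 1 → ∑ i, z i = 1 →
      (D.anomaly N (B.combination y) ≤ D.anomaly N (B.combination z) ↔
        cubic B.pt y ≤ cubic B.pt z) := by
    intro N hN y z hy hz
    rw [hanom N y hy, hanom N z hz]
    have : (0 : ℝ) < N := by exact_mod_cast hN
    exact mul_le_mul_iff_right₀ (by positivity)
  -- A linear left inverse is continuous in finite dimension, so local maxima correspond under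
  -- `combination`.
  obtain ⟨g, hg⟩ := LinearMap.exists_leftInverse_of_injective B.combination
    (LinearMap.ker_eq_bot.2 B.combination_injective)
  have hg : ∀ y, g (B.combination y) = y := fun y => LinearMap.congr_fun hg y
  have hgc : Continuous g := g.continuous_of_finiteDimensional
  have hcc : Continuous B.combination := B.combination.continuous_of_finiteDimensional
  have hRpos := B.pos_of_corner hx hpos
  refine ⟨B.combination x, fun N hN R' => ⟨fun hR' => ?_, ?_⟩,
    fun l => B.meson_bound hx hf hw l, ?_⟩
  · obtain ⟨y, hy, rfl⟩ := B.mem_chargeAssignments.1 hR'.1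
    -- A second local maximum would make the form constant on the line through `x` and `y`.
    by_contra hne
    have hd : y - x ≠ 0 := fun h => hne (by rw [sub_eq_zero.1 h])
    have hline : ∀ (z : Fin B.n → ℝ) (s : ℝ), ∑ i, z i = 1 → ∑ i, (z + s • (y - x)) i = 1 := by
      intro z s hz
      simp [Finset.sum_add_distrib, ← Finset.mul_sum, hz, hy, hx.2.1]
    have htend : ∀ z : Fin B.n → ℝ,
        Filter.Tendsto (fun s : ℝ => z + s • (y - x)) (𝓝 0) (𝓝 z) := by
      intro z
      have hc : Continuous fun s : ℝ => z + s • (y - x) := by fun_prop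
      simpa using hc.tendsto 0
    have h1 : ∀ᶠ s : ℝ in 𝓝 0, cubic B.pt (x + s • (y - x)) ≤ cubic B.pt x :=
      ((htend x).eventually hmax).mono fun s hs => hs (hline x s hx.2.1)
    have h2 : ∀ᶠ s : ℝ in 𝓝 0, cubic B.pt (y + s • (y - x)) ≤ cubic B.pt y := by
      have ht : Filter.Tendsto (fun s : ℝ => B.combination (y + s • (y - x))) (𝓝 0)
          (𝓝[D.chargeAssignments] (B.combination y)) :=
        tendsto_nhdsWithin_iff.2 ⟨(hcc.tendsto y).comp (htend y),
          Filter.Eventually.of_forall fun s => B.mem_chargeAssignments.2 ⟨_, hline y s hy, rfl⟩⟩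
      exact (ht.eventually hR'.2).mono fun s hs => (hanom_le hN (hline y s hy) hy).1 hs
    obtain ⟨s, hs⟩ := hnc (y - x) (by simp [hy, hx.2.1]) hd
    exact hs (eq_of_two_localMax h1 h2 s)
  · rintro rfl
    refine ⟨B.mem_chargeAssignments.2 ⟨x, hx.2.1, rfl⟩, ?_⟩
    have ht : Filter.Tendsto g (𝓝 (B.combination x)) (𝓝 x) := by
      have := hgc.tendsto (B.combination x)
      rwa [hg] at this
    have hev : ∀ᶠ R in 𝓝[D.chargeAssignments] (B.combination x), ∑ i, g R i = 1 →
        cubic B.pt (g R) ≤ cubic B.pt x := (ht.eventually hmax).filter_mono nhdsWithin_le_nhds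
    filter_upwards [hev, self_mem_nhdsWithin] with R hR hRc
    obtain ⟨y, hy, rfl⟩ := B.mem_chargeAssignments.1 hRc
    rw [hg] at hR
    exact (hanom_le hN hy hx.2.1).2 (hR hy)
  -- There are finitely many edges with positive charges; the sum of the individual bounds serves
  -- all of them.
  · choose f hf using fun e => exists_nat_ge (2 / 3 / B.combination x e)
    refine ⟨∑ e, f e, fun N hN O => ?_⟩
    rcases O with l | e
    · exact B.meson_bound hx ‹_› hw l
    · have h1 : f e ≤ N := (Finset.single_le_sum (fun _ _ => Nat.zero_le _)
        (Finset.mem_univ e)).trans hN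
      have h2 : 2 / 3 / B.combination x e ≤ N := (hf e).trans (by exact_mod_cast h1)
      rwa [div_le_iff₀ (hRpos e)] at h2

end Unitarity

end Dimer

/-! ### Angles of lattice vectors in circular order -/

/-- The angle of a lattice vector, between `-π` and `π`. -/
noncomputable def latticeArg (p : ℤ × ℤ) : ℝ := Complex.arg ⟨p.1, p.2⟩

theorem exists_latticeArg {p : ℤ × ℤ} {r θ : ℝ} (hr : 0 < r)
    (h : toPlane p = (r * Real.cos θ, r * Real.sin θ)) :
    ∃ k : ℤ, θ = latticeArg p + 2 * Real.pi * k := by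
  have h1 : (p.1 : ℝ) = r * Real.cos θ := congrArg Prod.fst h
  have h2 : (p.2 : ℝ) = r * Real.sin θ := congrArg Prod.snd h
  have e : (⟨p.1, p.2⟩ : ℂ) = r * (Complex.cos θ + Complex.sin θ * Complex.I) := by
    rw [h1, h2]
    apply Complex.ext <;> simp [Complex.cos_ofReal_re, Complex.sin_ofReal_re,
      Complex.cos_ofReal_im, Complex.sin_ofReal_im]
  have := Complex.arg_mul_cos_add_sin_mul_I_sub hr θ
  rw [← e] at this
  refine ⟨-⌊(Real.pi - θ) / (2 * Real.pi)⌋, ?_⟩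
  rw [latticeArg]
  push_cast
  linarith

/-- In one turn the angle drops exactly once. -/
theorem InCircularOrder.descents {n : ℕ} {u : ℕ → ℤ × ℤ} (h : InCircularOrder n u) (hn : 2 ≤ n)
    (hu : u n = u 0) :
    (∀ i < n, latticeArg (u (i + 1)) ≠ latticeArg (u i)) ∧
      ∑ i ∈ Finset.range n, (if latticeArg (u (i + 1)) < latticeArg (u i) then (1 : ℤ) else 0) =
        1 := by
  obtain ⟨θ, hθ, hr⟩ := h
  have hm : ∀ i, ∃ k : ℤ, i < n → θ i = latticeArg (u i) + 2 * Real.pi * k := by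
    intro i
    by_cases hi : i < n
    · obtain ⟨r, hr0, hr⟩ := hr i hi
      obtain ⟨k, hk⟩ := exists_latticeArg hr0 hr
      exact ⟨k, fun _ => hk⟩
    · exact ⟨0, fun h => absurd h hi⟩
  choose k hk using hm
  -- The index `n` stands for the first vector after a full turn: its angle has grown by `2π` and
  -- its branch number by one.
  set k' : ℕ → ℤ := fun i => if i < n then k i else k 0 + 1 with hk'
  set θ' : ℕ → ℝ := fun i => if i < n then θ i else θ 0 + 2 * Real.pi with hθ'
  have hpi := Real.pi_pos
  have hrep : ∀ i ≤ n, θ' i = latticeArg (u i) + 2 * Real.pi * k' i := by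
    intro i hi
    rcases hi.lt_or_eq with hi | rfl
    · simp only [hθ', hk', hi, if_true, hk i hi]
    · simp only [hθ', hk', lt_irrefl, if_false, hk 0 (by omega), hu]
      push_cast
      ring
  have hstep : ∀ i < n, 0 < θ' (i + 1) - θ' i ∧ θ' (i + 1) - θ' i < 2 * Real.pi := by
    intro i hi
    by_cases hi' : i + 1 < n
    · have := hθ i (i + 1) (Nat.lt_succ_self i) hi'
      simp only [hθ', hi, hi', if_true]
      constructor <;> linarith
    · have := hθ 0 i (by omega) hi
      simp only [hθ', hi, hi', if_true, if_false]
      constructor <;> linarith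
  -- The angle grows by less than `2π` and principal values differ by less than `2π`. Hence the
  -- branch number grows by `0` or `1`, and by `1` exactly when the principal value drops. The sum
  -- of these increments telescopes to one.
  have hcase : ∀ i < n, (k' (i + 1) - k' i = 0 ∧ latticeArg (u i) < latticeArg (u (i + 1))) ∨
      (k' (i + 1) - k' i = 1 ∧ latticeArg (u (i + 1)) < latticeArg (u i)) := by
    intro i hi
    have h1 := hstep i hi
    rw [hrep i hi.le, hrep (i + 1) hi] at h1
    have a1 : -Real.pi < latticeArg (u i) := Complex.neg_pi_lt_arg _
    have a2 : latticeArg (u i) ≤ Real.pi := Complex.arg_le_pi _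
    have b1 : -Real.pi < latticeArg (u (i + 1)) := Complex.neg_pi_lt_arg _
    have b2 : latticeArg (u (i + 1)) ≤ Real.pi := Complex.arg_le_pi _
    have c1 : 2 * Real.pi * (-1) < 2 * Real.pi * ((k' (i + 1) - k' i : ℤ) : ℝ) := by
      push_cast; linarith
    have c2 : 2 * Real.pi * ((k' (i + 1) - k' i : ℤ) : ℝ) < 2 * Real.pi * 2 := by
      push_cast; linarith
    have d1 : (-1 : ℝ) < ((k' (i + 1) - k' i : ℤ) : ℝ) := lt_of_mul_lt_mul_left c1 (by linarith)
    have d2 : ((k' (i + 1) - k' i : ℤ) : ℝ) < 2 := lt_of_mul_lt_mul_left c2 (by linarith)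
    have e1 : -1 < k' (i + 1) - k' i := by exact_mod_cast d1
    have e2 : k' (i + 1) - k' i < 2 := by exact_mod_cast d2
    have : k' (i + 1) - k' i = 0 ∨ k' (i + 1) - k' i = 1 := by omega
    rcases this with h | h
    · left
      refine ⟨h, ?_⟩
      have : (k' (i + 1) : ℝ) = k' i := by exact_mod_cast sub_eq_zero.1 h
      rw [this] at h1
      linarith
    · right
      refine ⟨h, ?_⟩
      have : (k' (i + 1) : ℝ) = k' i + 1 := by
        have : k' (i + 1) = k' i + 1 := by omega
        exact_mod_cast this
      rw [this] at h1
      linarith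
  refine ⟨fun i hi => ?_, ?_⟩
  · rcases hcase i hi with h | h
    · exact h.2.ne'
    · exact h.2.ne
  · have : ∀ i ∈ Finset.range n,
        (if latticeArg (u (i + 1)) < latticeArg (u i) then (1 : ℤ) else 0) = k' (i + 1) - k' i := by
      intro i hi
      rcases hcase i (Finset.mem_range.1 hi) with h | h
      · rw [if_neg h.2.le.not_gt, h.1]
      · rw [if_pos h.2, h.1]
    rw [Finset.sum_congr rfl this, Finset.sum_range_sub]
    have h0 : 0 < n := by omega
    simp only [hk', lt_irrefl, if_false, h0, if_true]
    ring

/-! ### Sorting the zigzag paths by angle -/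

namespace Dimer

section Sweep

open Classical

variable {E : Type*} [Fintype E]

/-- An order of the zigzag paths such that around every node the order drops exactly once. -/
structure SweepOrder (D : Dimer E) where
  rank : Cycles D.zigzagPerm ≃ Fin (Fintype.card (Cycles D.zigzagPerm))
  strand_ne : ∀ e, D.strand e ≠ D.strand (D.white⁻¹ e)
  white_drop : ∀ e, ∃! x, rank (D.strand x) < rank (D.strand (D.white⁻¹ x)) ∧
    D.white.SameCycle e x
  black_drop : ∀ e, ∃! x, rank (D.strand x) < rank (D.strand (D.white⁻¹ x)) ∧
    D.black.SameCycle e x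

variable {D : Dimer E} {m : D.Marking}

theorem winding_eq {x y : E} (h : D.strand x = D.strand y) : D.winding m x = D.winding m y := by
  unfold winding
  rw [strand_eq_iff] at h
  refine Finset.sum_congr ?_ fun _ _ => rfl
  ext z
  simp only [Finset.mem_filter, Finset.mem_univ, true_and]
  exact ⟨fun hz => h.symm.trans hz, fun hz => h.trans hz⟩

/-- The count of descents in one turn, carried over to cycles. A drop between `y` and `π y` is
attributed to the edge `π y`, whose two paths it compares. -/
theorem existsUnique_drop (π : Equiv.Perm E) (a : E → ℝ) (w : E → ℤ × ℤ)
    (ha : ∀ e, a e = latticeArg (w e)) (hπ : ∀ e, π e ≠ e)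
    (h : ∀ e, InCircularOrder (Function.minimalPeriod π e) fun i => w ((π ^ i) e)) :
    (∀ e, a (π e) ≠ a e) ∧ ∀ e, ∃! x, a x < a (π⁻¹ x) ∧ π.SameCycle e x := by
  have key : ∀ e, _ := fun e => (h e).descents (by
      have h0 : 0 < Function.minimalPeriod π e :=
        Function.minimalPeriod_pos_of_mem_periodicPts (π.injective.mem_periodicPts e)
      have h1 : Function.minimalPeriod π e ≠ 1 := fun h1 =>
        hπ e (Function.minimalPeriod_eq_one_iff_isFixedPt.1 h1)
      omega) (by
      have : (π ^ Function.minimalPeriod π e) e = e := by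
        have := Function.iterate_minimalPeriod (f := π) (x := e)
        rwa [← Equiv.Perm.coe_pow] at this
      simp only [this, pow_zero, Equiv.Perm.one_apply])
  simp only [← ha, pow_succ', Equiv.Perm.mul_apply] at key
  refine ⟨fun e => ?_, fun e => ?_⟩
  · have := (key e).1 0 (Function.minimalPeriod_pos_of_mem_periodicPts
      (π.injective.mem_periodicPts e))
    simpa only [pow_zero, Equiv.Perm.one_apply] using this
  · have h1 := (key e).2
    rw [sum_range_minimalPeriod π (fun x => if a (π x) < a x then (1 : ℤ) else 0) e] at h1
    have h2 := sum_sameCycle_comp π (fun x => if a x < a (π⁻¹ x) then (1 : ℤ) else 0) e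
    simp only [perm_inv_apply] at h2
    rw [h2, Finset.sum_boole] at h1
    have h3 : (Finset.filter (fun x => a x < a (π⁻¹ x))
        (Finset.filter (fun y => π.SameCycle e y) Finset.univ)).card = 1 := by exact_mod_cast h1
    obtain ⟨x, hx⟩ := Finset.card_eq_one.1 h3
    have hmem : ∀ y, (a y < a (π⁻¹ y) ∧ π.SameCycle e y) ↔ y = x := by
      intro y
      have := Finset.ext_iff.1 hx y
      simp only [Finset.mem_filter, Finset.mem_univ, true_and, Finset.mem_singleton] at this
      rw [← this, and_comm]
    exact ⟨x, (hmem x).2 rfl, fun y hy => (hmem y).1 hy⟩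

/-- Ties in the angle are broken arbitrarily. This is harmless, because paths adjacent at a node
have different angles. -/
theorem ProperlyOrdered.nonempty_sweepOrder (h : D.ProperlyOrdered m) :
    Nonempty (SweepOrder D) := by
  obtain ⟨hw, hb, hne⟩ := h
  have hs : ∀ e, D.strand e ≠ D.strand (D.white⁻¹ e) := fun e he => hne e (winding_eq he)
  set a : E → ℝ := fun e => latticeArg (D.winding m e) with ha
  obtain ⟨aw, dw⟩ := existsUnique_drop D.white a (D.winding m) (fun _ => rfl)
    (strand_ne_white hs) hw
  obtain ⟨ab, db⟩ := existsUnique_drop D.black a (D.winding m) (fun _ => rfl)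
    (strand_ne_black hs) hb
  set b : Cycles D.zigzagPerm → ℝ := fun z => a z.out with hbdef
  have hba : ∀ e, b (D.strand e) = a e := by
    intro e
    simp only [hbdef, ha]
    rw [winding_eq (x := (D.strand e).out) (y := e) (Quotient.out_eq _)]
  let e₀ := Fintype.equivFin (Cycles D.zigzagPerm)
  let σ := Tuple.sort (b ∘ e₀.symm)
  have hσ : Monotone ((b ∘ e₀.symm) ∘ σ) := Tuple.monotone_sort _
  let rank := e₀.trans σ.symm
  have hrank : ∀ y z, rank y ≤ rank z → b y ≤ b z := by
    intro y z hyz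
    have := hσ hyz
    simpa [rank] using this
  have hiff : ∀ x y, a x ≠ a y → (rank (D.strand x) < rank (D.strand y) ↔ a x < a y) := by
    intro x y hxy
    constructor
    · intro h
      have := hrank _ _ h.le
      rw [hba, hba] at this
      exact lt_of_le_of_ne this hxy
    · intro h
      by_contra hn
      have := hrank _ _ (not_lt.1 hn)
      rw [hba, hba] at this
      exact this.not_gt h
  have hneq : ∀ x, a x ≠ a (D.white⁻¹ x) := fun x => by
    have := aw (D.white⁻¹ x)
    rwa [perm_apply_inv] at this
  have hab : ∀ x, a (D.black⁻¹ x) = a (D.white⁻¹ x) := fun x => by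
    simp only [ha]
    rw [winding_eq (strand_black_inv x)]
  refine ⟨⟨rank, hs, fun e => ?_, fun e => ?_⟩⟩
  · simpa only [hiff _ _ (hneq _)] using dw e
  · have := db e
    simp only [hab] at this
    simpa only [hiff _ _ (hneq _)] using this

end Sweep

end Dimer

/-! ### The matchings of the sweep -/

namespace Dimer

section SweepMatchings

open Classical

variable {E : Type*} [Fintype E] {D : Dimer E} {m : D.Marking}

theorem sum_eq_one_iff {π : Equiv.Perm E} {p : E → Prop} [DecidablePred p] {e : E} :
    ∑ x with π.SameCycle e x, (if p x then (1 : ℝ) else 0) = 1 ↔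
      ∃! x, p x ∧ π.SameCycle e x := by
  rw [Finset.sum_boole, Nat.cast_eq_one, Finset.card_eq_one]
  have hmem : ∀ y, y ∈ Finset.filter p (Finset.filter (fun x => π.SameCycle e x) Finset.univ) ↔
      p y ∧ π.SameCycle e y := by
    intro y
    simp only [Finset.mem_filter, Finset.mem_univ, true_and, and_comm]
  constructor
  · rintro ⟨x, hx⟩
    have h : ∀ y, (p y ∧ π.SameCycle e y) ↔ y = x := fun y => by
      rw [← hmem, hx, Finset.mem_singleton]
    exact ⟨x, (h x).2 rfl, fun y hy => (h y).1 hy⟩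
  · rintro ⟨x, hx, hu⟩
    refine ⟨x, ?_⟩
    ext y
    rw [hmem, Finset.mem_singleton]
    exact ⟨fun hy => hu y hy, fun hy => hy ▸ hx⟩

theorem sum_perm_inv (π : Equiv.Perm E) (g : E → ℝ) (e : E) :
    ∑ x with π.SameCycle e x, g (π⁻¹ x) = ∑ x with π.SameCycle e x, g x := by
  have := sum_sameCycle_comp π (fun x => g (π⁻¹ x)) e
  simp only [perm_inv_apply] at this
  exact this.symm

/-- A set of edges that is closed under rotation about the nodes contains all edges. -/
theorem forall_of_closed {S : E → Prop} (hw : ∀ x, S x → S (D.white x))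
    (hb : ∀ x, S x → S (D.black x)) {x : E} (hx : S x) (y : E) : S y := by
  have key : ∀ π : Equiv.Perm E, (∀ x, S x → S (π x)) → ∀ x, S (π x) = S x := by
    intro π hπ x
    refine propext ⟨fun h => ?_, hπ x⟩
    obtain ⟨n, hn⟩ := (sameCycle_apply π x).symm.exists_nat_pow_eq
    have : ∀ n : ℕ, S ((π ^ n) (π x)) := by
      intro n
      induction n with
      | zero => exact h
      | succ n ih => rw [pow_succ', Equiv.Perm.mul_apply]; exact hπ _ ih
    exact hn ▸ this n
  rw [D.eq_of_invariant S (key _ hw) (key _ hb) y x]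
  exact hx

theorem card_matching_white {M : Finset E} (hM : D.IsPerfectMatching M) :
    M.card = Fintype.card (Cycles D.white) := by
  have h := sum_cycles D.white (fun x => if x ∈ M then (1 : ℝ) else 0)
  rw [Finset.sum_congr rfl fun c _ => sum_eq_one_iff.2 (hM.1 c.out)] at h
  simp only [Finset.sum_const, Finset.card_univ, nsmul_eq_mul, mul_one, Finset.sum_boole,
    Finset.filter_mem_eq_inter, Finset.univ_inter, Nat.cast_inj] at h
  exact h.symm

theorem card_matching_black {M : Finset E} (hM : D.IsPerfectMatching M) :
    M.card = Fintype.card (Cycles D.black) := by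
  have h := sum_cycles D.black (fun x => if x ∈ M then (1 : ℝ) else 0)
  rw [Finset.sum_congr rfl fun c _ => sum_eq_one_iff.2 (hM.2 c.out)] at h
  simp only [Finset.sum_const, Finset.card_univ, nsmul_eq_mul, mul_one, Finset.sum_boole,
    Finset.filter_mem_eq_inter, Finset.univ_inter, Nat.cast_inj] at h
  exact h.symm

theorem card_edges {M : Finset E} (hM : D.IsPerfectMatching M) :
    2 * M.card + Fintype.card D.Face = Fintype.card E := by
  have h1 := card_matching_white hM
  have h2 := card_matching_black hM
  have h3 : Fintype.card (Cycles D.white) + Fintype.card (Cycles D.black) +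
    Fintype.card D.Face = Fintype.card E := D.euler
  omega

/-- A matching misses both sides of some corner: there are nodes of degree three or more. -/
theorem exists_corner_notMem {M : Finset E} (hM : D.IsPerfectMatching M) :
    ∃ e, e ∉ M ∧ D.white e ∉ M := by
  by_contra! h
  have h1 : ∀ e, (1 : ℝ) ≤ (if e ∈ M then (1 : ℝ) else 0) + if D.white e ∈ M then 1 else 0 := by
    intro e
    by_cases he : e ∈ M
    · simp only [he, if_true]; split_ifs <;> norm_num
    · simp [he, h e he]
  have h2 := Finset.sum_le_sum fun e (_ : e ∈ Finset.univ) => h1 e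
  rw [Finset.sum_add_distrib, sum_comp_perm D.white (fun e => if e ∈ M then (1 : ℝ) else 0)] at h2
  simp only [Finset.sum_const, Finset.card_univ, nsmul_eq_mul, mul_one, Finset.sum_boole,
    Finset.filter_mem_eq_inter, Finset.univ_inter] at h2
  have h3 : Fintype.card E ≤ M.card + M.card := by exact_mod_cast h2
  have h4 := card_edges hM
  obtain ⟨e₀⟩ := D.nonempty
  have : 0 < Fintype.card D.Face := Fintype.card_pos_iff.2 ⟨D.leftFace e₀⟩
  omega

namespace SweepOrder

variable (S : SweepOrder D)

/-- The rank of the zigzag path that traverses the edge from black to white. -/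
def lower (e : E) : ℕ := S.rank (D.strand e)

/-- The rank of the zigzag path that traverses the edge from white to black. -/
def upper (e : E) : ℕ := S.rank (D.strand (D.white⁻¹ e))

theorem lower_ne_upper (e : E) : S.lower e ≠ S.upper e := fun h =>
  S.strand_ne e (S.rank.injective (Fin.ext h))

theorem lower_lt (e : E) : S.lower e < Fintype.card (Cycles D.zigzagPerm) := (S.rank _).isLt

theorem upper_lt (e : E) : S.upper e < Fintype.card (Cycles D.zigzagPerm) := (S.rank _).isLt

/-- The edges at which the order of the zigzag paths around a node drops, when the order is cut
at `k`. -/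
noncomputable def mat (k : ℕ) : Finset E := Finset.univ.filter fun e =>
  if S.lower e < S.upper e then k ≤ S.lower e ∨ S.upper e < k
  else S.upper e < k ∧ k ≤ S.lower e

theorem mem_mat {k : ℕ} {e : E} : e ∈ S.mat k ↔
    if S.lower e < S.upper e then k ≤ S.lower e ∨ S.upper e < k
    else S.upper e < k ∧ k ≤ S.lower e := by
  simp [mat]

/-- The dependence on the cut is a difference of two indicators that have the same sum around every
node. So each node keeps as many edges as for the cut at zero, namely its single drop. -/
theorem ite_mem_mat (k : ℕ) (e : E) : (if e ∈ S.mat k then (1 : ℝ) else 0) =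
    (if S.upper e < k then (1 : ℝ) else 0) - (if S.lower e < k then 1 else 0) +
      if S.lower e < S.upper e then 1 else 0 := by
  have h := S.lower_ne_upper e
  simp only [mem_mat]
  by_cases h1 : S.lower e < S.upper e
  · by_cases h2 : S.lower e < k
    · by_cases h3 : S.upper e < k
      · simp [h1, h2, h3]
      · simp [h1, h2, h3, h2.not_ge]
    · have h3 : ¬S.upper e < k := by omega
      simp [h1, h2, h3, not_lt.1 h2]
  · by_cases h3 : S.upper e < k
    · by_cases h2 : S.lower e < k
      · simp [h1, h2, h3, h2.not_ge]
      · simp [h1, h2, h3, not_lt.1 h2]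
    · have h2 : ¬S.lower e < k := by omega
      simp [h1, h2, h3]

theorem isPerfectMatching (k : ℕ) : D.IsPerfectMatching (S.mat k) := by
  have hb : ∀ e, S.upper e = S.lower (D.black⁻¹ e) := fun e => by
    simp only [upper, lower, strand_black_inv]
  refine ⟨fun e => ?_, fun e => ?_⟩
  · have h0 := sum_eq_one_iff.2 (S.white_drop e)
    rw [← sum_eq_one_iff]
    simp only [S.ite_mem_mat, Finset.sum_add_distrib, Finset.sum_sub_distrib]
    have h1 := sum_perm_inv D.white (fun x => if S.lower x < k then (1 : ℝ) else 0) e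
    change ∑ x with D.white.SameCycle e x, (if S.upper x < k then (1 : ℝ) else 0) = _ at h1
    rw [h1, sub_self, zero_add]
    exact h0
  · have h0 := sum_eq_one_iff.2 (S.black_drop e)
    rw [← sum_eq_one_iff]
    simp only [S.ite_mem_mat, Finset.sum_add_distrib, Finset.sum_sub_distrib]
    have h1 := sum_perm_inv D.black (fun x => if S.lower x < k then (1 : ℝ) else 0) e
    simp only [← hb] at h1
    rw [h1, sub_self, zero_add]
    exact h0

theorem delta_mat (k : ℕ) (e : E) : delta (S.mat k) e =
    2 * ((if S.upper e < k then (1 : ℝ) else 0) - (if S.lower e < k then 1 else 0) +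
      if S.lower e < S.upper e then 1 else 0) := by
  rw [← S.ite_mem_mat, delta]
  split_ifs <;> norm_num

theorem delta_mat_succ {k : ℕ} (hk : k < Fintype.card (Cycles D.zigzagPerm)) :
    delta (S.mat (k + 1)) - delta (S.mat k) = (2 : ℝ) • D.zeta (S.rank.symm ⟨k, hk⟩) := by
  ext e
  have h1 : (D.strand e = S.rank.symm ⟨k, hk⟩) ↔ S.lower e = k := by
    rw [Equiv.eq_symm_apply, Fin.ext_iff]; rfl
  have h2 : (D.strand (D.white⁻¹ e) = S.rank.symm ⟨k, hk⟩) ↔ S.upper e = k := by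
    rw [Equiv.eq_symm_apply, Fin.ext_iff]; rfl
  have h3 : ∀ n : ℕ, (if n < k + 1 then (1 : ℝ) else 0) =
      (if n < k then 1 else 0) + if n = k then 1 else 0 := by
    intro n
    rcases lt_trichotomy n k with h | h | h
    · simp [h, h.ne, Nat.lt_succ_of_lt h]
    · simp [h]
    · have : ¬n < k + 1 := by omega
      simp [h.not_gt, h.ne', this]
  simp only [Pi.sub_apply, Pi.smul_apply, smul_eq_mul, delta_mat, zeta, chi, h1, h2, h3]
  ring

theorem mat_card : S.mat (Fintype.card (Cycles D.zigzagPerm)) = S.mat 0 := by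
  ext e
  have h1 := S.lower_lt e
  have h2 := S.upper_lt e
  rw [mem_mat, mem_mat]
  split_ifs with h <;> omega

theorem exists_mem_mat (e : E) : ∃ k < Fintype.card (Cycles D.zigzagPerm), e ∈ S.mat k := by
  have h := S.lower_ne_upper e
  by_cases h1 : S.lower e < S.upper e
  · exact ⟨0, (Nat.zero_le _).trans_lt (S.lower_lt e), by rw [mem_mat, if_pos h1]; simp⟩
  · refine ⟨S.lower e, S.lower_lt e, ?_⟩
    rw [mem_mat, if_neg h1]
    omega

/-- The number of sides of a face that are in a matching does not depend on the matching. -/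
theorem sum_face_mat (k : ℕ) (hk : k ≤ Fintype.card (Cycles D.zigzagPerm)) (e : E) :
    ∑ x with D.facePerm.SameCycle e x, (delta (S.mat k) x + delta (S.mat k) (D.white x)) =
      ∑ x with D.facePerm.SameCycle e x, (delta (S.mat 0) x + delta (S.mat 0) (D.white x)) := by
  induction k with
  | zero => rfl
  | succ k ih =>
    rw [← ih (by omega)]
    have h := S.delta_mat_succ (k := k) (by omega)
    have h1 : ∀ x, delta (S.mat (k + 1)) x = delta (S.mat k) x +
        2 * D.zeta (S.rank.symm ⟨k, by omega⟩) x := fun x => by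
      have := congrFun h x
      simp only [Pi.sub_apply, Pi.smul_apply, smul_eq_mul] at this
      linarith
    have h2 := sum_zeta_face (S.rank.symm ⟨k, by omega⟩) e
    have h3 : ∀ x, delta (S.mat (k + 1)) x + delta (S.mat (k + 1)) (D.white x) =
        (delta (S.mat k) x + delta (S.mat k) (D.white x)) +
        2 * (D.zeta (S.rank.symm ⟨k, by omega⟩) x +
          D.zeta (S.rank.symm ⟨k, by omega⟩) (D.white x)) := fun x => by
      rw [h1, h1]; ring
    rw [Finset.sum_congr rfl fun x _ => h3 x, Finset.sum_add_distrib, ← Finset.mul_sum, h2,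
      mul_zero, add_zero]

/-- Every edge belongs to some matching of the sweep. If each of these uses `x` or `π x` at the
node, then the node has no other edges. -/
theorem eq_of_mem_cycle {π : Equiv.Perm E} (h : ∀ k, ∀ x y, x ∈ S.mat k → y ∈ S.mat k →
    π.SameCycle x y → x = y) {x y : E} (hx : ∀ k ≤ Fintype.card (Cycles D.zigzagPerm),
    x ∈ S.mat k ∨ π x ∈ S.mat k) (hy : π.SameCycle x y) : y = x ∨ y = π x := by
  obtain ⟨k, hk, hyk⟩ := S.exists_mem_mat y
  rcases hx k hk.le with h1 | h1
  · exact Or.inl (h k _ _ hyk h1 hy.symm)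
  · exact Or.inr (h k _ _ hyk h1 (hy.symm.trans (sameCycle_apply _ _)))

/-- Equality would make every matching of the sweep use one of the two sides at each corner of the
face, so all its nodes would have degree two. The graph would then be the boundary of this face, and
no matching could miss both edges of a corner. -/
theorem sum_face_lt (e : E) :
    ∑ x with D.facePerm.SameCycle e x, (delta (S.mat 0) x + delta (S.mat 0) (D.white x)) <
      ∑ x with D.facePerm.SameCycle e x, (2 : ℝ) := by
  have hle : ∀ k x, delta (S.mat k) x + delta (S.mat k) (D.white x) ≤ 2 := fun k x =>
    delta_add_white_le S.strand_ne (S.isPerfectMatching k) x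
  have hle' : ∀ k x, delta (S.mat k) (D.white x) + delta (S.mat k) (D.facePerm x) ≤ 2 := by
    intro k x
    have : ¬(D.white x ∈ S.mat k ∧ D.facePerm x ∈ S.mat k) := fun hx =>
      strand_ne_black S.strand_ne (D.white x) ((S.isPerfectMatching k).eq_black hx.1 hx.2
        (by rw [facePerm_apply]; exact sameCycle_apply _ _)).symm
    simp only [delta]
    split_ifs <;> first | tauto | norm_num
  have hor : ∀ {M : Finset E} {x y : E}, (delta M x + delta M y : ℝ) = 2 → x ∈ M ∨ y ∈ M := by
    intro M x y h
    by_contra! hn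
    simp [delta, hn.1, hn.2] at h
  by_contra hnot
  have heq := le_antisymm (Finset.sum_le_sum fun x _ => hle 0 x) (not_lt.1 hnot)
  have h1 : ∀ k ≤ Fintype.card (Cycles D.zigzagPerm), ∀ x, D.facePerm.SameCycle e x →
      x ∈ S.mat k ∨ D.white x ∈ S.mat k := by
    intro k hk x hx
    have := (S.sum_face_mat k hk e).trans heq
    rw [Finset.sum_eq_sum_iff_of_le fun x _ => hle k x] at this
    exact hor (this x (by simpa using hx))
  have h2 : ∀ k ≤ Fintype.card (Cycles D.zigzagPerm), ∀ x, D.facePerm.SameCycle e x →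
      D.white x ∈ S.mat k ∨ D.facePerm x ∈ S.mat k := by
    intro k hk x hx
    have := (S.sum_face_mat k hk e).trans heq
    rw [Finset.sum_add_distrib, ← sum_sameCycle_comp D.facePerm (fun x => delta (S.mat k) x) e,
      add_comm, ← Finset.sum_add_distrib, Finset.sum_eq_sum_iff_of_le fun x _ => hle' k x] at this
    exact hor (this x (by simpa using hx))
  have hww : ∀ x, D.facePerm.SameCycle e x → D.white (D.white x) = x := by
    intro x hx
    rcases S.eq_of_mem_cycle (π := D.white) (fun k _ _ => (S.isPerfectMatching k).eq_white)
      (fun k hk => h1 k hk x hx) ((sameCycle_apply _ x).trans (sameCycle_apply _ _)) with h | h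
    · exact h
    · exact absurd h (strand_ne_white S.strand_ne _)
  have hbb : ∀ x, D.facePerm.SameCycle e x → D.black (D.facePerm x) = D.white x := by
    intro x hx
    rcases S.eq_of_mem_cycle (π := D.black) (fun k _ _ => (S.isPerfectMatching k).eq_black)
      (fun k hk => h2 k hk x hx) ((sameCycle_apply _ (D.white x)).trans (sameCycle_apply _ _))
      with h | h
    · exact h
    · exact absurd h (strand_ne_black S.strand_ne _)
  have hall : ∀ y, D.facePerm.SameCycle e y ∨ D.facePerm.SameCycle e (D.white⁻¹ y) := by
    refine forall_of_closed (D := D) (fun x hx => ?_) (fun x hx => ?_)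
      (Or.inl (Equiv.Perm.SameCycle.refl _ e))
    · rcases hx with hx | hx
      · right; rwa [perm_inv_apply]
      · left
        have := hww _ hx
        rw [perm_apply_inv] at this
        rwa [this]
    · rcases hx with hx | hx
      · right
        have hy : D.facePerm.SameCycle e (D.facePerm⁻¹ x) :=
          hx.trans (sameCycle_inv_apply _ x)
        have := hbb _ hy
        rw [perm_apply_inv] at this
        rwa [this, perm_inv_apply]
      · left
        have := Equiv.Perm.sameCycle_apply_right.2 hx
        rwa [facePerm_apply, perm_apply_inv] at this
  obtain ⟨y, hy1, hy2⟩ := exists_corner_notMem (S.isPerfectMatching 0)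
  rcases hall y with hy | hy
  · exact (h1 0 (Nat.zero_le _) y hy).elim hy1 hy2
  · have h3 := hww _ hy
    have h4 := h1 0 (Nat.zero_le _) _ hy
    rw [perm_apply_inv] at h3 h4
    rw [← h3] at h4
    exact h4.elim hy2 hy1

/-- The deficit of each face is positive by `sum_face_lt`, and Euler's relation fixes the total of
the deficits. -/
theorem sum_face_eq (e : E) :
    ∑ x with D.facePerm.SameCycle e x, (delta (S.mat 0) x + delta (S.mat 0) (D.white x)) =
      ∑ x with D.facePerm.SameCycle e x, (2 : ℝ) - 2 := by
  have hcast : ∀ c : D.Face, ∑ x with D.facePerm.SameCycle c.out x,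
      (delta (S.mat 0) x + delta (S.mat 0) (D.white x)) = ((2 * ∑ x with
        D.facePerm.SameCycle c.out x, ((if x ∈ S.mat 0 then 1 else 0) +
        (if D.white x ∈ S.mat 0 then 1 else 0)) : ℕ) : ℝ) := by
    intro c
    push_cast
    rw [Finset.mul_sum]
    refine Finset.sum_congr rfl fun x _ => ?_
    simp only [delta]
    split_ifs <;> norm_num
  -- Both sums are even integers, so a strict inequality leaves a gap of at least two.
  have hle : ∀ c ∈ (Finset.univ : Finset D.Face), ∑ x with D.facePerm.SameCycle c.out x,
      (delta (S.mat 0) x + delta (S.mat 0) (D.white x)) ≤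
      ∑ x with D.facePerm.SameCycle c.out x, (2 : ℝ) - 2 := by
    intro c _
    have := S.sum_face_lt c.out
    rw [hcast] at this ⊢
    rw [Finset.sum_const, nsmul_eq_mul] at this ⊢
    generalize (∑ x with D.facePerm.SameCycle c.out x, ((if x ∈ S.mat 0 then 1 else 0) +
        (if D.white x ∈ S.mat 0 then 1 else 0)) : ℕ) = a at this ⊢
    generalize Finset.card _ = b at this ⊢
    have h1 : 2 * a < b * 2 := by exact_mod_cast this
    have h2 : a + 1 ≤ b := by omega
    have h3 : (a : ℝ) + 1 ≤ b := by exact_mod_cast h2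
    push_cast
    linarith
  have hsum : ∑ c : D.Face, ∑ x with D.facePerm.SameCycle c.out x,
      (delta (S.mat 0) x + delta (S.mat 0) (D.white x)) =
      ∑ c : D.Face, (∑ x with D.facePerm.SameCycle c.out x, (2 : ℝ) - 2) := by
    rw [Finset.sum_sub_distrib, sum_cycles D.facePerm, sum_cycles D.facePerm (fun _ => (2 : ℝ)),
      Finset.sum_add_distrib, sum_comp_perm D.white (fun x => (delta (S.mat 0) x : ℝ))]
    have h1 := sum_mul_delta (S.mat 0) (fun _ => (1 : ℝ))
    have h2 := card_edges (S.isPerfectMatching 0)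
    simp only [one_mul, Finset.sum_const, nsmul_eq_mul, mul_one, Finset.card_univ] at h1 ⊢
    rw [h1, ← h2]
    push_cast
    ring
  have h := (Finset.sum_eq_sum_iff_of_le hle).1 hsum (D.leftFace e) (Finset.mem_univ _)
  have hout : ∀ x, D.facePerm.SameCycle (D.leftFace e).out x ↔ D.facePerm.SameCycle e x := by
    intro x
    have : D.facePerm.SameCycle (D.leftFace e).out e := cycles_mk_eq_iff.1 (Quotient.out_eq _)
    exact ⟨fun h => this.symm.trans h, fun h => this.trans h⟩
  simpa only [hout] using h

theorem delta_mem (k : ℕ) (hk : k ≤ Fintype.card (Cycles D.zigzagPerm)) :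
    delta (S.mat k) ∈ D.chargeAssignments := by
  refine ⟨sum_delta_white (S.isPerfectMatching k), sum_delta_black (S.isPerfectMatching k),
    fun e => ?_⟩
  have h := (S.sum_face_mat k hk e).trans (S.sum_face_eq e)
  have : ∀ x, (1 - delta (S.mat k) x) + (1 - delta (S.mat k) (D.white x)) =
      2 - (delta (S.mat k) x + delta (S.mat k) (D.white x)) := fun x => by ring
  rw [Finset.sum_congr rfl fun x _ => this x, Finset.sum_sub_distrib, h]
  ring

end SweepOrder

end SweepMatchings

end Dimer

/-! ### Triple products of matchings as areas -/

namespace Dimer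

section Triples

open Classical

variable {E : Type*} [Fintype E] {D : Dimer E} {m : D.Marking}

/-- The sum of the products of the signs of the edges in three matchings. -/
noncomputable def triple (A B C : Finset E) : ℝ :=
  ∑ e, (delta A e - 1) * (delta B e - 1) * (delta C e - 1)

theorem triple_swap_left (A B C : Finset E) : triple A B C = triple B A C :=
  Finset.sum_congr rfl fun e _ => by ring

theorem triple_swap_right (A B C : Finset E) : triple A B C = triple A C B :=
  Finset.sum_congr rfl fun e _ => by ring

/-- The contribution of a node: it is positive if the three matchings have distinct edges there. -/
theorem sum_node {π : Equiv.Perm E} {A B C : Finset E}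
    (hA : ∀ e, ∃! x, x ∈ A ∧ π.SameCycle e x) (hB : ∀ e, ∃! x, x ∈ B ∧ π.SameCycle e x)
    (hC : ∀ e, ∃! x, x ∈ C ∧ π.SameCycle e x) {e a b c : E} (ha : a ∈ A ∧ π.SameCycle e a)
    (hb : b ∈ B ∧ π.SameCycle e b) (hc : c ∈ C ∧ π.SameCycle e c) :
    ∑ x with π.SameCycle e x, ((delta A x - 1) * (delta B x - 1) * (delta C x - 1) + 1) =
      2 + if a ≠ b ∧ b ≠ c ∧ a ≠ c then (4 : ℝ) else 0 := by
  have hδ : ∀ {M : Finset E} {y : E}, (∀ e, ∃! x, x ∈ M ∧ π.SameCycle e x) →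
      (y ∈ M ∧ π.SameCycle e y) → ∀ x, π.SameCycle e x →
      (delta M x : ℝ) = if x = y then 2 else 0 := by
    intro M y hM hy x hx
    have : x ∈ M ↔ x = y := ⟨fun h => (hM e).unique ⟨h, hx⟩ hy, fun h => h ▸ hy.1⟩
    simp only [delta, this]
  have hsum : ∀ y, π.SameCycle e y →
      ∑ x with π.SameCycle e x, (if x = y then (1 : ℝ) else 0) = 1 := by
    intro y hy
    rw [Finset.sum_ite_eq', if_pos (by simpa using hy)]
  set p : ℝ := if a = b then 1 else 0 with hp
  set q : ℝ := if b = c then 1 else 0 with hq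
  set r : ℝ := if a = c then 1 else 0 with hr
  have hterm : ∀ x ∈ Finset.filter (fun x => π.SameCycle e x) Finset.univ,
      (delta A x - 1) * (delta B x - 1) * (delta C x - 1) + 1 =
      (2 - 4 * p - 4 * r + 8 * p * r) * (if x = a then (1 : ℝ) else 0) +
      (2 - 4 * q) * (if x = b then (1 : ℝ) else 0) + 2 * (if x = c then (1 : ℝ) else 0) := by
    intro x hx
    have hx : π.SameCycle e x := by simpa using hx
    rw [hδ hA ha x hx, hδ hB hb x hx, hδ hC hc x hx]
    by_cases h1 : x = a
    · subst h1
      by_cases h2 : x = b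
      · subst h2
        by_cases h3 : x = c
        · subst h3; norm_num [hp, hq, hr]
        · norm_num [hp, hq, hr, h3]
      · by_cases h3 : x = c
        · subst h3; norm_num [hp, hq, hr, h2]
        · norm_num [hp, hq, hr, h2, h3]
    · by_cases h2 : x = b
      · subst h2
        by_cases h3 : x = c
        · subst h3; norm_num [hq, h1]
        · norm_num [hq, h1, h3]
      · by_cases h3 : x = c
        · subst h3; norm_num [h1, h2]
        · norm_num [h1, h2, h3]
  rw [Finset.sum_congr rfl hterm, Finset.sum_add_distrib, Finset.sum_add_distrib,
    ← Finset.mul_sum, ← Finset.mul_sum, ← Finset.mul_sum, hsum a ha.2, hsum b hb.2, hsum c hc.2]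
  by_cases h1 : a = b
  · subst h1
    by_cases h2 : a = c
    · norm_num [hp, hq, hr, h2]
    · norm_num [hp, hq, hr, h2]
  · by_cases h2 : b = c
    · subst h2; norm_num [hp, hq, hr, h1]
    · by_cases h3 : a = c
      · norm_num [hp, hq, hr, h1, h2, h3, Ne.symm h2]
      · norm_num [hp, hq, hr, h1, h2, h3, Ne.symm h2]

/-- The constants agree because the number of edges is `2 |A| + F` and there are `|A|` nodes of the
color. -/
theorem triple_add_eq {π : Equiv.Perm E} {A B C : Finset E} (hA : D.IsPerfectMatching A)
    (hcard : A.card = Fintype.card (Cycles π)) :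
    triple A B C + Fintype.card D.Face = ∑ v : Cycles π, (∑ x with π.SameCycle v.out x,
      ((delta A x - 1) * (delta B x - 1) * (delta C x - 1) + 1) - 2) := by
  rw [Finset.sum_sub_distrib, sum_cycles π, Finset.sum_add_distrib]
  have h := card_edges hA
  simp only [Finset.sum_const, nsmul_eq_mul, mul_one, Finset.card_univ, ← hcard, ← h]
  push_cast
  rw [triple]
  ring

theorem node_nonneg {π : Equiv.Perm E} {A B C : Finset E}
    (hA : ∀ e, ∃! x, x ∈ A ∧ π.SameCycle e x) (hB : ∀ e, ∃! x, x ∈ B ∧ π.SameCycle e x)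
    (hC : ∀ e, ∃! x, x ∈ C ∧ π.SameCycle e x) (e : E) :
    0 ≤ ∑ x with π.SameCycle e x,
      ((delta A x - 1) * (delta B x - 1) * (delta C x - 1) + 1) - 2 := by
  obtain ⟨a, ha, -⟩ := hA e
  obtain ⟨b, hb, -⟩ := hB e
  obtain ⟨c, hc, -⟩ := hC e
  rw [sum_node hA hB hC ha hb hc]
  split_ifs <;> norm_num

theorem triple_add_pos {π : Equiv.Perm E} {A B C : Finset E} (hM : D.IsPerfectMatching A)
    (hcard : A.card = Fintype.card (Cycles π))
    (hA : ∀ e, ∃! x, x ∈ A ∧ π.SameCycle e x) (hB : ∀ e, ∃! x, x ∈ B ∧ π.SameCycle e x)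
    (hC : ∀ e, ∃! x, x ∈ C ∧ π.SameCycle e x) {a b c : E} (ha : a ∈ A) (hb : b ∈ B) (hc : c ∈ C)
    (hab : π.SameCycle a b) (hac : π.SameCycle a c) (h1 : a ≠ b) (h2 : b ≠ c) (h3 : a ≠ c) :
    0 < triple A B C + Fintype.card D.Face := by
  rw [triple_add_eq hM hcard]
  refine Finset.sum_pos' (fun v _ => node_nonneg hA hB hC _)
    ⟨Quotient.mk _ a, Finset.mem_univ _, ?_⟩
  have h : π.SameCycle (Quotient.mk _ a : Cycles π).out a :=
    cycles_mk_eq_iff.1 (Quotient.out_eq _)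
  rw [sum_node hA hB hC ⟨ha, h⟩ ⟨hb, h.trans hab⟩ ⟨hc, h.trans hac⟩, if_pos ⟨h1, h2, h3⟩]
  norm_num

theorem triple_add_nonneg {A B C : Finset E} (hA : D.IsPerfectMatching A)
    (hB : D.IsPerfectMatching B) (hC : D.IsPerfectMatching C) :
    0 ≤ triple A B C + Fintype.card D.Face := by
  rw [triple_add_eq hA (card_matching_white hA)]
  exact Finset.sum_nonneg fun v _ => node_nonneg hA.1 hB.1 hC.1 _

/-- The winding of a zigzag path. -/
noncomputable def strandWinding (m : D.Marking) (z : Cycles D.zigzagPerm) : ℤ × ℤ :=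
  D.winding m z.out

theorem strandWinding_strand (e : E) : strandWinding m (D.strand e) = D.winding m e :=
  winding_eq (Quotient.out_eq _)

namespace SweepOrder

variable (S : SweepOrder D)

/-- The lattice points of the matchings of the sweep. -/
noncomputable def point (m : D.Marking) (k : ℕ) : ℤ × ℤ := D.latticePoint m (S.mat k)

theorem point_succ {k : ℕ} (hk : k < Fintype.card (Cycles D.zigzagPerm)) :
    S.point m (k + 1) = S.point m k + strandWinding m (S.rank.symm ⟨k, hk⟩) := by
  obtain ⟨e, he⟩ := Quotient.exists_rep (S.rank.symm ⟨k, hk⟩)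
  have he : S.rank.symm ⟨k, hk⟩ = D.strand e := he.symm
  have h := S.delta_mat_succ hk
  rw [he] at h ⊢
  have h1 := latticePoint_sub (m := m) (ε := 1) (by rw [h, mul_one])
  apply toPlane_injective
  rw [one_smul, sub_eq_iff_eq_add] at h1
  rw [strandWinding_strand, point, point, h1]
  simp only [toPlane, Prod.fst_add, Prod.snd_add, Int.cast_add, Prod.mk_add_mk, add_comm]

/-- Between the cuts `i` and `k` the path `l` has been passed, so on its edges the matchings can
differ only in the direction of `zeta`. The product of the signs is `-1` where they differ and `1`
elsewhere. -/
theorem zeta_mul {i l k : ℕ} (hil : i ≤ l) (hlk : l < k)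
    (hk : k ≤ Fintype.card (Cycles D.zigzagPerm)) (e : E) :
    D.zeta (S.rank.symm ⟨l, by omega⟩) e * (delta (S.mat i) e - 1) * (delta (S.mat k) e - 1) =
      D.zeta (S.rank.symm ⟨l, by omega⟩) e - (D.chi (S.rank.symm ⟨l, by omega⟩) e +
        D.chi (S.rank.symm ⟨l, by omega⟩) (D.white⁻¹ e)) *
        (delta (S.mat k) e - delta (S.mat i) e) := by
  have h1 : (D.strand e = S.rank.symm ⟨l, by omega⟩) ↔ S.lower e = l := by
    rw [Equiv.eq_symm_apply, Fin.ext_iff]; rfl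
  have h2 : (D.strand (D.white⁻¹ e) = S.rank.symm ⟨l, by omega⟩) ↔ S.upper e = l := by
    rw [Equiv.eq_symm_apply, Fin.ext_iff]; rfl
  have hne := S.lower_ne_upper e
  simp only [zeta, chi, h1, h2]
  by_cases ha : S.upper e = l
  · have hb : S.lower e ≠ l := fun h => hne (h.trans ha.symm)
    have hmem : e ∉ S.mat i ∨ e ∈ S.mat k := by
      rw [mem_mat, mem_mat]
      by_cases h : S.lower e < S.upper e
      · rw [if_pos h, if_pos h]; right; right; omega
      · rw [if_neg h, if_neg h]; left; omega
    simp only [ha, hb, if_true, if_false, delta]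
    rcases hmem with h | h <;> simp only [h, if_true, if_false] <;> split_ifs <;> norm_num
  · by_cases hb : S.lower e = l
    · have hmem : e ∈ S.mat i ∨ e ∉ S.mat k := by
        rw [mem_mat, mem_mat]
        by_cases h : S.lower e < S.upper e
        · rw [if_pos h, if_pos h]; left; left; omega
        · rw [if_neg h, if_neg h]; right; omega
      simp only [ha, hb, if_true, if_false, delta]
      rcases hmem with h | h <;> simp only [h, if_true, if_false] <;> split_ifs <;> norm_num
    · simp [ha, hb]

theorem wedge_count (m : D.Marking) {A B : Finset E} (hA : D.IsPerfectMatching A)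
    (hB : D.IsPerfectMatching B) (z : Cycles D.zigzagPerm) :
    ∑ e, (D.chi z e + D.chi z (D.white⁻¹ e)) * (delta B e - delta A e) =
      2 * wedge (D.latticePoint m B - D.latticePoint m A) (strandWinding m z) := by
  obtain ⟨e₀, he⟩ := Quotient.exists_rep z
  have he : z = D.strand e₀ := he.symm
  subst he
  obtain ⟨c, hc⟩ := m.exists_count e₀
  have h1 := hc A hA
  have h2 := hc B hB
  rw [← sum_chi_reindex] at h1 h2
  simp only [mul_sub, Finset.sum_sub_distrib]
  rw [h1, h2, strandWinding_strand]
  simp only [wedge, Prod.fst_sub, Prod.snd_sub]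
  push_cast
  ring

/-- The cubic form of the sweep is given by the areas of lattice triangles. -/
theorem triple_mat {i j k : ℕ} (hij : i ≤ j) (hjk : j ≤ k)
    (hk : k ≤ Fintype.card (Cycles D.zigzagPerm)) :
    triple (S.mat i) (S.mat j) (S.mat k) + Fintype.card D.Face =
      4 * wedge (S.point m j - S.point m i) (S.point m k - S.point m i) := by
  induction j, hij using Nat.le_induction with
  | base =>
    -- Signs square to one, and the remaining sum is `2 |M| - |E| = -F`, so a repeated matching
    -- gives zero.
    have h1 : triple (S.mat i) (S.mat i) (S.mat k) = ∑ e, (delta (S.mat k) e - 1) := by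
      refine Finset.sum_congr rfl fun e _ => ?_
      have : (delta (S.mat i) e - 1) * (delta (S.mat i) e - 1) = (1 : ℝ) := by
        simp only [delta]; split_ifs <;> norm_num
      rw [this, one_mul]
    have h2 := sum_mul_delta (S.mat k) (fun _ => (1 : ℝ))
    have h3 := card_edges (S.isPerfectMatching k)
    simp only [one_mul, Finset.sum_const, nsmul_eq_mul, mul_one] at h2
    rw [h1, Finset.sum_sub_distrib, h2, Finset.sum_const, Finset.card_univ, nsmul_eq_mul, mul_one,
      ← h3, sub_self]
    simp [wedge]
  | succ j hij ih =>
    have ih := ih (by omega)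
    have hj : j < Fintype.card (Cycles D.zigzagPerm) := by omega
    have hd := S.delta_mat_succ hj
    set z := S.rank.symm ⟨j, hj⟩ with hz
    -- The increment is linear in `zeta`. Of its two parts by `zeta_mul`, the first sums to zero and
    -- the second counts edges on the path, which is a wedge with the winding.
    have h1 : triple (S.mat i) (S.mat (j + 1)) (S.mat k) = triple (S.mat i) (S.mat j) (S.mat k) +
        2 * ∑ e, D.zeta z e * (delta (S.mat i) e - 1) * (delta (S.mat k) e - 1) := by
      rw [triple, triple, Finset.mul_sum, ← Finset.sum_add_distrib]
      refine Finset.sum_congr rfl fun e _ => ?_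
      have := congrFun hd e
      simp only [Pi.sub_apply, Pi.smul_apply, smul_eq_mul] at this
      have h' : delta (S.mat (j + 1)) e = delta (S.mat j) e + 2 * D.zeta z e := by linarith
      rw [h']
      ring
    have h2 : ∑ e, D.zeta z e = 0 := by
      have := sum_zeta_reindex z (fun _ => (1 : ℝ))
      simpa using this
    rw [h1, Finset.sum_congr rfl fun e _ => S.zeta_mul hij hjk hk e, Finset.sum_sub_distrib,
      ← hz, h2, wedge_count m (S.isPerfectMatching i) (S.isPerfectMatching k), S.point_succ hj,
      ← hz]
    change _ = 4 * (wedge (S.point m j + strandWinding m z - S.point m i) _ : ℝ)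
    have e1 : triple (S.mat i) (S.mat j) (S.mat k) = 4 * (wedge (S.point m j - S.point m i)
        (S.point m k - S.point m i) : ℝ) - Fintype.card D.Face := by linarith
    rw [e1]
    change _ + 2 * (0 - 2 * (wedge (S.point m k - S.point m i) _ : ℝ)) + _ = _
    simp only [wedge, Prod.fst_sub, Prod.snd_sub, Prod.fst_add, Prod.snd_add]
    push_cast
    ring

/-- Since the contributions of the nodes are nonnegative, the wedge in `triple_mat` is too: in the
order of the sweep it is twice an honest area. Both sides are symmetric, which settles the other
orders. -/
theorem triple_mat_eq {i j k : ℕ} (hi : i ≤ Fintype.card (Cycles D.zigzagPerm))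
    (hj : j ≤ Fintype.card (Cycles D.zigzagPerm)) (hk : k ≤ Fintype.card (Cycles D.zigzagPerm)) :
    triple (S.mat i) (S.mat j) (S.mat k) + Fintype.card D.Face =
      8 * triangleArea (S.point m i) (S.point m j) (S.point m k) := by
  have key : ∀ {i j k : ℕ}, i ≤ j → j ≤ k → k ≤ Fintype.card (Cycles D.zigzagPerm) →
      triple (S.mat i) (S.mat j) (S.mat k) + Fintype.card D.Face =
      8 * triangleArea (S.point m i) (S.point m j) (S.point m k) := by
    intro i j k hij hjk hk
    have h1 := S.triple_mat (m := m) hij hjk hk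
    have h2 := triple_add_nonneg (S.isPerfectMatching i) (S.isPerfectMatching j)
      (S.isPerfectMatching k)
    rw [h1] at h2
    rw [h1, triangleArea, abs_of_nonneg (by linarith)]
    ring
  have sl : ∀ p q r : ℤ × ℤ, triangleArea p q r = triangleArea q p r := fun p q r => by
    rw [triangleArea_eq, triangleArea_eq, planeArea_swap_left]
  have sr : ∀ p q r : ℤ × ℤ, triangleArea p q r = triangleArea p r q := fun p q r => by
    rw [triangleArea_eq, triangleArea_eq, planeArea_swap_right]
  rcases le_total i j with h1 | h1 <;> rcases le_total j k with h2 | h2 <;>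
    rcases le_total i k with h3 | h3
  · exact key h1 h2 hk
  · exact key h1 h2 hk
  · rw [triple_swap_right, sr]; exact key h3 h2 hj
  · rw [triple_swap_right, sr, triple_swap_left, sl]; exact key h3 h1 hj
  · rw [triple_swap_left, sl]; exact key h1 h3 hk
  · rw [triple_swap_left, sl, triple_swap_right, sr]; exact key h2 h3 hi
  · rw [triple_swap_left, sl, triple_swap_right, sr, triple_swap_left, sl]
    exact key h2 h1 hi
  · rw [triple_swap_left, sl, triple_swap_right, sr, triple_swap_left, sl]
    exact key h2 h1 hi

/-- The lattice points of the sweep are not collinear. -/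
theorem exists_noncollinear (m : D.Marking) : ∃ i j k : ℕ,
    i < Fintype.card (Cycles D.zigzagPerm) ∧ j < Fintype.card (Cycles D.zigzagPerm) ∧
    k < Fintype.card (Cycles D.zigzagPerm) ∧
    0 < triangleArea (S.point m i) (S.point m j) (S.point m k) := by
  -- The node of a corner that `mat 0` misses has three distinct edges, each in a matching of the
  -- sweep; its contribution is positive.
  obtain ⟨e, he1, he2⟩ := exists_corner_notMem (S.isPerfectMatching 0)
  obtain ⟨y, ⟨hy, hey⟩, -⟩ := (S.isPerfectMatching 0).1 e
  obtain ⟨j, hj, hje⟩ := S.exists_mem_mat e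
  obtain ⟨k, hk, hke⟩ := S.exists_mem_mat (D.white e)
  have h0 : 0 < Fintype.card (Cycles D.zigzagPerm) := by omega
  refine ⟨0, j, k, h0, hj, hk, ?_⟩
  have := triple_add_pos (π := D.white) (S.isPerfectMatching 0)
    (card_matching_white (S.isPerfectMatching 0)) (S.isPerfectMatching 0).1
    (S.isPerfectMatching j).1 (S.isPerfectMatching k).1 hy hje hke hey.symm
    (hey.symm.trans (sameCycle_apply _ _)) (fun h => he1 (h ▸ hy))
    (strand_ne_white S.strand_ne e).symm (fun h => he2 (h ▸ hy))
  rw [S.triple_mat_eq (m := m) h0.le hj.le hk.le] at this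
  linarith

/-- Different matchings of the sweep have different lattice points. -/
theorem mat_eq_of_point_eq {i l : ℕ} (hi : i ≤ Fintype.card (Cycles D.zigzagPerm))
    (hl : l ≤ Fintype.card (Cycles D.zigzagPerm)) (h : S.point m i = S.point m l) :
    S.mat i = S.mat l := by
  have hzero : ∀ k ≤ Fintype.card (Cycles D.zigzagPerm),
      triple (S.mat i) (S.mat l) (S.mat k) + Fintype.card D.Face = 0 := by
    intro k hk
    rw [S.triple_mat_eq (m := m) hi hl hk, h]
    simp [triangleArea, wedge]
  -- No third matching may use a third edge at a node. Where the two matchings differ, the node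
  -- therefore has only their two edges, and the difference extends to all of it.
  have node : ∀ π : Equiv.Perm E, (∀ k, ∀ e, ∃! x, x ∈ S.mat k ∧ π.SameCycle e x) →
      (S.mat i).card = Fintype.card (Cycles π) → (∀ x, π x ≠ x) → ∀ x,
      (x ∈ S.mat i ∧ x ∉ S.mat l ∨ x ∈ S.mat l ∧ x ∉ S.mat i) →
      (π x ∈ S.mat i ∧ π x ∉ S.mat l ∨ π x ∈ S.mat l ∧ π x ∉ S.mat i) := by
    intro π hπ hcard hfix x hx
    obtain ⟨a, ⟨ha, hxa⟩, hau⟩ := hπ i x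
    obtain ⟨b, ⟨hb, hxb⟩, hbu⟩ := hπ l x
    have hab : a ≠ b := by
      rintro rfl
      rcases hx with hx | hx
      · have := hau x ⟨hx.1, Equiv.Perm.SameCycle.refl _ _⟩
        exact hx.2 (this ▸ hb)
      · have := hbu x ⟨hx.1, Equiv.Perm.SameCycle.refl _ _⟩
        exact hx.2 (this ▸ ha)
    have hy : ∀ y, π.SameCycle x y → y = a ∨ y = b := by
      intro y hy
      obtain ⟨k, hk, hyk⟩ := S.exists_mem_mat y
      by_contra! hn
      exact (triple_add_pos (S.isPerfectMatching i) hcard (hπ i) (hπ l) (hπ k) ha hb hyk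
        (hxa.symm.trans hxb) (hxa.symm.trans hy) hab hn.2.symm hn.1.symm).ne' (hzero k hk.le)
    have hbi : b ∉ S.mat i := fun h => hab (hau b ⟨h, hxb⟩).symm
    have hal : a ∉ S.mat l := fun h => hab (hbu a ⟨h, hxa⟩)
    rcases hy (π x) (sameCycle_apply _ _) with h | h
    · rw [h]; exact Or.inl ⟨ha, hal⟩
    · rw [h]; exact Or.inr ⟨hb, hbi⟩
  by_contra hne
  obtain ⟨x, hx⟩ : ∃ x, (x ∈ S.mat i ∧ x ∉ S.mat l ∨ x ∈ S.mat l ∧ x ∉ S.mat i) := by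
    by_contra! hn
    exact hne (Finset.ext fun x => ⟨(hn x).1, (hn x).2⟩)
  have hall := forall_of_closed (D := D)
    (node D.white (fun k => (S.isPerfectMatching k).1)
      (card_matching_white (S.isPerfectMatching i)) (strand_ne_white S.strand_ne))
    (node D.black (fun k => (S.isPerfectMatching k).2)
      (card_matching_black (S.isPerfectMatching i)) (strand_ne_black S.strand_ne)) hx
  obtain ⟨y, hy1, hy2⟩ := exists_corner_notMem (S.isPerfectMatching i)
  have h1 := hall y
  have h2 := hall (D.white y)
  have h3 : y = D.white y := (S.isPerfectMatching l).eq_white (by tauto) (by tauto)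
    (sameCycle_apply _ _)
  exact strand_ne_white S.strand_ne y h3.symm

end SweepOrder

end Triples

end Dimer

/-! ### The dimension of the space of charge assignments -/

namespace Dimer

section Dimension

open Classical

variable {E : Type*} [Fintype E] {D : Dimer E} {m : D.Marking}

variable (D) in
/-- The matrix of the linear equations for the charges. -/
noncomputable def chargeMatrix :
    Matrix (Cycles D.white ⊕ (Cycles D.black ⊕ D.Face)) E ℝ :=
  Matrix.of fun i e => match i with
    | Sum.inl v => if (Quotient.mk _ e : Cycles D.white) = v then 1 else 0
    | Sum.inr (Sum.inl v) => if (Quotient.mk _ e : Cycles D.black) = v then 1 else 0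
    | Sum.inr (Sum.inr f) => (if D.leftFace e = f then 1 else 0) +
        if D.rightFace e = f then 1 else 0

theorem sum_ite_cycle (π : Equiv.Perm E) (g : E → ℝ) (e : E) :
    ∑ x, (if (Quotient.mk _ x : Cycles π) = Quotient.mk _ e then (1 : ℝ) else 0) * g x =
      ∑ x with π.SameCycle e x, g x := by
  rw [Finset.sum_filter]
  refine Finset.sum_congr rfl fun x _ => ?_
  have : (Quotient.mk _ x : Cycles π) = Quotient.mk _ e ↔ π.SameCycle e x := by
    rw [eq_comm]; exact cycles_mk_eq_iff
  simp only [this, ite_mul, one_mul, zero_mul]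

theorem mem_ker_chargeMatrix {R : E → ℝ} :
    R ∈ LinearMap.ker D.chargeMatrix.mulVecLin ↔
      (∀ e, ∑ x with D.white.SameCycle e x, R x = 0) ∧
      (∀ e, ∑ x with D.black.SameCycle e x, R x = 0) ∧
      ∀ e, ∑ x with D.facePerm.SameCycle e x, (R x + R (D.white x)) = 0 := by
  have hw : ∀ e, D.chargeMatrix.mulVec R (Sum.inl (Quotient.mk _ e)) =
      ∑ x with D.white.SameCycle e x, R x := fun e => sum_ite_cycle D.white R e
  have hb : ∀ e, D.chargeMatrix.mulVec R (Sum.inr (Sum.inl (Quotient.mk _ e))) =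
      ∑ x with D.black.SameCycle e x, R x := fun e => sum_ite_cycle D.black R e
  have hf : ∀ e, D.chargeMatrix.mulVec R (Sum.inr (Sum.inr (D.leftFace e))) =
      ∑ x with D.facePerm.SameCycle e x, (R x + R (D.white x)) := by
    intro e
    have h1 := sum_ite_cycle D.facePerm R e
    have h2 := sum_ite_cycle D.facePerm (fun x => R (D.white x)) e
    have h3 : ∑ x, (if D.rightFace x = D.leftFace e then (1 : ℝ) else 0) * R x =
        ∑ x, (if D.leftFace x = D.leftFace e then (1 : ℝ) else 0) * R (D.white x) := by
      rw [← sum_comp_perm D.white]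
      simp only [rightFace_white]
    rw [Finset.sum_add_distrib, ← h1, ← h2]
    change ∑ x, ((if D.leftFace x = D.leftFace e then (1 : ℝ) else 0) +
      if D.rightFace x = D.leftFace e then 1 else 0) * R x = _
    simp only [add_mul, Finset.sum_add_distrib]
    rw [h3]
    rfl
  rw [LinearMap.mem_ker, Matrix.mulVecLin_apply]
  constructor
  · intro h
    refine ⟨fun e => ?_, fun e => ?_, fun e => ?_⟩
    · rw [← hw, h]; rfl
    · rw [← hb, h]; rfl
    · rw [← hf, h]; rfl
  · rintro ⟨h1, h2, h3⟩
    ext i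
    rcases i with v | v | f
    · obtain ⟨e, rfl⟩ := Quotient.exists_rep v
      rw [hw, h1]; rfl
    · obtain ⟨e, rfl⟩ := Quotient.exists_rep v
      rw [hb, h2]; rfl
    · obtain ⟨e, rfl⟩ := Quotient.exists_rep f
      exact (hf e).trans (h3 e)

theorem mem_chargeAssignments_iff {R₀ R : E → ℝ} (h₀ : R₀ ∈ D.chargeAssignments) :
    R ∈ D.chargeAssignments ↔ R - R₀ ∈ LinearMap.ker D.chargeMatrix.mulVecLin := by
  rw [mem_ker_chargeMatrix]
  obtain ⟨h1, h2, h3⟩ := h₀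
  have hf : ∀ e, ∑ x with D.facePerm.SameCycle e x, ((1 - R x) + (1 - R (D.white x))) = 2 -
      ∑ x with D.facePerm.SameCycle e x, ((R - R₀) x + (R - R₀) (D.white x)) := by
    intro e
    rw [← h3 e, ← Finset.sum_sub_distrib]
    refine Finset.sum_congr rfl fun x _ => ?_
    simp only [Pi.sub_apply]
    ring
  constructor
  · rintro ⟨g1, g2, g3⟩
    refine ⟨fun e => ?_, fun e => ?_, fun e => ?_⟩
    · simp only [Pi.sub_apply, Finset.sum_sub_distrib, g1 e, h1 e, sub_self]
    · simp only [Pi.sub_apply, Finset.sum_sub_distrib, g2 e, h2 e, sub_self]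
    · linarith [hf e, g3 e]
  · rintro ⟨g1, g2, g3⟩
    refine ⟨fun e => ?_, fun e => ?_, fun e => ?_⟩
    · have := g1 e
      simp only [Pi.sub_apply, Finset.sum_sub_distrib, h1 e] at this
      linarith
    · have := g2 e
      simp only [Pi.sub_apply, Finset.sum_sub_distrib, h2 e] at this
      linarith
    · rw [hf, g3, sub_zero]

theorem zeta_mem_ker (z : Cycles D.zigzagPerm) :
    D.zeta z ∈ LinearMap.ker D.chargeMatrix.mulVecLin :=
  mem_ker_chargeMatrix.2 ⟨sum_zeta_white z, sum_zeta_black z, sum_zeta_face z⟩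

/-- The combination of the windings with given coefficients. -/
noncomputable def windingMap (m : D.Marking) : (Cycles D.zigzagPerm → ℝ) →ₗ[ℝ] ℝ × ℝ :=
  Fintype.linearCombination ℝ fun z => toPlane (strandWinding m z)

theorem mem_ker_transpose {t : Cycles D.white ⊕ (Cycles D.black ⊕ D.Face) → ℝ} :
    t ∈ LinearMap.ker D.chargeMatrix.transpose.mulVecLin ↔
      ∀ e, t (Sum.inl (Quotient.mk _ e)) + (t (Sum.inr (Sum.inl (Quotient.mk _ e))) +
        (t (Sum.inr (Sum.inr (D.leftFace e))) + t (Sum.inr (Sum.inr (D.rightFace e))))) = 0 := by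
  have h : ∀ e, D.chargeMatrix.transpose.mulVec t e = t (Sum.inl (Quotient.mk _ e)) +
      (t (Sum.inr (Sum.inl (Quotient.mk _ e))) +
        (t (Sum.inr (Sum.inr (D.leftFace e))) + t (Sum.inr (Sum.inr (D.rightFace e))))) := by
    intro e
    simp [Matrix.mulVec, dotProduct, chargeMatrix, Fintype.sum_sum_type, add_mul,
      Finset.sum_add_distrib]
  rw [LinearMap.mem_ker, Matrix.mulVecLin_apply]
  constructor
  · intro h0 e
    rw [← h, h0]; rfl
  · intro h0
    ext e
    rw [h, h0]; rfl

/-- By Euler's relation there are as many equations as edges, so the solutions have the dimension of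
the relations between the equations. A relation assigns a number to each zigzag path; these numbers
are annihilated by the two coordinates of the winding, and they determine the relation up to one
dimension. -/
theorem finrank_ker_chargeMatrix (m : D.Marking)
    (hm : Function.Surjective (windingMap (D := D) m)) :
    Module.finrank ℝ (LinearMap.ker D.chargeMatrix.mulVecLin) + 1 ≤
      Fintype.card (Cycles D.zigzagPerm) := by
  have h1 := finrank_ker_add_card D.chargeMatrix
  rw [Fintype.card_sum, Fintype.card_sum] at h1
  have h2 : Fintype.card (Cycles D.white) + Fintype.card (Cycles D.black) +
    Fintype.card D.Face = Fintype.card E := D.euler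
  set K := LinearMap.ker D.chargeMatrix.transpose.mulVecLin with hK
  have h3 := LinearMap.finrank_range_add_finrank_ker (windingMap (D := D) m)
  rw [LinearMap.range_eq_top.2 hm, finrank_top, Module.finrank_fintype_fun_eq_card,
    Module.finrank_prod, Module.finrank_self] at h3
  let L : K →ₗ[ℝ] (Cycles D.zigzagPerm → ℝ) :=
    { toFun := fun t z => t.1 (Sum.inl (Quotient.mk _ z.out)) +
        t.1 (Sum.inr (Sum.inr (D.leftFace z.out)))
      map_add' := fun s t => by
        ext z
        simp only [Submodule.coe_add, Pi.add_apply]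
        ring
      map_smul' := fun c t => by
        ext z
        simp only [Submodule.coe_smul, Pi.smul_apply, smul_eq_mul, RingHom.id_apply]
        ring }
  -- the sum over the corner of a zigzag path at a white node is the same along the path
  have hL : ∀ (t : K) (x : E), L t (D.strand x) = t.1 (Sum.inl (Quotient.mk _ x)) +
      t.1 (Sum.inr (Sum.inr (D.leftFace x))) := by
    intro t x
    have ht := mem_ker_transpose.1 t.2
    refine forall_strand (P := fun y => t.1 (Sum.inl (Quotient.mk _ (D.strand x).out)) +
      t.1 (Sum.inr (Sum.inr (D.leftFace (D.strand x).out))) = t.1 (Sum.inl (Quotient.mk _ y)) +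
      t.1 (Sum.inr (Sum.inr (D.leftFace y)))) (fun y hy => ?_) rfl (Quotient.out_eq _)
    rw [hy]
    have e1 := ht (D.white y)
    have e2 := ht (D.zigzagPerm y)
    rw [rightFace_white, cycles_mk_apply D.white] at e1
    rw [zigzagPerm_apply, cycles_mk_inv_apply D.black] at e2
    have e3 : D.rightFace (D.black⁻¹ (D.white y)) = D.leftFace (D.white y) := by
      rw [rightFace, ← facePerm_inv_apply]
      exact cycles_mk_inv_apply D.facePerm _
    rw [e3] at e2
    rw [zigzagPerm_apply]
    linarith
  have h4 := LinearMap.finrank_range_add_finrank_ker L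
  -- Sum the corner values against a closed cochain: the part from the nodes telescopes around each
  -- node, and the part from the faces vanishes by closedness.
  have h5 : LinearMap.range L ≤ LinearMap.ker (windingMap (D := D) m) := by
    rintro _ ⟨t, rfl⟩
    rw [LinearMap.mem_ker]
    have hsum : ∀ h : E → ℝ, (∀ e, ∑ x with D.facePerm.SameCycle e x, (h x - h (D.white x)) = 0) →
        ∑ x, L t (D.strand x) * (h (D.white x) - h x) = 0 := by
      intro h hh
      have e1 : ∑ x, L t (D.strand x) * (h (D.white x) - h x) =
          ∑ x, t.1 (Sum.inl (Quotient.mk _ x)) * (h (D.white x) - h x) -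
          ∑ x, t.1 (Sum.inr (Sum.inr (D.leftFace x))) * (h x - h (D.white x)) := by
        rw [← Finset.sum_sub_distrib]
        refine Finset.sum_congr rfl fun x _ => ?_
        rw [hL]; ring
      have e2 : ∑ x, t.1 (Sum.inl (Quotient.mk _ x)) * (h (D.white x) - h x) = 0 := by
        simp only [mul_sub, Finset.sum_sub_distrib]
        rw [sub_eq_zero, ← sum_comp_perm D.white (fun x => t.1 (Sum.inl (Quotient.mk _ x)) * h x)]
        refine Finset.sum_congr rfl fun x _ => ?_
        rw [cycles_mk_apply D.white]
      have e3 : ∑ x, t.1 (Sum.inr (Sum.inr (D.leftFace x))) * (h x - h (D.white x)) = 0 := by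
        rw [← sum_cycles D.facePerm]
        refine Finset.sum_eq_zero fun f _ => ?_
        have : ∀ x ∈ Finset.filter (fun x => D.facePerm.SameCycle f.out x) Finset.univ,
            t.1 (Sum.inr (Sum.inr (D.leftFace x))) * (h x - h (D.white x)) =
            t.1 (Sum.inr (Sum.inr f)) * (h x - h (D.white x)) := by
          intro x hx
          have hx : D.facePerm.SameCycle f.out x := by simpa using hx
          have : D.leftFace x = f := by
            rw [← leftFace_eq_iff] at hx
            rw [← hx]
            exact Quotient.out_eq _
          rw [this]
        rw [Finset.sum_congr rfl this, ← Finset.mul_sum, hh, mul_zero]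
      rw [e1, e2, e3, sub_zero]
    have hz : ∀ h : E → ℝ, ∑ x, L t (D.strand x) * (h (D.white x) - h x) =
        ∑ z, L t z * ∑ x, D.chi z x * (h (D.white x) - h x) := by
      intro h
      simp only [Finset.mul_sum]
      rw [Finset.sum_comm]
      refine Finset.sum_congr rfl fun x _ => ?_
      simp only [chi, ite_mul, one_mul, zero_mul, mul_ite, mul_zero, Finset.sum_ite_eq,
        Finset.mem_univ, if_true]
    have hw : ∀ z, toPlane (strandWinding m z) =
        (∑ x, D.chi z x * ((m.crossing (D.white x)).1 - (m.crossing x).1 : ℝ),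
          ∑ x, D.chi z x * ((m.crossing (D.white x)).2 - (m.crossing x).2 : ℝ)) := by
      intro z
      obtain ⟨e, he⟩ := Quotient.exists_rep z
      have he : z = D.strand e := he.symm
      subst he
      obtain ⟨g1, g2⟩ := sum_chi_winding m e
      rw [strandWinding_strand, toPlane, g1, g2]
    have hm1 := hsum (fun e => (m.crossing e).1) (fun e => by
      have := congrArg (fun p : ℤ × ℤ => (p.1 : ℝ)) (m.sum_face e)
      simpa [Prod.fst_sum] using this)
    have hm2 := hsum (fun e => (m.crossing e).2) (fun e => by
      have := congrArg (fun p : ℤ × ℤ => (p.2 : ℝ)) (m.sum_face e)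
      simpa [Prod.snd_sum] using this)
    have hm1 := (hz fun e => ((m.crossing e).1 : ℝ)).symm.trans hm1
    have hm2 := (hz fun e => ((m.crossing e).2 : ℝ)).symm.trans hm2
    rw [windingMap, Fintype.linearCombination_apply]
    ext
    · simp only [hw, Prod.fst_sum, Prod.smul_fst, smul_eq_mul, Prod.fst_zero]
      exact hm1
    · simp only [hw, Prod.snd_sum, Prod.smul_snd, smul_eq_mul, Prod.snd_zero]
      exact hm2
  have h6 := Submodule.finrank_mono h5
  have hv : (Sum.elim (fun _ => -1) (Sum.elim (fun _ => -1) (fun _ => 1)) :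
      Cycles D.white ⊕ (Cycles D.black ⊕ D.Face) → ℝ) ∈ K := by
    rw [hK, mem_ker_transpose]
    intro e
    norm_num
  -- If the corner values vanish, the face values do not change from face to face and determine the
  -- rest.
  have h7 : Module.finrank ℝ (LinearMap.ker L) ≤ 1 := by
    refine finrank_le_one_of_forall _ ⟨_, hv⟩ fun t ht => ?_
    have ht0 : ∀ x, t.1 (Sum.inl (Quotient.mk _ x)) +
        t.1 (Sum.inr (Sum.inr (D.leftFace x))) = 0 := fun x => by
      rw [← hL, LinearMap.mem_ker.1 ht]; rfl
    have hwi : ∀ x, t.1 (Sum.inr (Sum.inr (D.leftFace (D.white x)))) =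
        t.1 (Sum.inr (Sum.inr (D.leftFace x))) := by
      intro x
      have e1 := ht0 x
      have e2 := ht0 (D.white x)
      rw [cycles_mk_apply D.white] at e2
      linarith
    have hbi : ∀ x, t.1 (Sum.inr (Sum.inr (D.leftFace (D.black x)))) =
        t.1 (Sum.inr (Sum.inr (D.leftFace x))) := by
      intro x
      have e1 := hwi (D.white⁻¹ x)
      rw [perm_apply_inv] at e1
      rw [e1]
      have : D.leftFace (D.black x) = D.leftFace (D.white⁻¹ x) := by
        have := cycles_mk_apply D.facePerm (D.white⁻¹ x)
        rwa [facePerm_apply, perm_apply_inv] at this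
      rw [this]
    obtain ⟨e₀⟩ := D.nonempty
    have hc := fun x => D.eq_of_invariant
      (fun x => t.1 (Sum.inr (Sum.inr (D.leftFace x)))) hwi hbi x e₀
    refine ⟨t.1 (Sum.inr (Sum.inr (D.leftFace e₀))), Subtype.ext (funext fun i => ?_)⟩
    simp only [Submodule.coe_smul, Pi.smul_apply, smul_eq_mul]
    rcases i with v | v | f
    · obtain ⟨x, rfl⟩ := Quotient.exists_rep v
      simp only [Sum.elim_inl]
      linarith [ht0 x, hc x]
    · obtain ⟨x, rfl⟩ := Quotient.exists_rep v
      simp only [Sum.elim_inl, Sum.elim_inr]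
      have e1 := mem_ker_transpose.1 t.2 x
      have e2 : t.1 (Sum.inr (Sum.inr (D.rightFace x))) =
          t.1 (Sum.inr (Sum.inr (D.leftFace e₀))) := hc (D.white⁻¹ x)
      linarith [ht0 x, hc x]
    · obtain ⟨x, rfl⟩ := Quotient.exists_rep f
      simp only [Sum.elim_inr, mul_one]
      exact hc x
  omega

namespace SweepOrder

variable (S : SweepOrder D)

/-- Differences of points of the sweep are sums of windings, and two such differences are
independent. -/
theorem windingMap_surjective (S : SweepOrder D) (m : D.Marking) : Function.Surjective (windingMap (D := D) m) := by
  obtain ⟨i, j, k, hi, hj, hk, harea⟩ := S.exists_noncollinear m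
  set W := LinearMap.range (windingMap (D := D) m) with hW
  have hz : ∀ z, toPlane (strandWinding m z) ∈ W := by
    intro z
    refine ⟨Pi.single z 1, ?_⟩
    rw [windingMap, Fintype.linearCombination_apply, Finset.sum_eq_single z]
    · simp
    · intro b _ hb; simp [hb]
    · simp
  have hp : ∀ k ≤ Fintype.card (Cycles D.zigzagPerm),
      toPlane (S.point m k) - toPlane (S.point m 0) ∈ W := by
    intro k
    induction k with
    | zero => intro _; rw [sub_self]; exact W.zero_mem
    | succ k ih =>
      intro hk
      have := W.add_mem (ih (by omega)) (hz (S.rank.symm ⟨k, hk⟩))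
      convert this using 1
      rw [S.point_succ hk]
      simp only [toPlane, Prod.fst_add, Prod.snd_add, Int.cast_add, Prod.mk_sub_mk,
        Prod.mk_add_mk]
      ext <;> simp <;> ring
  set u := toPlane (S.point m j) - toPlane (S.point m i) with hu
  set v := toPlane (S.point m k) - toPlane (S.point m i) with hv
  have huW : u ∈ W := by
    have := W.sub_mem (hp j hj.le) (hp i hi.le)
    rwa [sub_sub_sub_cancel_right] at this
  have hvW : v ∈ W := by
    have := W.sub_mem (hp k hk.le) (hp i hi.le)
    rwa [sub_sub_sub_cancel_right] at this
  have hd : det2 u v ≠ 0 := by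
    intro h
    rw [triangleArea_eq, planeArea, ← hu, ← hv, h] at harea
    simp at harea
  intro y
  have hy : y = (det2 y v / det2 u v) • u + (det2 u y / det2 u v) • v := by
    have h1 : det2 u v = u.1 * v.2 - u.2 * v.1 := rfl
    ext
    · simp only [Prod.fst_add, Prod.smul_fst, smul_eq_mul]
      rw [div_mul_eq_mul_div, div_mul_eq_mul_div, ← add_div, eq_div_iff hd]
      simp only [det2]; ring
    · simp only [Prod.snd_add, Prod.smul_snd, smul_eq_mul]
      rw [div_mul_eq_mul_div, div_mul_eq_mul_div, ← add_div, eq_div_iff hd]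
      simp only [det2]; ring
  rw [hy]
  exact W.add_mem (W.smul_mem _ huW) (W.smul_mem _ hvW)

theorem card_pos : 0 < Fintype.card (Cycles D.zigzagPerm) := by
  obtain ⟨e⟩ := D.nonempty
  exact Fintype.card_pos_iff.2 ⟨D.strand e⟩

theorem exists_fin {k : ℕ} (hk : k ≤ Fintype.card (Cycles D.zigzagPerm)) :
    ∃ i : Fin (Fintype.card (Cycles D.zigzagPerm)), S.mat i = S.mat k := by
  rcases hk.lt_or_eq with h | rfl
  · exact ⟨⟨k, h⟩, rfl⟩
  · exact ⟨⟨0, card_pos⟩, S.mat_card.symm⟩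

theorem zeta_eq (z : Cycles D.zigzagPerm) : ∃ i j : Fin (Fintype.card (Cycles D.zigzagPerm)),
    D.zeta z = (1 / 2 : ℝ) • (delta (S.mat j) - delta (S.mat i)) := by
  obtain ⟨j, hj⟩ := S.exists_fin (k := S.rank z + 1) (S.rank z).isLt
  refine ⟨S.rank z, j, ?_⟩
  rw [hj, S.delta_mat_succ (S.rank z).isLt, smul_smul]
  simp

/-- The span contains one `delta` and every `zeta`, so its dimension is at least the number of
paths, which is the number of vectors. -/
theorem linearIndependent : LinearIndependent ℝ
    fun i : Fin (Fintype.card (Cycles D.zigzagPerm)) => (delta (S.mat i) : E → ℝ) := by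
  rw [linearIndependent_iff_card_le_finrank_span, Fintype.card_fin]
  have hmem : ∀ i : Fin (Fintype.card (Cycles D.zigzagPerm)), (delta (S.mat i) : E → ℝ) ∈
      Submodule.span ℝ (Set.range fun i : Fin (Fintype.card (Cycles D.zigzagPerm)) =>
        (delta (S.mat i) : E → ℝ)) := fun i => Submodule.subset_span (Set.mem_range_self i)
  refine card_strands_le_finrank (S.isPerfectMatching 0) (hmem ⟨0, card_pos⟩) fun z => ?_
  obtain ⟨i, j, h⟩ := S.zeta_eq z
  rw [h]
  exact Submodule.smul_mem _ _ (Submodule.sub_mem _ (hmem j) (hmem i))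

/-- Both dimensions are the number of paths minus one: from below by adjoining one `delta`, from
above by `finrank_ker_chargeMatrix`. -/
theorem ker_eq_span (S : SweepOrder D) (m : D.Marking) : Submodule.span ℝ (Set.range (D.zeta)) =
    LinearMap.ker D.chargeMatrix.mulVecLin := by
  have hle : Submodule.span ℝ (Set.range (D.zeta)) ≤ LinearMap.ker D.chargeMatrix.mulVecLin := by
    rw [Submodule.span_le]
    rintro _ ⟨z, rfl⟩
    exact zeta_mem_ker z
  refine Submodule.eq_of_le_of_finrank_le hle ?_
  have h1 := finrank_ker_chargeMatrix m (S.windingMap_surjective m)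
  have h2 := card_strands_le_finrank (V := Submodule.span ℝ (Set.range (D.zeta)) ⊔
    Submodule.span ℝ {(delta (S.mat 0) : E → ℝ)}) (S.isPerfectMatching 0)
    (Submodule.mem_sup_right (Submodule.mem_span_singleton_self _))
    (fun z => Submodule.mem_sup_left (Submodule.subset_span (Set.mem_range_self z)))
  have h3 := Submodule.finrank_add_le_finrank_add_finrank (Submodule.span ℝ (Set.range (D.zeta)))
    (Submodule.span ℝ {(delta (S.mat 0) : E → ℝ)})
  have h4 : Module.finrank ℝ (Submodule.span ℝ {(delta (S.mat 0) : E → ℝ)}) ≤ 1 :=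
    (finrank_span_le_card _).trans (by simp)
  omega

theorem mem_chargeAssignments_iff_exists (m : D.Marking) (R : E → ℝ) : R ∈ D.chargeAssignments ↔
    ∃ lam : Fin (Fintype.card (Cycles D.zigzagPerm)) → ℝ,
      ∑ i, lam i = 1 ∧ R = ∑ i, lam i • delta (S.mat i) := by
  have h0 := S.delta_mem 0 (Nat.zero_le _)
  rw [mem_chargeAssignments_iff h0]
  constructor
  · intro h
    rw [← S.ker_eq_span m] at h
    have hle : Submodule.span ℝ (Set.range (D.zeta)) ≤
        Submodule.map (Fintype.linearCombination ℝ
          fun i : Fin (Fintype.card (Cycles D.zigzagPerm)) => (delta (S.mat i) : E → ℝ))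
        (LinearMap.ker (Fintype.linearCombination ℝ
          fun _ : Fin (Fintype.card (Cycles D.zigzagPerm)) => (1 : ℝ))) := by
      rw [Submodule.span_le]
      rintro _ ⟨z, rfl⟩
      obtain ⟨i, j, hz⟩ := S.zeta_eq z
      refine ⟨(1 / 2 : ℝ) • (Pi.single j 1 - Pi.single i 1), ?_, ?_⟩
      · simp [Fintype.linearCombination_apply]
      · rw [hz, map_smul, map_sub, Fintype.linearCombination_apply_single,
          Fintype.linearCombination_apply_single, one_smul, one_smul]
    obtain ⟨μ, hμ, he⟩ := hle h
    refine ⟨μ + Pi.single ⟨0, card_pos⟩ 1, ?_, ?_⟩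
    · have : ∑ i, μ i = 0 := by
        simpa [Fintype.linearCombination_apply] using hμ
      simp [Finset.sum_add_distrib, this]
    · have e1 : ∑ i : Fin (Fintype.card (Cycles D.zigzagPerm)),
          (μ + Pi.single ⟨0, card_pos⟩ 1 : Fin (Fintype.card (Cycles D.zigzagPerm)) → ℝ) i • (delta (S.mat i) : E → ℝ) =
          Fintype.linearCombination ℝ
          (fun i : Fin (Fintype.card (Cycles D.zigzagPerm)) => (delta (S.mat i) : E → ℝ))
          (μ + Pi.single ⟨0, card_pos⟩ 1) := rfl
      rw [e1, map_add, he, Fintype.linearCombination_apply_single, one_smul, sub_add_cancel]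
  · rintro ⟨lam, hlam, rfl⟩
    have : ∑ i, lam i • (delta (S.mat i) : E → ℝ) - delta (S.mat 0) =
        ∑ i, lam i • ((delta (S.mat i) : E → ℝ) - delta (S.mat 0)) := by
      simp only [smul_sub, Finset.sum_sub_distrib, ← Finset.sum_smul, hlam, one_smul]
    rw [this]
    exact Submodule.sum_mem _ fun i _ => Submodule.smul_mem _ _
      ((mem_chargeAssignments_iff h0).1 (S.delta_mem i i.isLt.le))

/-- Because the weights add up to one, both the shift by `1` and the constant `F` can be made
homogeneous of degree three. -/
theorem anomaly_eq (m : D.Marking) (N : ℕ)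
    (lam : Fin (Fintype.card (Cycles D.zigzagPerm)) → ℝ) (hlam : ∑ i, lam i = 1) :
    D.anomaly N (∑ i, lam i • delta (S.mat i)) = 9 * (N : ℝ) ^ 2 / 4 *
      ∑ i : Fin (Fintype.card (Cycles D.zigzagPerm)),
      ∑ j : Fin (Fintype.card (Cycles D.zigzagPerm)),
      ∑ k : Fin (Fintype.card (Cycles D.zigzagPerm)),
      triangleArea (S.point m i) (S.point m j) (S.point m k) * lam i * lam j * lam k := by
  have h1 : ∀ e, (∑ i, lam i • (delta (S.mat i) : E → ℝ)) e - 1 =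
      ∑ i, lam i * (delta (S.mat i) e - 1) := by
    intro e
    simp only [Finset.sum_apply, Pi.smul_apply, smul_eq_mul, mul_sub, mul_one,
      Finset.sum_sub_distrib, hlam]
  have hcube : ∀ g : Fin (Fintype.card (Cycles D.zigzagPerm)) → ℝ,
      (∑ i, g i) ^ 3 = ∑ i, ∑ j, ∑ k, g i * g j * g k := by
    intro g
    rw [pow_succ, pow_two, Finset.sum_mul_sum, Finset.sum_mul]
    refine Finset.sum_congr rfl fun i _ => ?_
    rw [Finset.sum_mul]
    refine Finset.sum_congr rfl fun j _ => ?_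
    rw [Finset.mul_sum]
  have h2 : ∑ e, ((∑ i, lam i • (delta (S.mat i) : E → ℝ)) e - 1) ^ 3 =
      ∑ i : Fin (Fintype.card (Cycles D.zigzagPerm)),
      ∑ j : Fin (Fintype.card (Cycles D.zigzagPerm)),
      ∑ k : Fin (Fintype.card (Cycles D.zigzagPerm)), triple (S.mat i) (S.mat j) (S.mat k) * lam i * lam j * lam k := by
    simp only [h1, hcube]
    rw [Finset.sum_comm]
    refine Finset.sum_congr rfl fun i _ => ?_
    rw [Finset.sum_comm]
    refine Finset.sum_congr rfl fun j _ => ?_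
    rw [Finset.sum_comm]
    refine Finset.sum_congr rfl fun k _ => ?_
    rw [triple, Finset.sum_mul, Finset.sum_mul, Finset.sum_mul]
    refine Finset.sum_congr rfl fun e _ => by ring
  have h3 : (Fintype.card D.Face : ℝ) =
      ∑ i, ∑ j, ∑ k, (Fintype.card D.Face : ℝ) * lam i * lam j * lam k := by
    have := hcube lam
    rw [hlam, one_pow] at this
    nth_rewrite 1 [← mul_one (Fintype.card D.Face : ℝ), this]
    simp only [Finset.mul_sum, mul_assoc]
  rw [anomaly, h2]
  nth_rewrite 1 [h3]
  simp only [← Finset.sum_add_distrib, Finset.mul_sum]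
  refine Finset.sum_congr rfl fun i _ => Finset.sum_congr rfl fun j _ =>
    Finset.sum_congr rfl fun k _ => ?_
  have := S.triple_mat_eq (m := m) i.isLt.le j.isLt.le k.isLt.le
  linear_combination (9 * (N : ℝ) ^ 2 / 32 * lam i * lam j * lam k) * this

end SweepOrder

end Dimension

end Dimer

/-! ### Windings are primitive -/

namespace Dimer

section Primitive

open Classical

variable {E : Type*} [Fintype E] {D : Dimer E} {m : D.Marking}

theorem exists_eq_smul_of_wedge_eq_zero {w x : ℤ × ℤ} (hw : IsCoprime w.1 w.2)
    (h : wedge w x = 0) : ∃ c : ℤ, x = c • w := by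
  obtain ⟨a, b, hab⟩ := hw
  rw [wedge] at h
  refine ⟨a * x.1 + b * x.2, Prod.ext ?_ ?_⟩
  · simp only [Prod.smul_fst, smul_eq_mul]
    linear_combination (-x.1) * hab - b * h
  · simp only [Prod.smul_snd, smul_eq_mul]
    linear_combination (-x.2) * hab + a * h

/-- The winding of a zigzag path that does not meet itself is primitive or zero. -/
theorem isCoprime_winding (hs : ∀ e, D.strand e ≠ D.strand (D.white⁻¹ e)) (e₀ : E)
    (h0 : D.winding m e₀ ≠ 0) : IsCoprime (D.winding m e₀).1 (D.winding m e₀).2 := by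
  rw [Int.isCoprime_iff_gcd_eq_one]
  by_contra hq1
  set q : ℕ := Int.gcd (D.winding m e₀).1 (D.winding m e₀).2 with hq
  have hq0 : q ≠ 0 := fun h => h0 (Prod.ext (Int.gcd_eq_zero_iff.1 h).1 (Int.gcd_eq_zero_iff.1 h).2)
  have hq2 : 2 ≤ q := by omega
  obtain ⟨a, ha⟩ : (q : ℤ) ∣ (D.winding m e₀).1 := Int.gcd_dvd_left ..
  obtain ⟨b, hb⟩ : (q : ℤ) ∣ (D.winding m e₀).2 := Int.gcd_dvd_right ..
  obtain ⟨φ, η, hφ, hη, h⟩ := m.exists_zigzag_potential e₀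
  set z := D.strand e₀ with hz
  -- If `q ≥ 2` divides the winding, the crossing cochain is exact modulo `q`. The potentials below
  -- are normalized to make the white one vanish at `e₀`.
  set G := AddSubgroup.zmultiples (q : ℝ) with hG
  have h1G : (1 : ℝ) ∉ G := by
    rintro ⟨n, hn⟩
    simp only [zsmul_eq_mul] at hn
    have hn : n * (q : ℤ) = 1 := by exact_mod_cast hn
    have := Int.eq_one_of_dvd_one (by omega) (Dvd.intro_left n hn)
    omega
  set f : E → ℝ := fun e => φ e - φ e₀ with hf
  set g : E → ℝ := fun e => η e + φ e₀ with hg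
  have hcG : ∀ e, D.chi z e + D.chi z (D.white⁻¹ e) - f e - g e ∈ G := by
    intro e
    refine ⟨b * (m.crossing e).1 - a * (m.crossing e).2, ?_⟩
    simp only [zsmul_eq_mul, hf, hg, h, ha, hb]
    push_cast
    ring
  have hfw : ∀ e, f (D.white e) = f e := fun e => by simp only [hf, hφ]
  have hgb : ∀ e, g (D.black e) = g e := fun e => by simp only [hg, hη]
  -- Along the path the white potential is `0` and the black one `1` modulo `q`.
  have hone : ∀ e, D.chi z e + D.chi z (D.white⁻¹ e) = 0 ∨
      (D.chi z e + D.chi z (D.white⁻¹ e) = 1 ∧ f e ∈ G ∧ g e - 1 ∈ G) := by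
    have hstr : ∀ x, D.strand x = z → f x ∈ G := by
      intro x hx
      refine forall_strand (P := fun y => D.strand y = z → f y ∈ G) (fun y ih hy => ?_)
        (fun _ => ?_) hx.symm hx
      · rw [strand_zigzag] at hy
        have e1 := hcG (D.white y)
        have e2 := hcG (D.zigzagPerm y)
        have n1 : D.strand (D.white y) ≠ z := fun h1 => by
          apply hs (D.white y)
          rw [perm_inv_apply, h1, hy]
        have n2 : D.strand (D.white⁻¹ (D.zigzagPerm y)) ≠ z := fun h1 => by
          apply hs (D.zigzagPerm y)
          rw [strand_zigzag, h1, hy]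
        have e3 : g (D.white y) = g (D.zigzagPerm y) := by
          rw [zigzagPerm_apply, ← hgb (D.black⁻¹ _), perm_apply_inv]
        simp only [chi, perm_inv_apply, hy, n1, strand_zigzag, n2, if_true, if_false, hfw,
          e3] at e1 e2
        have := G.sub_mem (G.add_mem e1 (ih hy)) e2
        convert this using 1
        ring
      · simp only [hf, sub_self]
        exact G.zero_mem
    intro e
    have e1 := hcG e
    by_cases h1 : D.strand e = z
    · have h2 : D.strand (D.white⁻¹ e) ≠ z := fun h2 => hs e (h1.trans h2.symm)
      right
      simp only [chi, h1, h2, if_true, if_false] at e1 ⊢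
      refine ⟨by norm_num, hstr e h1, ?_⟩
      have := G.neg_mem (G.add_mem e1 (hstr e h1))
      convert this using 1
      ring
    · by_cases h2 : D.strand (D.white⁻¹ e) = z
      · right
        have h3 := hstr _ h2
        rw [← hfw, perm_apply_inv] at h3
        simp only [chi, h1, h2, if_true, if_false] at e1 ⊢
        refine ⟨by norm_num, h3, ?_⟩
        have := G.neg_mem (G.add_mem e1 h3)
        convert this using 1
        ring
      · left
        simp only [chi, h1, h2, if_false, add_zero]
  -- Off the path the two potentials are opposite modulo `q`, so by connectedness they take only the
  -- residues `0`, `-1` and `0`, `1`.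
  have hall : ∀ e, (f e ∈ G ∨ f e + 1 ∈ G) ∧ (g e ∈ G ∨ g e - 1 ∈ G) := by
    have hfg : ∀ e, (f e ∈ G ∨ f e + 1 ∈ G) → (g e ∈ G ∨ g e - 1 ∈ G) := by
      intro e he
      rcases hone e with h1 | ⟨-, -, h1⟩
      · have e1 := hcG e
        rw [h1] at e1
        rcases he with h2 | h2
        · left
          have := G.neg_mem (G.add_mem e1 h2)
          convert this using 1
          ring
        · right
          have := G.neg_mem (G.add_mem e1 h2)
          convert this using 1
          ring
      · exact Or.inr h1
    have hgf : ∀ e, (g e ∈ G ∨ g e - 1 ∈ G) → (f e ∈ G ∨ f e + 1 ∈ G) := by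
      intro e he
      rcases hone e with h1 | ⟨-, h1, -⟩
      · have e1 := hcG e
        rw [h1] at e1
        rcases he with h2 | h2
        · left
          have := G.neg_mem (G.add_mem e1 h2)
          convert this using 1
          ring
        · right
          have := G.neg_mem (G.add_mem e1 h2)
          convert this using 1
          ring
      · exact Or.inl h1
    have : ∀ e, f e ∈ G ∨ f e + 1 ∈ G := by
      refine forall_of_closed (D := D) (fun x hx => by rwa [hfw]) (fun x hx => hgf _ ?_)
        (x := e₀) (Or.inl ?_)
      · rw [hgb]
        exact hfg x hx
      · simp only [hf, sub_self]
        exact G.zero_mem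
    exact fun e => ⟨this e, hfg e (this e)⟩
  -- The lifts of these residues solve the equation exactly, so the cochain is exact over the reals
  -- and the winding would be zero.
  set F : E → ℝ := fun e => if f e ∈ G then 0 else -1 with hF
  set H : E → ℝ := fun e => if g e ∈ G then 0 else 1 with hH
  have hsum : ∀ e, D.chi z e + D.chi z (D.white⁻¹ e) =
      0 * (m.crossing e).1 + 0 * (m.crossing e).2 + F e + H e := by
    intro e
    rcases hone e with h1 | ⟨h1, h2, h3⟩
    · have e1 := hcG e
      have e2 : f e ∈ G ↔ g e ∈ G := by
        rw [h1] at e1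
        constructor
        · intro h2
          have := G.neg_mem (G.add_mem e1 h2)
          convert this using 1
          ring
        · intro h2
          have := G.neg_mem (G.add_mem e1 h2)
          convert this using 1
          ring
      rw [h1]
      simp only [hF, hH, e2]
      split_ifs <;> norm_num
    · have h4 : g e ∉ G := fun h4 => h1G (by
        have := G.sub_mem h4 h3
        rwa [sub_sub_cancel] at this)
      rw [h1]
      simp [hF, hH, h2, h4]
  obtain ⟨h2, h1⟩ := m.coeff_of_zigzag (D.chi z) F H 0 0 (chi_zigzag z)
    (fun e => by simp only [hF, hfw]) (fun e => by simp only [hH, hgb]) hsum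
  obtain ⟨g1, g2⟩ := sum_chi_winding m e₀
  rw [g2] at h2
  rw [g1] at h1
  refine h0 (Prod.ext ?_ ?_)
  · have : ((D.winding m e₀).1 : ℝ) = 0 := by linarith
    exact_mod_cast this
  · have : ((D.winding m e₀).2 : ℝ) = 0 := by linarith
    exact_mod_cast this

theorem toPlane_ne_zero_of_circularOrder {n : ℕ} {u : ℕ → ℤ × ℤ} (h : InCircularOrder n u)
    (hn : 0 < n) : u 0 ≠ 0 := by
  obtain ⟨θ, -, h⟩ := h
  obtain ⟨r, hr, h⟩ := h 0 hn
  intro h0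
  rw [h0] at h
  have h1 := congrArg Prod.fst h
  have h2 := congrArg Prod.snd h
  simp only [toPlane, Prod.fst_zero, Prod.snd_zero, Int.cast_zero] at h1 h2
  have := Real.cos_sq_add_sin_sq (θ 0)
  rw [(mul_eq_zero.1 h1.symm).resolve_left hr.ne',
    (mul_eq_zero.1 h2.symm).resolve_left hr.ne'] at this
  norm_num at this

theorem ProperlyOrdered.isCoprime_strandWinding (h : D.ProperlyOrdered m)
    (z : Cycles D.zigzagPerm) : IsCoprime (strandWinding m z).1 (strandWinding m z).2 := by
  refine isCoprime_winding (fun e he => h.2.2 e (winding_eq he)) z.out ?_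
  refine toPlane_ne_zero_of_circularOrder (h.1 z.out) (Function.minimalPeriod_pos_of_mem_periodicPts ?_)
  exact (Equiv.injective D.white).mem_periodicPts _

end Primitive

end Dimer

/-! ### Closed convex lattice paths with primitive steps -/

section LatticePaths

open Dimer

theorem toPlane_add (a b : ℤ × ℤ) : toPlane (a + b) = toPlane a + toPlane b := by
  simp [toPlane]

theorem toPlane_sub (a b : ℤ × ℤ) : toPlane (a - b) = toPlane a - toPlane b := by
  simp [toPlane]

theorem toPlane_smul (c : ℤ) (a : ℤ × ℤ) : toPlane (c • a) = (c : ℝ) • toPlane a := by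
  simp [toPlane]

theorem det2_toPlane (a b : ℤ × ℤ) : det2 (toPlane a) (toPlane b) = wedge a b := by
  simp [det2, toPlane, wedge]

theorem wedge_self (a : ℤ × ℤ) : wedge a a = 0 := by rw [wedge]; ring

theorem wedge_add_right (a b c : ℤ × ℤ) : wedge a (b + c) = wedge a b + wedge a c := by
  simp only [wedge, Prod.fst_add, Prod.snd_add]; ring

theorem wedge_sub_right (a b c : ℤ × ℤ) : wedge a (b - c) = wedge a b - wedge a c := by
  simp only [wedge, Prod.fst_sub, Prod.snd_sub]; ring

theorem wedge_smul_right (a b : ℤ × ℤ) (c : ℤ) : wedge a (c • b) = c * wedge a b := by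
  simp only [wedge, Prod.smul_fst, Prod.smul_snd, smul_eq_mul]; ring

theorem wedge_neg_left (a b : ℤ × ℤ) : wedge (-a) b = -wedge a b := by
  simp only [wedge, Prod.fst_neg, Prod.snd_neg]; ring

theorem eq_or_eq_neg_of_wedge_eq_zero {u v : ℤ × ℤ} (hu : IsCoprime u.1 u.2)
    (hv : IsCoprime v.1 v.2) (h : wedge u v = 0) : v = u ∨ v = -u := by
  obtain ⟨c, rfl⟩ := exists_eq_smul_of_wedge_eq_zero hu h
  obtain ⟨a, b, hab⟩ := hv
  simp only [Prod.smul_fst, Prod.smul_snd, smul_eq_mul] at hab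
  have : IsUnit c := IsUnit.of_mul_eq_one (a * u.1 + b * u.2) (by linear_combination hab)
  rcases Int.isUnit_iff.1 this with rfl | rfl
  · left; rw [one_smul]
  · right; rw [neg_one_smul]

/-- A closed lattice path of primitive steps that stays on the left of each of its steps. -/
structure ConvexPath (n : ℕ) (P w : ℕ → ℤ × ℤ) : Prop where
  pos : 0 < n
  period : ∀ k, P (k + n) = P k
  period_step : ∀ k, w (k + n) = w k
  succ : ∀ k, P (k + 1) = P k + w k
  coprime : ∀ k, IsCoprime (w k).1 (w k).2
  left : ∀ j k, 0 ≤ wedge (w k) (P j - P k)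
  noncollinear : ∃ i j k, wedge (P j - P i) (P k - P i) ≠ 0

namespace ConvexPath

variable {n : ℕ} {P w : ℕ → ℤ × ℤ}

theorem exists_pos (h : ConvexPath n P w) (k : ℕ) : ∃ j, 0 < wedge (w k) (P j - P k) := by
  by_contra! hn
  have h0 : ∀ j, ∃ c : ℤ, P j - P k = c • w k := fun j =>
    exists_eq_smul_of_wedge_eq_zero (h.coprime k) (le_antisymm (hn j) (h.left j k))
  obtain ⟨i, j, l, hne⟩ := h.noncollinear
  obtain ⟨a, ha⟩ := h0 i
  obtain ⟨b, hb⟩ := h0 j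
  obtain ⟨c, hc⟩ := h0 l
  apply hne
  rw [← sub_sub_sub_cancel_right (P j) (P i) (P k), ← sub_sub_sub_cancel_right (P l) (P i) (P k),
    ha, hb, hc, ← sub_smul, ← sub_smul]
  simp only [wedge, Prod.smul_fst, Prod.smul_snd, smul_eq_mul]
  ring

theorem wedge_step (h : ConvexPath n P w) (k : ℕ) : 0 ≤ wedge (w k) (w (k + 1)) := by
  have h1 := h.left (k + 1 + 1) k
  rw [h.succ (k + 1), h.succ k, add_assoc, add_sub_cancel_left, wedge_add_right, wedge_self,
    zero_add] at h1
  exact h1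

/-- Primitive parallel steps agree up to sign. Turning back is impossible, since some point lies
strictly to the left. -/
theorem step_eq (h : ConvexPath n P w) (k : ℕ) (h0 : wedge (w k) (w (k + 1)) = 0) : w (k + 1) = w k := by
  rcases eq_or_eq_neg_of_wedge_eq_zero (h.coprime k) (h.coprime (k + 1)) h0 with h1 | h1
  · exact h1
  · obtain ⟨j, hj⟩ := h.exists_pos k
    have h2 := h.left j (k + 1)
    rw [h1, h.succ, ← sub_sub, wedge_neg_left, wedge_sub_right, wedge_self] at h2
    omega

/-- If the path turned left before reaching `P k + c w k`, this point would lie strictly to the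
right of the step after the turn. -/
theorem line_up (h : ConvexPath n P w) {k c : ℕ} (hr : ∀ l, 0 ≤ wedge (w l) (P k + (c : ℤ) • w k - P l)) {i : ℕ}
    (hi : i ≤ c) : P (k + i) = P k + (i : ℤ) • w k := by
  have key : ∀ i < c, P (k + i) = P k + (i : ℤ) • w k ∧ w (k + i) = w k := by
    intro i
    induction i with
    | zero => intro _; simp
    | succ i ih =>
      intro hi
      obtain ⟨h1, h2⟩ := ih (by omega)
      have h3 : P (k + (i + 1)) = P k + ((i + 1 : ℕ) : ℤ) • w k := by
        rw [← add_assoc, h.succ, h1, h2]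
        push_cast
        rw [add_smul, one_smul, add_assoc]
      refine ⟨h3, ?_⟩
      have h4 := hr (k + (i + 1))
      rw [h3, add_sub_add_left_eq_sub, ← sub_smul, wedge_smul_right] at h4
      have h5 : 0 ≤ wedge (w (k + (i + 1))) (w k) :=
        nonneg_of_mul_nonneg_right h4 (by push_cast; omega)
      have h6 := h.wedge_step (k + i)
      rw [h2] at h6
      have h7 := h.step_eq (k + i) (by
        rw [h2]
        refine le_antisymm ?_ h6
        have : wedge (w k) (w (k + i + 1)) = -wedge (w (k + (i + 1))) (w k) := by
          rw [← add_assoc]; simp only [wedge]; ring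
        omega)
      rw [← add_assoc, h7, h2]
  rcases hi.lt_or_eq with hi | rfl
  · exact (key i hi).1
  · rcases i with _ | i
    · simp
    · obtain ⟨h1, h2⟩ := key i (by omega)
      rw [← add_assoc, h.succ, h1, h2]
      push_cast
      rw [add_smul, one_smul, add_assoc]

theorem line_down (h : ConvexPath n P w) {k c : ℕ} (hck : c ≤ k)
    (hr : ∀ l, 0 ≤ wedge (w l) (P k - (c : ℤ) • w k - P l)) {i : ℕ} (hi : i ≤ c) :
    P (k - i) = P k - (i : ℤ) • w k ∧ w (k - i) = w k := by
  induction i with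
  | zero => simp
  | succ i ih =>
    obtain ⟨h1, h2⟩ := ih (by omega)
    obtain ⟨s, hs⟩ : ∃ s, k - i = s + 1 := ⟨k - i - 1, by omega⟩
    have hs' : k - (i + 1) = s := by omega
    rw [hs] at h1 h2
    rw [hs']
    have h3 := h.succ s
    have h4 := hr s
    have h5 : P k - (c : ℤ) • w k - P s = w s - ((c : ℤ) - i) • w k := by
      rw [h1] at h3
      rw [sub_smul, eq_sub_of_add_eq h3.symm]
      abel
    rw [h5, wedge_sub_right, wedge_self, wedge_smul_right, zero_sub, neg_nonneg] at h4
    have h6 : wedge (w s) (w k) ≤ 0 := nonpos_of_mul_nonpos_right h4 (by omega)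
    have h7 := h.wedge_step s
    have h8 := h.step_eq s (le_antisymm (h2 ▸ h6) h7)
    have h9 : w s = w k := h8.symm.trans h2
    refine ⟨?_, h9⟩
    rw [h9] at h3
    rw [eq_sub_of_add_eq h3.symm, h1]
    push_cast
    rw [add_smul, one_smul]
    abel

theorem period_mul (h : ConvexPath n P w) (k c : ℕ) : P (k + c * n) = P k ∧ w (k + c * n) = w k := by
  induction c with
  | zero => simp
  | succ c ih => rw [Nat.succ_mul, ← add_assoc, h.period, h.period_step]; exact ih

/-- A lattice point of the polygon on the line of a step is a point of the path. -/
theorem exists_of_line (h : ConvexPath n P w) {k : ℕ} {r : ℤ × ℤ} (hr : ∀ l, 0 ≤ wedge (w l) (r - P l))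
    (hk : wedge (w k) (r - P k) = 0) : ∃ l, P l = r := by
  obtain ⟨c, hc⟩ := exists_eq_smul_of_wedge_eq_zero (h.coprime k) hk
  obtain rfl : r = P k + c • w k := by rw [← hc, add_sub_cancel]
  rcases Int.eq_nat_or_neg c with ⟨c, rfl | rfl⟩
  · exact ⟨_, h.line_up hr le_rfl⟩
  · obtain ⟨h1, h2⟩ := h.period_mul k c
    -- Going around `c` times first keeps the subtraction of indices from truncating.
    have h3 := h.line_down (k := k + c * n) (c := c)
      ((Nat.le_mul_of_pos_right c h.pos).trans (Nat.le_add_left _ _))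
      (by rw [h1, h2, sub_eq_add_neg (P k), ← neg_smul]; exact hr) le_rfl
    refine ⟨_, h3.1.trans ?_⟩
    rw [h1, h2, sub_eq_add_neg, ← neg_smul]

/-- Lattice points on the line of a step that differ by the step are met in succession. -/
theorem exists_succ_of_line (h : ConvexPath n P w) {k : ℕ} {a : ℤ}
    (hr : ∀ l, 0 ≤ wedge (w l) (P k + a • w k - P l))
    (hr' : ∀ l, 0 ≤ wedge (w l) (P k + (a + 1) • w k - P l)) :
    ∃ l, P l = P k + a • w k ∧ P (l + 1) = P k + (a + 1) • w k := by
  rcases Int.eq_nat_or_neg a with ⟨c, rfl | rfl⟩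
  · have hr' : ∀ l, 0 ≤ wedge (w l) (P k + ((c + 1 : ℕ) : ℤ) • w k - P l) := by
      push_cast; exact hr'
    refine ⟨k + c, h.line_up hr' (by omega), ?_⟩
    rw [add_assoc, h.line_up hr' (i := c + 1) le_rfl]
    push_cast; rfl
  · obtain ⟨h1, h2⟩ := h.period_mul k c
    have h3 := h.line_down (k := k + c * n) (c := c)
      ((Nat.le_mul_of_pos_right c h.pos).trans (Nat.le_add_left _ _))
      (by rw [h1, h2, sub_eq_add_neg (P k), ← neg_smul]; exact hr) le_rfl
    have h4 : P (k + c * n - c) = P k + (-(c : ℤ)) • w k := by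
      rw [h3.1, h1, h2, sub_eq_add_neg, ← neg_smul]
    refine ⟨_, h4, ?_⟩
    rw [h.succ, h4, h3.2, h2, add_smul, one_smul, add_assoc]

/-- The open polygon bounded by the path. -/
def inside (P w : ℕ → ℤ × ℤ) (n : ℕ) : Set (ℝ × ℝ) :=
  {y | ∀ k : Fin n, 0 < det2 (toPlane (w k)) (y - toPlane (P k))}

theorem isOpen_inside : IsOpen (inside P w n) := by
  have : inside P w n = ⋂ k : Fin n, {y | 0 < det2 (toPlane (w k)) (y - toPlane (P k))} := by
    ext y; simp [inside]
  rw [this]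
  refine isOpen_iInter_of_finite fun k => isOpen_lt continuous_const ?_
  unfold det2
  fun_prop

theorem exists_fin (h : ConvexPath n P w) (k : ℕ) : ∃ l : Fin n, P l = P k ∧ w l = w k := by
  refine ⟨⟨k % n, Nat.mod_lt _ h.pos⟩, ?_⟩
  have := h.period_mul (k % n) (k / n)
  rw [mul_comm, Nat.mod_add_div] at this
  exact ⟨this.1.symm, this.2.symm⟩

/-- The average of the vertices is strictly to the left of each step, because some vertex is. -/
theorem inside_nonempty (h : ConvexPath n P w) : (inside P w n).Nonempty := by
  refine ⟨(n : ℝ)⁻¹ • ∑ j : Fin n, toPlane (P j), fun k => ?_⟩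
  have hn' : (0 : ℝ) < n := by exact_mod_cast h.pos
  have e : det2 (toPlane (w k)) ((n : ℝ)⁻¹ • ∑ j : Fin n, toPlane (P j) - toPlane (P k)) =
      (n : ℝ)⁻¹ * ∑ j : Fin n, ((wedge (w k) (P j - P k) : ℤ) : ℝ) := by
    simp only [← det2_toPlane, toPlane_sub]
    simp only [det2, Prod.fst_sub, Prod.snd_sub, Prod.smul_fst, Prod.smul_snd, smul_eq_mul,
      Prod.fst_sum, Prod.snd_sum, Finset.sum_sub_distrib, ← Finset.mul_sum, Finset.sum_const,
      Finset.card_univ, Fintype.card_fin, nsmul_eq_mul]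
    field_simp
  rw [e]
  refine mul_pos (inv_pos.2 hn') (Finset.sum_pos' (fun j _ => by exact_mod_cast h.left j k) ?_)
  obtain ⟨j, hj⟩ := h.exists_pos k
  obtain ⟨l, hl, -⟩ := h.exists_fin j
  exact ⟨l, Finset.mem_univ _, by rw [hl]; exact_mod_cast hj⟩

/-- The three determinants, divided by that of the triangle `p`, `u`, `v`, give the barycentric
coordinates of `y`. -/
theorem mem_convexHull_of_det2 {p u v y : ℝ × ℝ} (h1 : 0 < det2 (u - p) (y - p))
    (h2 : det2 (v - p) (y - p) ≤ 0) (h3 : 0 < det2 (v - u) (y - u)) {K : Set (ℝ × ℝ)}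
    (hK : Convex ℝ K) (hp : p ∈ K) (hu : u ∈ K) (hv : v ∈ K) : y ∈ K := by
  have e : det2 (v - u) (y - u) = det2 (u - p) (v - p) + det2 (v - p) (y - p) -
      det2 (u - p) (y - p) := by
    simp only [det2, Prod.fst_sub, Prod.snd_sub]; ring
  set a := det2 (u - p) (y - p) with ha
  set b := det2 (v - p) (y - p) with hb
  set d := det2 (u - p) (v - p) with hd
  have hd0 : 0 < d := by linarith
  have hy : y = (1 - (a / d + -b / d)) • p + (-b / d) • u + (a / d) • v := by
    have g1 : d * (y.1 - p.1) = -b * (u.1 - p.1) + a * (v.1 - p.1) := by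
      rw [ha, hb, hd]; simp only [det2, Prod.fst_sub, Prod.snd_sub]; ring
    have g2 : d * (y.2 - p.2) = -b * (u.2 - p.2) + a * (v.2 - p.2) := by
      rw [ha, hb, hd]; simp only [det2, Prod.fst_sub, Prod.snd_sub]; ring
    ext
    · simp only [Prod.fst_add, Prod.smul_fst, smul_eq_mul]
      field_simp
      linear_combination g1
    · simp only [Prod.snd_add, Prod.smul_snd, smul_eq_mul]
      field_simp
      linear_combination g2
  have c1 : 0 ≤ 1 - (a / d + -b / d) := by
    rw [← add_div, sub_nonneg, div_le_one hd0]; linarith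
  rw [hy]
  have := hK.sum_mem (t := (Finset.univ : Finset (Fin 3)))
    (w := ![1 - (a / d + -b / d), -b / d, a / d]) (z := ![p, u, v])
    (fun i _ => by
      fin_cases i
      · exact c1
      · exact div_nonneg (by linarith) hd0.le
      · exact div_nonneg h1.le hd0.le)
    (by
      simp only [Fin.sum_univ_three, Matrix.cons_val]
      ring)
    (fun i _ => by fin_cases i <;> assumption)
  simpa [Fin.sum_univ_three] using this

/-- A convex set that contains the path contains the polygon that it bounds. -/
theorem inside_subset (h : ConvexPath n P w) {K : Set (ℝ × ℝ)} (hK : Convex ℝ K) (hP : ∀ k, toPlane (P k) ∈ K) :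
    inside P w n ⊆ K := by
  intro y hy
  -- Fan of triangles at `P 0`: at the first `j` where the next value is not positive, `y` lies in
  -- the triangle of `P 0`, `P j` and `P (j + 1)`.
  set f : ℕ → ℝ := fun j => det2 (toPlane (P j) - toPlane (P 0)) (y - toPlane (P 0)) with hf
  have hpos : ∀ k, 0 < det2 (toPlane (w k)) (y - toPlane (P k)) := fun k => by
    obtain ⟨l, h1, h2⟩ := h.exists_fin k
    rw [← h1, ← h2]; exact hy l
  have hstep : ∀ k, toPlane (w k) = toPlane (P (k + 1)) - toPlane (P k) := fun k => by
    rw [h.succ, toPlane_add, add_sub_cancel_left]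
  have h1 : 0 < f 1 := by
    have := hpos 0
    rwa [hstep] at this
  have h2 : ∃ j, f (j + 1) ≤ 0 := by
    refine ⟨n - 1, ?_⟩
    have : P (n - 1 + 1) = P 0 := by
      rw [Nat.sub_add_cancel h.pos, ← h.period 0, zero_add]
    simp only [hf, this, sub_self]
    simp [det2]
  classical
  have h3 := Nat.find_spec h2
  set j := Nat.find h2 with hj
  have h4 : 0 < f j := by
    rcases Nat.eq_zero_or_pos j with h0 | h0
    · rw [h0] at h3
      exact absurd h3 (not_le.2 h1)
    · have := Nat.find_min h2 (m := j - 1) (by omega)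
      rw [Nat.sub_add_cancel h0] at this
      exact not_le.1 this
  have h5 := hpos j
  rw [hstep] at h5
  exact mem_convexHull_of_det2 h4 h3 h5 hK (hP 0) (hP j) (hP (j + 1))

end ConvexPath

end LatticePaths

/-! ### The sweep gives the area form -/

namespace Dimer

section AreaForm

open Classical AreaCubic

variable {E : Type*} [Fintype E] {D : Dimer E} {m : D.Marking}

namespace SweepOrder

variable (S : SweepOrder D)

/-- `S.mat k` contains every edge that the path of rank `k` traverses from black to white. That is
half of its edges, and no perfect matching has more. -/
theorem wedge_nonneg (m : D.Marking) {M : Finset E} (hM : D.IsPerfectMatching M) {k : ℕ}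
    (hk : k < Fintype.card (Cycles D.zigzagPerm)) :
    0 ≤ wedge (strandWinding m (S.rank.symm ⟨k, hk⟩)) (D.latticePoint m M - S.point m k) := by
  have h := wedge_count m (S.isPerfectMatching k) hM (S.rank.symm ⟨k, hk⟩)
  rw [sum_chi_reindex] at h
  have h1 : ∑ x, D.chi (S.rank.symm ⟨k, hk⟩) x * ((delta M x - delta (S.mat k) x) +
      (delta M (D.white x) - delta (S.mat k) (D.white x))) ≤ 0 := by
    refine Finset.sum_nonpos fun x _ => ?_
    rw [chi]
    split_ifs with hx
    · have hl : S.lower x = k := by rw [lower, hx, Equiv.apply_symm_apply]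
      have hmem : x ∈ S.mat k := by
        rw [mem_mat, hl]
        have := S.lower_ne_upper x
        split_ifs <;> omega
      have e1 : (delta (S.mat k) x : ℝ) = 2 := by simp [delta, hmem]
      have e2 : (0 : ℝ) ≤ delta (S.mat k) (D.white x) := by
        rw [delta]; split_ifs <;> norm_num
      have := delta_add_white_le S.strand_ne hM x
      linarith
    · rw [zero_mul]
  have h2 : (2 : ℝ) * wedge (D.latticePoint m M - S.point m k)
      (strandWinding m (S.rank.symm ⟨k, hk⟩)) ≤ 0 := h ▸ h1
  have h3 : wedge (D.latticePoint m M - S.point m k)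
      (strandWinding m (S.rank.symm ⟨k, hk⟩)) ≤ 0 := by
    have : (wedge (D.latticePoint m M - S.point m k)
      (strandWinding m (S.rank.symm ⟨k, hk⟩)) : ℝ) ≤ 0 := by linarith
    exact_mod_cast this
  have h4 : ∀ a b : ℤ × ℤ, wedge a b = -wedge b a := fun a b => by rw [wedge, wedge]; ring
  rw [h4]
  omega

/-- The steps of the sweep, continued periodically. -/
noncomputable def cyclicStep (m : D.Marking) (k : ℕ) : ℤ × ℤ :=
  strandWinding m (S.rank.symm ⟨k % Fintype.card (Cycles D.zigzagPerm), Nat.mod_lt _ card_pos⟩)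

/-- The lattice points of the sweep, continued periodically. -/
noncomputable def cyclicPoint (m : D.Marking) (k : ℕ) : ℤ × ℤ :=
  S.point m (k % Fintype.card (Cycles D.zigzagPerm))

theorem cyclicPoint_of_lt {k : ℕ} (hk : k < Fintype.card (Cycles D.zigzagPerm)) :
    S.cyclicPoint m k = S.point m k := by
  rw [cyclicPoint, Nat.mod_eq_of_lt hk]

theorem mod_succ (k : ℕ) : S.mat ((k + 1) % Fintype.card (Cycles D.zigzagPerm)) =
    S.mat (k % Fintype.card (Cycles D.zigzagPerm) + 1) := by
  have h1 := Nat.mod_lt k (card_pos (D := D))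
  rw [← Nat.mod_add_mod]
  rcases Nat.lt_or_ge (k % Fintype.card (Cycles D.zigzagPerm) + 1)
    (Fintype.card (Cycles D.zigzagPerm)) with h | h
  · rw [Nat.mod_eq_of_lt h]
  · have h2 : k % Fintype.card (Cycles D.zigzagPerm) + 1 = Fintype.card (Cycles D.zigzagPerm) := by
      omega
    rw [h2, Nat.mod_self, S.mat_card]

theorem convexPath (hm : ∀ z : Cycles D.zigzagPerm,
    IsCoprime (strandWinding m z).1 (strandWinding m z).2) :
    ConvexPath (Fintype.card (Cycles D.zigzagPerm)) (S.cyclicPoint m) (S.cyclicStep m) where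
  pos := card_pos
  period k := by rw [cyclicPoint, cyclicPoint, Nat.add_mod_right]
  period_step k := by simp only [cyclicStep, Nat.add_mod_right]
  succ k := by
    rw [cyclicPoint, point, mod_succ, ← point, S.point_succ (Nat.mod_lt _ card_pos)]
    rfl
  coprime k := hm _
  left j k := S.wedge_nonneg m (S.isPerfectMatching _) _
  noncollinear := by
    obtain ⟨i, j, k, hi, hj, hk, h⟩ := S.exists_noncollinear m
    refine ⟨i, j, k, fun h0 => ?_⟩
    rw [S.cyclicPoint_of_lt hi, S.cyclicPoint_of_lt hj, S.cyclicPoint_of_lt hk] at h0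
    rw [triangleArea, h0] at h
    norm_num at h

theorem latticePoint_mem_toricDiagram {M : Finset E} (hM : D.IsPerfectMatching M) :
    toPlane (D.latticePoint m M) ∈ D.toricDiagram m :=
  subset_convexHull ℝ _ ⟨M, hM, rfl⟩

theorem point_mem (k : ℕ) : toPlane (S.cyclicPoint m k) ∈ D.toricDiagram m :=
  latticePoint_mem_toricDiagram (S.isPerfectMatching _)

theorem det2_nonneg {y : ℝ × ℝ} (hy : y ∈ D.toricDiagram m) (k : ℕ) :
    0 ≤ det2 (toPlane (S.cyclicStep m k)) (y - toPlane (S.cyclicPoint m k)) := by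
  set u : ℝ × ℝ := -turn (toPlane (S.cyclicStep m k)) with hu
  have hdot : ∀ x, dot2 u x = det2 (toPlane (S.cyclicStep m k)) x := fun x => by
    rw [hu, dot2_neg_left, dot2_turn, neg_neg]
  rw [← hdot, dot2_sub, sub_nonneg]
  refine convexHull_min ?_ (convex_halfplane u (dot2 u (toPlane (S.cyclicPoint m k)))) hy
  rintro _ ⟨M, hM, rfl⟩
  rw [Set.mem_ofPred_eq, ← sub_nonneg, ← dot2_sub, hdot, ← toPlane_sub, det2_toPlane]
  exact_mod_cast S.wedge_nonneg m hM _

/-- A point of the diagram strictly to the left of all steps is in the open polygon, hence in the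
interior. -/
theorem exists_line (hm : ∀ z : Cycles D.zigzagPerm,
    IsCoprime (strandWinding m z).1 (strandWinding m z).2) {y : ℝ × ℝ}
    (hy : y ∈ frontier (D.toricDiagram m)) : y ∈ D.toricDiagram m ∧ ∃ k,
      det2 (toPlane (S.cyclicStep m k)) (y - toPlane (S.cyclicPoint m k)) = 0 := by
  rw [isClosed_toricDiagram.frontier_eq] at hy
  refine ⟨hy.1, ?_⟩
  by_contra! hn
  exact hy.2 (interior_maximal ((S.convexPath hm).inside_subset (convex_convexHull ℝ _) S.point_mem)
    ConvexPath.isOpen_inside fun k => lt_of_le_of_ne (S.det2_nonneg hy.1 k) (hn k).symm)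

theorem interior_nonempty (S : SweepOrder D) (hm : ∀ z : Cycles D.zigzagPerm,
    IsCoprime (strandWinding m z).1 (strandWinding m z).2) :
    (interior (D.toricDiagram m)).Nonempty :=
  (S.convexPath hm).inside_nonempty.mono (interior_maximal
    ((S.convexPath hm).inside_subset (convex_convexHull ℝ _) S.point_mem)
    ConvexPath.isOpen_inside)

theorem point_mem_frontier (hm : ∀ z : Cycles D.zigzagPerm,
    IsCoprime (strandWinding m z).1 (strandWinding m z).2) (k : ℕ) :
    toPlane (S.cyclicPoint m k) ∈ frontier (D.toricDiagram m) := by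
  rw [isClosed_toricDiagram.frontier_eq]
  refine ⟨S.point_mem k, ?_⟩
  have h0 : toPlane (S.cyclicStep m k) ≠ 0 := fun h0 => by
    have h1 : S.cyclicStep m k = 0 := toPlane_injective (h0.trans (by simp [toPlane]; rfl))
    have h2 := (S.convexPath hm).coprime k
    rw [h1] at h2
    exact not_isCoprime_zero_zero h2
  refine notMem_interior_of_le (u := -turn (toPlane (S.cyclicStep m k)))
    (neg_ne_zero.2 (turn_ne_zero h0)) fun y hy => ?_
  rw [← sub_nonneg, ← dot2_sub, dot2_neg_left, dot2_turn, neg_neg]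
  exact S.det2_nonneg hy k

theorem wedge_nonneg_of_mem {r : ℤ × ℤ} (hr : toPlane r ∈ D.toricDiagram m) (l : ℕ) :
    0 ≤ wedge (S.cyclicStep m l) (r - S.cyclicPoint m l) := by
  have := S.det2_nonneg hr l
  rw [← toPlane_sub, det2_toPlane] at this
  exact_mod_cast this

theorem point_injective (S : SweepOrder D) (m : D.Marking) :
    Function.Injective fun i : Fin (Fintype.card (Cycles D.zigzagPerm)) =>
    S.point m i := by
  intro i j hij
  have h := S.mat_eq_of_point_eq (m := m) i.isLt.le j.isLt.le hij
  exact S.linearIndependent.injective (congrArg delta h)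

theorem range_point (hm : ∀ z : Cycles D.zigzagPerm,
    IsCoprime (strandWinding m z).1 (strandWinding m z).2) :
    (Set.range fun i : Fin (Fintype.card (Cycles D.zigzagPerm)) => S.point m i) =
      D.boundaryPoints m := by
  ext r
  constructor
  · rintro ⟨i, rfl⟩
    have := S.point_mem_frontier hm i
    rwa [S.cyclicPoint_of_lt i.isLt] at this
  · intro hr
    obtain ⟨hr, k, hk⟩ := S.exists_line hm hr
    rw [← toPlane_sub, det2_toPlane] at hk
    obtain ⟨l, rfl⟩ := (S.convexPath hm).exists_of_line (S.wedge_nonneg_of_mem hr)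
      (by exact_mod_cast hk)
    exact ⟨⟨l % _, Nat.mod_lt _ card_pos⟩, rfl⟩

/-- Consecutive boundary points are met in succession by the sweep. -/
theorem exists_of_consecutive (hm : ∀ z : Cycles D.zigzagPerm,
    IsCoprime (strandWinding m z).1 (strandWinding m z).2) {p q : ℤ × ℤ}
    (h : D.Consecutive m p q) : ∃ l, (S.cyclicPoint m l = p ∧ S.cyclicPoint m (l + 1) = q) ∨
      (S.cyclicPoint m l = q ∧ S.cyclicPoint m (l + 1) = p) := by
  obtain ⟨hne, hseg, honly⟩ := h
  have hp := S.exists_line hm (hseg (left_mem_segment ℝ _ _))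
  have hq := S.exists_line hm (hseg (right_mem_segment ℝ _ _))
  -- Neither end is to the right of the line that contains the midpoint, so both lie on it.
  obtain ⟨-, k, hk⟩ := S.exists_line hm (hseg (midpoint_mem_segment (𝕜 := ℝ) (toPlane p) (toPlane q)))
  have h1 := S.det2_nonneg hp.1 k
  have h2 := S.det2_nonneg hq.1 k
  have h3 : det2 (toPlane (S.cyclicStep m k)) (midpoint ℝ (toPlane p) (toPlane q) -
      toPlane (S.cyclicPoint m k)) =
      (det2 (toPlane (S.cyclicStep m k)) (toPlane p - toPlane (S.cyclicPoint m k)) +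
      det2 (toPlane (S.cyclicStep m k)) (toPlane q - toPlane (S.cyclicPoint m k))) / 2 := by
    rw [midpoint_eq_smul_add]
    simp only [det2, Prod.fst_sub, Prod.snd_sub, Prod.smul_fst, Prod.smul_snd, Prod.fst_add,
      Prod.snd_add, smul_eq_mul, invOf_eq_inv]
    ring
  have e1 : wedge (S.cyclicStep m k) (p - S.cyclicPoint m k) = 0 := by
    have : det2 (toPlane (S.cyclicStep m k)) (toPlane p - toPlane (S.cyclicPoint m k)) = 0 := by
      linarith
    rw [← toPlane_sub, det2_toPlane] at this
    exact_mod_cast this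
  have e2 : wedge (S.cyclicStep m k) (q - S.cyclicPoint m k) = 0 := by
    have : det2 (toPlane (S.cyclicStep m k)) (toPlane q - toPlane (S.cyclicPoint m k)) = 0 := by
      linarith
    rw [← toPlane_sub, det2_toPlane] at this
    exact_mod_cast this
  have hco := (S.convexPath hm).coprime k
  obtain ⟨a, ha⟩ := exists_eq_smul_of_wedge_eq_zero hco e1
  obtain ⟨b, hb⟩ := exists_eq_smul_of_wedge_eq_zero hco e2
  rw [sub_eq_iff_eq_add'] at ha hb
  have hw0 : S.cyclicStep m k ≠ 0 := fun h0 => by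
    rw [h0] at hco
    exact not_isCoprime_zero_zero hco
  -- the point that follows the first of the two points is the other one
  have key : ∀ {p q : ℤ × ℤ} {a b : ℤ}, (∀ r : ℤ × ℤ, toPlane r ∈ segment ℝ (toPlane p) (toPlane q) →
      r = p ∨ r = q) → toPlane p ∈ D.toricDiagram m → toPlane q ∈ D.toricDiagram m →
      p = S.cyclicPoint m k + a • S.cyclicStep m k →
      q = S.cyclicPoint m k + b • S.cyclicStep m k → a < b →
      ∃ l, S.cyclicPoint m l = p ∧ S.cyclicPoint m (l + 1) = q := by
    intro p q a b honly hp hq ha hb hab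
    have hab' : (0 : ℝ) < b - a := by
      rw [sub_pos]; exact_mod_cast hab
    -- One primitive step beyond `p` the segment contains a lattice point, and it can only be `q`.
    have hmem : toPlane (S.cyclicPoint m k + (a + 1) • S.cyclicStep m k) ∈
        segment ℝ (toPlane p) (toPlane q) := by
      refine ⟨1 - 1 / (b - a), 1 / (b - a), ?_, by positivity, by ring, ?_⟩
      · rw [sub_nonneg, div_le_one hab', le_sub_iff_add_le']
        exact_mod_cast hab
      · rw [ha, hb, toPlane_add, toPlane_add, toPlane_add, toPlane_smul, toPlane_smul,
          toPlane_smul]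
        push_cast
        ext <;> simp only [Prod.fst_add, Prod.snd_add, Prod.smul_fst, Prod.smul_snd,
          smul_eq_mul] <;> field_simp <;> ring
    have hq' : S.cyclicPoint m k + (a + 1) • S.cyclicStep m k = q := by
      refine (honly _ hmem).resolve_left fun h0 => hw0 ?_
      rw [ha, add_smul, one_smul, ← add_assoc] at h0
      exact add_eq_left.1 h0
    rw [ha] at hp
    rw [← hq'] at hq
    obtain ⟨l, h1, h2⟩ := (S.convexPath hm).exists_succ_of_line (S.wedge_nonneg_of_mem hp)
      (S.wedge_nonneg_of_mem hq)
    exact ⟨l, h1.trans ha.symm, h2.trans hq'⟩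
  rcases lt_trichotomy a b with hab | rfl | hab
  · obtain ⟨l, hl⟩ := key honly hp.1 hq.1 ha hb hab
    exact ⟨l, Or.inl hl⟩
  · exact absurd (ha.trans hb.symm) hne
  · obtain ⟨l, hl⟩ := key (fun r hr => (honly r (by rwa [segment_symm])).symm) hq.1 hp.1 hb ha hab
    exact ⟨l, Or.inr hl⟩

theorem symmDiff_mat_succ {k : ℕ} (hk : k < Fintype.card (Cycles D.zigzagPerm)) :
    ∃ e, symmDiff (S.mat k : Set E) (S.mat (k + 1) : Set E) = D.zigzagEdges e := by
  obtain ⟨e, he⟩ := Quotient.exists_rep (S.rank.symm ⟨k, hk⟩)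
  have he : S.rank.symm ⟨k, hk⟩ = D.strand e := he.symm
  have h := S.delta_mat_succ hk
  rw [he] at h
  refine ⟨e, ?_⟩
  ext x
  have hx := congrFun h x
  have hne := S.strand_ne x
  rw [mem_zigzagEdges, Set.mem_symmDiff, Finset.mem_coe, Finset.mem_coe]
  simp only [Pi.sub_apply, Pi.smul_apply, smul_eq_mul, zeta, chi, delta] at hx
  by_cases h1 : D.strand x = D.strand e
  · have h2 : D.strand (D.white⁻¹ x) ≠ D.strand e := fun h2 => hne (h1.trans h2.symm)
    by_cases h3 : x ∈ S.mat k <;> by_cases h4 : x ∈ S.mat (k + 1) <;>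
      simp only [h1, h2, h3, h4, if_true, if_false] at hx ⊢ <;> first | (exfalso; norm_num at hx; done) | norm_num
  · by_cases h2 : D.strand (D.white⁻¹ x) = D.strand e <;>
    by_cases h3 : x ∈ S.mat k <;> by_cases h4 : x ∈ S.mat (k + 1) <;>
      simp only [h1, h2, h3, h4, if_true, if_false] at hx ⊢ <;> first | (exfalso; norm_num at hx; done) | norm_num

/-- The matchings of the sweep are a basis of boundary matchings. -/
noncomputable def boundaryBasis (hm : ∀ z : Cycles D.zigzagPerm,
    IsCoprime (strandWinding m z).1 (strandWinding m z).2) : D.BoundaryBasis m where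
  polygon := S.interior_nonempty hm
  n := Fintype.card (Cycles D.zigzagPerm)
  point i := S.point m i
  point_injective := S.point_injective m
  range_point := S.range_point hm
  matching i := S.mat i
  isPerfectMatching i := S.isPerfectMatching i
  latticePoint_matching _ := rfl
  zigzag i j h := by
    obtain ⟨l, hl⟩ := S.exists_of_consecutive hm h
    obtain ⟨e, he⟩ := S.symmDiff_mat_succ (Nat.mod_lt l (card_pos (D := D)))
    rw [← S.mod_succ] at he
    -- A lattice point determines its matching in the sweep, so the cyclic index `l` may be
    -- exchanged for the given indices.
    have hmat : ∀ (l : ℕ) (i : Fin (Fintype.card (Cycles D.zigzagPerm))),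
        S.cyclicPoint m l = S.point m i →
        S.mat (l % Fintype.card (Cycles D.zigzagPerm)) = S.mat i := fun l i h =>
      S.mat_eq_of_point_eq (Nat.mod_lt l (card_pos (D := D))).le i.isLt.le h
    refine ⟨e, ?_⟩
    rcases hl with hl | hl
    · rw [hmat _ _ hl.1, hmat _ _ hl.2] at he
      exact he
    · rw [hmat _ _ hl.1, hmat _ _ hl.2, symmDiff_comm] at he
      exact he
  independent := S.linearIndependent
  spanning := S.mem_chargeAssignments_iff_exists m

end SweepOrder

theorem ProperlyOrdered.hasAreaForm (h : D.ProperlyOrdered m) : D.HasAreaForm m := by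
  obtain ⟨S⟩ := h.nonempty_sweepOrder
  exact ⟨S.boundaryBasis h.isCoprime_strandWinding, S.anomaly_eq m⟩

end AreaForm

end Dimer

theorem mainTheorem6 {E : Type*} [Fintype E] (D : Dimer E) (m : D.Marking) :
    (D.HasAreaForm m → D.SatisfiesUnitarityBound) ∧
      (D.ProperlyOrdered m → D.HasAreaForm m ∧ D.SatisfiesUnitarityBound) :=
  ⟨fun h => h.satisfiesUnitarityBound,
    fun h => ⟨h.hasAreaForm, h.hasAreaForm.satisfiesUnitarityBound⟩⟩
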